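/- Let $Q$ be a finite connected quiver and $d\in\mathbb{N}^{Q_0}$ a dimension vector such that $(Q,d)$ defines a linear free divisor $D$. That is: $d_i\ge 1$ for all vertices $i$; the divisor $D\subset \mathrm{Rep}(Q,d)=\bigoplus_{i\to j}\mathrm{Mat}_{d_j\times d_i}(\mathbb{C})$ is the discriminant (the complement of the open orbit) of the action $(g_i)\cdot(x_\alpha)=(g_{t\alpha}x_\alpha g_{s\alpha}^{-1})$ of $\mathrm{GL}(Q,d)=\prod_i\mathrm{GL}_{d_i}(\mathbb{C})$; the module $\mathrm{Der}(-\log D)$ of logarithmic vector fields along the reduced hypersurface $D$ is free with a basis of linear vector fields; and the largest connected subgroup of $\mathrm{GL}(\mathrm{Rep}(Q,d))$ preserving $D$ is $\mathrm{PGL}(Q,d)=\mathrm{GL}(Q,d)/\mathbb{C}^*\mathrm{id}$. Let $M\in D$ be a point whose corresponding representation of $Q$ is not regular, i.e. has an indecomposable direct summand $N$ which is preprojective ($\tau^kN$ is a nonzero projective $\mathbb{C}Q$-module for some $k\ge 0$, where $\tau N=\mathrm{Hom}_{\mathbb{C}}(\mathrm{Ext}^1_{\mathbb{C}Q}(N,\mathbb{C}Q),\mathbb{C})$)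 or preinjective ($\tau'^kN$ is a nonzero injective $\mathbb{C}Q$-module for some $k\ge0$, where $\tau' N=\mathrm{Ext}^1(\mathrm{Hom}_{\mathbb{C}}(N,\mathbb{C}),\mathbb{C}Q)$, the $\mathrm{Ext}$ being taken over right $\mathbb{C}Q$-modules). Then $D$ is weakly quasihomogeneous at $M$: in coordinates $x_1,\dots,x_n$ of $\mathrm{Rep}(Q,d)$ centred at $M$, there are a local defining equation $f$ of $D$ at $M$ (a generator of the ideal of $D$ in the local ring $\mathcal{O}_M$ of regular functions at $M$) and a matrix $A=(A_{ij})$ with entries in $\mathcal{O}_M$ such that $$f=\sum_{i,j=1}^n x_i\,A_{ij}\,\frac{\partial f}{\partial x_j}$$ and all eigenvalues of the complex matrix $A(0)$ (the value of $A$ at $M$) are non-negative real numbers. -/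

import Mathlib

/-! ## Local rings and logarithmic vector fields on affine space -/

noncomputable section AffineSpace

open MvPolynomial

variable {ι : Type}

instance evalKerIsPrime (p : ι → ℂ) : (RingHom.ker (MvPolynomial.eval p)).IsPrime :=
  RingHom.ker_isPrime _

/-- The local ring of regular functions at the point `p` of the affine space `ℂ^ι`:
the polynomial ring localized at the maximal ideal of polynomials vanishing at `p`. -/
abbrev LocalRingAt (p : ι → ℂ) : Type :=
  Localization.AtPrime (RingHom.ker (MvPolynomial.eval p))

/-- The value at `p` of a germ of a regular function. -/
def valueAt (p : ι → ℂ) : LocalRingAt p →+* ℂ :=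
  IsLocalization.lift (M := (RingHom.ker (MvPolynomial.eval p)).primeCompl)
    (g := MvPolynomial.eval p) (fun y => isUnit_iff_ne_zero.mpr y.2)

/-- The partial derivative `∂/∂x_j` on germs, given on a fraction `a / b` by the quotient rule.
It does not depend on the fraction chosen to represent the germ, see `partialAt_mk`. -/
def partialAt (p : ι → ℂ) (j : ι) (F : LocalRingAt p) : LocalRingAt p :=
  let ab := IsLocalization.sec (RingHom.ker (MvPolynomial.eval p)).primeCompl F
  Localization.mk (ab.2 * pderiv j ab.1 - ab.1 * pderiv j (ab.2 : MvPolynomial ι ℂ)) (ab.2 * ab.2)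

theorem quotientRule_aux (j : ι) (a b u v : MvPolynomial ι ℂ) (h : b * u = v * a) :
    b * b * (v * pderiv j u - u * pderiv j v) = v * v * (b * pderiv j a - a * pderiv j b) := by
  have h2 := congrArg (pderiv j) h
  simp only [Derivation.leibniz, smul_eq_mul] at h2
  linear_combination b * v * h2 - (b * pderiv j v + v * pderiv j b) * h

theorem partialAt_mk (p : ι → ℂ) (j : ι) (a : MvPolynomial ι ℂ)
    (b : (RingHom.ker (MvPolynomial.eval p)).primeCompl) :
    partialAt p j (Localization.mk a b) =
      Localization.mk ((b : MvPolynomial ι ℂ) * pderiv j a - a * pderiv j (b : MvPolynomial ι ℂ))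
        (b * b) := by
  have hs := IsLocalization.mk'_sec (M := (RingHom.ker (MvPolynomial.eval p)).primeCompl)
    (LocalRingAt p) (Localization.mk a b)
  unfold partialAt
  generalize IsLocalization.sec (RingHom.ker (MvPolynomial.eval p)).primeCompl
    (Localization.mk a b : LocalRingAt p) = u at hs ⊢
  obtain ⟨u, v⟩ := u
  rw [Localization.mk_eq_mk', IsLocalization.mk'_eq_iff_eq] at hs
  have h1 := IsLocalization.injective (LocalRingAt p)
    (Ideal.primeCompl_le_nonZeroDivisors (RingHom.ker (MvPolynomial.eval p))) hs
  have h2 := quotientRule_aux j a b u v h1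
  dsimp only
  rw [Localization.mk_eq_mk', IsLocalization.mk'_eq_iff_eq]
  exact congrArg _ h2

variable [Fintype ι] [DecidableEq ι]

/-- The vanishing ideal `I(D)` of a subset `D` of `ℂ^ι` in the polynomial ring. -/
abbrev idealOf (D : Set (ι → ℂ)) : Ideal (MvPolynomial ι ℂ) :=
  MvPolynomial.vanishingIdeal ℂ D

/-- `D` is an (algebraic, reduced) hypersurface: the zero set of one nonzero polynomial. -/
def IsHypersurface (D : Set (ι → ℂ)) : Prop :=
  ∃ f : MvPolynomial ι ℂ, f ≠ 0 ∧ D = {x | MvPolynomial.eval x f = 0}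

/-- The module `Der(-log D)` of logarithmic vector fields along `D`: the polynomial vector fields
`δ` with `δ(I(D)) ⊆ I(D)`.  As affine space is affine, this module of global sections determines
the (coherent) sheaf of logarithmic vector fields. -/
def logDer (D : Set (ι → ℂ)) :
    Submodule (MvPolynomial ι ℂ) (Derivation ℂ (MvPolynomial ι ℂ) (MvPolynomial ι ℂ)) where
  carrier := {δ | ∀ f ∈ idealOf D, δ f ∈ idealOf D}
  add_mem' hδ hε f hf := add_mem (hδ f hf) (hε f hf)
  zero_mem' _ _ := zero_mem _
  smul_mem' c _ hδ f hf := Ideal.mul_mem_left _ c (hδ f hf)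

/-- A vector field is linear if its coefficients are linear forms. -/
def IsLinearVectorField (δ : Derivation ℂ (MvPolynomial ι ℂ) (MvPolynomial ι ℂ)) : Prop :=
  ∀ j, (δ (X j)).IsHomogeneous 1

/-- `D` is a linear free divisor: a reduced hypersurface whose module of logarithmic vector fields
is free with a basis of linear vector fields. -/
def IsLinearFreeDivisor (D : Set (ι → ℂ)) : Prop :=
  IsHypersurface D ∧
    ∃ b : Module.Basis ι (MvPolynomial ι ℂ) (logDer D), ∀ k, IsLinearVectorField (b k).1

/-- `f` is a local defining equation of the reduced hypersurface `D` at `p`: it generates the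
stalk at `p` of the ideal of `D`. -/
def IsLocalEquation (D : Set (ι → ℂ)) (p : ι → ℂ) (f : LocalRingAt p) : Prop :=
  Ideal.span {f} = (idealOf D).map (algebraMap (MvPolynomial ι ℂ) (LocalRingAt p))

/-- `D` is weakly quasihomogeneous at `p`: with the coordinates `x_i - p_i` centred at `p`, some
local equation satisfies `f = ∑ (x_i - p_i) A_ij ∂f/∂x_j`, where all eigenvalues of the complex
matrix `A(p)` are non-negative real numbers. -/
def IsWeaklyQuasihomogeneousAt (D : Set (ι → ℂ)) (p : ι → ℂ) : Prop :=
  ∃ f : LocalRingAt p, IsLocalEquation D p f ∧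
    ∃ A : Matrix ι ι (LocalRingAt p),
      f = ∑ i, ∑ j, algebraMap (MvPolynomial ι ℂ) (LocalRingAt p) (X i - C (p i)) * A i j *
        partialAt p j f ∧
      ∀ μ ∈ spectrum ℂ (A.map (valueAt p)), ∃ r : ℝ, 0 ≤ r ∧ μ = (r : ℂ)

/-- `H` is the largest connected subgroup of `GL(ℂ^ι)` preserving `D`. -/
def IsLargestConnectedSubgroupPreserving (D : Set (ι → ℂ)) (H : Subgroup (GL ι ℂ)) : Prop :=
  IsGreatest {K : Subgroup (GL ι ℂ) |
    IsConnected (K : Set (GL ι ℂ)) ∧ ∀ g ∈ K, (fun x => g.1.mulVec x) '' D = D} H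

end AffineSpace

/-! ## Representations of a quiver -/

/-- A representation over `ℂ` of the quiver `Q` (of arbitrary dimension); for `Q` with finitely many
vertices this is the same as a left module over the path algebra `ℂQ`. -/
structure QRep (Q : Type) [Quiver.{0} Q] where
  V : Q → Type
  [addCommGroup : ∀ i, AddCommGroup (V i)]
  [module : ∀ i, Module ℂ (V i)]
  map : ∀ {i j : Q}, (i ⟶ j) → V i →ₗ[ℂ] V j

namespace QRep

noncomputable section

attribute [instance] QRep.addCommGroup QRep.module

variable {Q : Type} [Quiver.{0} Q]

/-- Homomorphisms of representations. -/
structure Hom (M N : QRep Q) where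
  app : ∀ i, M.V i →ₗ[ℂ] N.V i
  comm : ∀ {i j : Q} (a : i ⟶ j), N.map a ∘ₗ app i = app j ∘ₗ M.map a

/-- Two representations are isomorphic. -/
def IsIso (M N : QRep Q) : Prop := ∃ φ : Hom M N, ∀ i, Function.Bijective (φ.app i)

/-- The representation is zero. -/
def IsZero (M : QRep Q) : Prop := ∀ i, Subsingleton (M.V i)

/-- The direct sum `M ⊕ N`. -/
def sum (M N : QRep Q) : QRep Q where
  V i := M.V i × N.V i
  map a := LinearMap.prodMap (M.map a) (N.map a)

/-- `M` is indecomposable. -/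
def IsIndecomposable (M : QRep Q) : Prop :=
  ¬ M.IsZero ∧ ∀ A B : QRep Q, IsIso M (A.sum B) → A.IsZero ∨ B.IsZero

/-- `N` is (isomorphic to) a direct summand of `M`. -/
def IsSummand (N M : QRep Q) : Prop := ∃ N' : QRep Q, IsIso M (N.sum N')

/-- `M` is projective as a `ℂQ`-module. -/
def IsProjective (M : QRep Q) : Prop :=
  ∀ (A B : QRep Q) (g : Hom A B) (h : Hom M B), (∀ i, Function.Surjective (g.app i)) →
    ∃ l : Hom M A, ∀ i, g.app i ∘ₗ l.app i = h.app i

/-- `M` is injective as a `ℂQ`-module. -/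
def IsInjective (M : QRep Q) : Prop :=
  ∀ (A B : QRep Q) (g : Hom A B) (h : Hom A M), (∀ i, Function.Injective (g.app i)) →
    ∃ l : Hom B M, ∀ i, l.app i ∘ₗ g.app i = h.app i

/-- The map `c_{M,N} : ∏_i Hom(M_i, N_i) → ∏_{a : i → j} Hom(M_i, N_j)`,
`φ ↦ (φ_j M_a - N_a φ_i)_a`, obtained by applying `Hom_Q(-, N)` to the standard projective
resolution of `M`. -/
def ringel (M N : QRep Q) :
    (∀ i, M.V i →ₗ[ℂ] N.V i) →ₗ[ℂ] (∀ (i j : Q) (_ : i ⟶ j), M.V i →ₗ[ℂ] N.V j) where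
  toFun φ := fun i j a => φ j ∘ₗ M.map a - N.map a ∘ₗ φ i
  map_add' φ ψ := by
    funext i j a
    ext v
    simp only [Pi.add_apply, LinearMap.sub_apply, LinearMap.add_apply, LinearMap.comp_apply,
      map_add]
    abel
  map_smul' c φ := by
    funext i j a
    ext v
    simp [smul_sub]

/-- `Ext_Q(M, N) = Ext^1(M, N)`, computed by the standard projective resolution of `M`: the
cokernel of `c_{M,N}`. -/
abbrev Ext (M N : QRep Q) : Type :=
  (∀ (i j : Q) (_ : i ⟶ j), M.V i →ₗ[ℂ] N.V j) ⧸ LinearMap.range (ringel M N)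

/-- Postcomposition with `φ : N ⟶ N'` on families indexed by the arrows. -/
def postcomp (M : QRep Q) {N N' : QRep Q} (φ : Hom N N') :
    (∀ (i j : Q) (_ : i ⟶ j), M.V i →ₗ[ℂ] N.V j) →ₗ[ℂ]
      (∀ (i j : Q) (_ : i ⟶ j), M.V i →ₗ[ℂ] N'.V j) where
  toFun θ := fun i j a => φ.app j ∘ₗ θ i j a
  map_add' θ η := by
    funext i j a
    ext v
    simp
  map_smul' c θ := by
    funext i j a
    ext v
    simp

/-- Functoriality of `Ext_Q(M, N)` in `N`. -/
def extMap (M : QRep Q) {N N' : QRep Q} (φ : Hom N N') : Ext M N →ₗ[ℂ] Ext M N' :=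
  Submodule.mapQ _ _ (postcomp M φ) (by
    rintro _ ⟨ψ, rfl⟩
    refine ⟨fun i => φ.app i ∘ₗ ψ i, ?_⟩
    funext i j a
    ext v
    have h := LinearMap.congr_fun (φ.comm a) (ψ i v)
    simp only [LinearMap.comp_apply] at h
    simp [ringel, postcomp, h])

/-- The representation `P(i) = ℂQ e_i`, spanned by the paths starting at `i`. -/
def P (i : Q) : QRep Q where
  V k := Quiver.Path i k →₀ ℂ
  map a := Finsupp.lmapDomain ℂ ℂ (fun p => p.cons a)

/-- Right multiplication by the arrow `a : i → j` on the path algebra, `ℂQ e_j → ℂQ e_i`. -/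
def PMap {i j : Q} (a : i ⟶ j) : Hom (P j) (P i) where
  app _ := Finsupp.lmapDomain ℂ ℂ (fun p => a.toPath.comp p)
  comm b := by
    have h : ∀ {k l : Q} (b : k ⟶ l),
        Finsupp.lmapDomain ℂ ℂ (fun p : Quiver.Path i k => p.cons b) ∘ₗ
          Finsupp.lmapDomain ℂ ℂ (fun p : Quiver.Path j k => a.toPath.comp p) =
        Finsupp.lmapDomain ℂ ℂ (fun p : Quiver.Path j l => a.toPath.comp p) ∘ₗ
          Finsupp.lmapDomain ℂ ℂ (fun p : Quiver.Path j k => p.cons b) := by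
      intro k l b
      ext p : 2
      simp [Finsupp.mapDomain_single]
    exact h b

/-- The Auslander-Reiten translate `τ M = D Ext(M, ℂQ)`, where `D = Hom_ℂ(-, ℂ)`.  At the vertex
`i` the right module `Ext(M, ℂQ)` is `Ext(M, ℂQ) e_i = Ext(M, P(i))`. -/
def tau (M : QRep Q) : QRep Q where
  V i := Module.Dual ℂ (Ext M (P i))
  map a := (extMap M (PMap a)).dualMap

/-- The dual `D M = Hom_ℂ(M, ℂ)`, a right `ℂQ`-module, i.e. a representation of the
opposite quiver. -/
def dual (M : QRep Q) : QRep Qᵒᵖ where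
  V i := Module.Dual ℂ (M.V i.unop)
  map a := (M.map a.unop).dualMap

/-- The inverse translate `τ' M = Ext(D M, ℂQ)`, with `Ext` of right `ℂQ`-modules.  At the vertex
`i` it is `Ext(D M, e_i ℂQ)`, and `e_i ℂQ` is the representation `P(i)` of the opposite quiver. -/
def tauInv (M : QRep Q) : QRep Q where
  V i := Ext (dual M) (P (Opposite.op i))
  map a := extMap (dual M) (PMap a.op)

/-- `M` is preprojective: some `τ^k M` is a nonzero projective. -/
def IsPreprojective (M : QRep Q) : Prop :=
  ∃ k : ℕ, ¬ (tau^[k] M).IsZero ∧ (tau^[k] M).IsProjective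

/-- `M` is preinjective: some `τ'^k M` is a nonzero injective. -/
def IsPreinjective (M : QRep Q) : Prop :=
  ∃ k : ℕ, ¬ (tauInv^[k] M).IsZero ∧ (tauInv^[k] M).IsInjective

/-- `M` is regular: it has no preprojective or preinjective indecomposable summand. -/
def IsRegular (M : QRep Q) : Prop :=
  ∀ N : QRep Q, N.IsIndecomposable → IsSummand N M → ¬ N.IsPreprojective ∧ ¬ N.IsPreinjective

end

end QRep

/-! ## Representation spaces and quiver linear free divisors -/

noncomputable section RepSpace

variable {Q : Type} [Quiver.{0} Q]

/-- The quiver is a (nonempty) connected graph. -/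
def IsConnectedQuiver (Q : Type) [Quiver.{0} Q] : Prop :=
  Nonempty Q ∧ Subsingleton (Quiver.WeaklyConnectedComponent Q)

/-- Index set of the coordinates on `Rep(Q, d)`: an arrow `i → j` with the row and column index of
an entry of a `d_j × d_i` matrix. -/
abbrev RepCoord (Q : Type) [Quiver.{0} Q] (d : Q → ℕ) : Type :=
  Σ (i j : Q) (_ : i ⟶ j), Fin (d j) × Fin (d i)

/-- The representation space `Rep(Q, d) = ⊕_{i → j} Mat_{d_j × d_i}(ℂ)`, in coordinates. -/
abbrev RepSpace (Q : Type) [Quiver.{0} Q] (d : Q → ℕ) : Type := RepCoord Q d → ℂ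

/-- The matrix of the arrow `a` in the representation `x`. -/
def RepSpace.mat {d : Q → ℕ} (x : RepSpace Q d) {i j : Q} (a : i ⟶ j) :
    Matrix (Fin (d j)) (Fin (d i)) ℂ :=
  Matrix.of fun k l => x ⟨i, j, a, k, l⟩

/-- The point `x` as a representation with the spaces `ℂ^{d_i}`. -/
def RepSpace.toQRep {d : Q → ℕ} (x : RepSpace Q d) : QRep Q where
  V i := Fin (d i) → ℂ
  map a := (RepSpace.mat x a).mulVecLin

/-- The action `(g x)_a = g_j x_a g_i⁻¹` (for `a : i → j`) of `GL(Q, d) = ∏_i GL_{d_i}(ℂ)` on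
`Rep(Q, d)`. -/
def RepSpace.act {d : Q → ℕ} (g : ∀ i, GL (Fin (d i)) ℂ) (x : RepSpace Q d) : RepSpace Q d :=
  fun c => ((g c.2.1).1 * RepSpace.mat x c.2.2.1 * ((g c.1)⁻¹).1) c.2.2.2.1 c.2.2.2.2

/-- `(Q, d)` defines the linear free divisor `D`: the dimension vector `d` is sincere; `D` is the
discriminant of the action of `GL(Q, d)` on `Rep(Q, d)`, i.e. the complement of an open orbit
(openness is automatic as `D` is a hypersurface); `D` is a linear free divisor; and its associated
group, the largest connected subgroup of `GL(Rep(Q, d))` preserving `D`, is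
`PGL(Q, d) = GL(Q, d) / ℂ^* id` acting on `Rep(Q, d)`. -/
structure DefinesLinearFreeDivisor [Fintype Q] [DecidableEq Q] [∀ i j : Q, Fintype (i ⟶ j)]
    [∀ i j : Q, DecidableEq (i ⟶ j)] (d : Q → ℕ) (D : Set (RepSpace Q d)) : Prop where
  sincere : ∀ i, 1 ≤ d i
  discriminant : ∃ x₀ : RepSpace Q d, Dᶜ = Set.range fun g => RepSpace.act g x₀
  linearFree : IsLinearFreeDivisor D
  group_image : ∃ H : Subgroup (GL (RepCoord Q d) ℂ), IsLargestConnectedSubgroupPreserving D H ∧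
    ∀ h : GL (RepCoord Q d) ℂ, h ∈ H ↔
      ∃ g : ∀ i, GL (Fin (d i)) ℂ, ∀ x : RepSpace Q d, h.1.mulVec x = RepSpace.act g x
  group_kernel : ∀ g : ∀ i, GL (Fin (d i)) ℂ,
    (∀ x : RepSpace Q d, RepSpace.act g x = x) ↔
      ∃ c : ℂ, ∀ i, (g i).1 = c • (1 : Matrix (Fin (d i)) (Fin (d i)) ℂ)

end RepSpace

/-! The proof has a representation-theoretic half and a geometric half, joined by a dichotomy: a
non-regular `M` is either rigid, i.e. `Ext(M, M) = 0`, or a direct sum `A ⊕ B` of nonzero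
representations with `Ext(A, B) = 0` and `Hom(B, A) = 0`.

For the dichotomy, the representations `Z` with `τ^k Z = 0` are closed under subobjects and
extensions, because `τ` is left exact. If `M` has a preprojective summand, it maps nontrivially to
such a `Z`. Take `k` least, and among the maps to such `Z` one with smallest kernel `U`. Closure
under extensions gives `Hom(U, Z') = 0` for every `Z'` in the class, in particular for `A = M / U`
and for `τA`. The Auslander-Reiten formula turns `Hom(U, τA) = 0` into `Ext(A, U) = 0`, so `M`
splits; if `U = 0`, minimality of `k` gives `Hom(M, τM) = 0` and `M` is rigid. Vector space duality
covers the preinjective case (`ringel_surjective_or_hasOrthogonalSplitting_of_not_isRegular`).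

A rigid `M` has an open orbit, so it cannot lie in `D` (`notMem_of_surjective`). In the split case
let `e` be the projection to `A` and `L` the linear field of its infinitesimal action, which
vanishes at `M`. It grades the Lie algebra and `Rep(Q, d)` in degrees `1, 0, -1`, and the
infinitesimal orbit map at `M` respects the gradings. By `Hom(B, A) = 0` the orbit map is injective
in degree `1`, and by `Ext(A, B) = 0` it is onto in degree `-1`. As the parts of the Lie algebra of
degrees `1` and `-1` have equal dimension, `χ = trace L ≥ 0` (`exists_trace_sub_eq_of_graded`).

By Saito's criterion `f` is, up to a constant, the determinant of the coefficients of the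
infinitesimal action. The Lie algebra is unimodular, so Jacobi's formula gives `L f = χ f`
(`linVF_eq_trace_mul`). If `χ` were `0`, the fixed space of `L` would be a slice at `M` transversal
to the orbit; it would meet the open orbit, where the isotropy is scalar, so `e` would be `0` or
`1`. Hence `χ > 0`.

The linear part of `L` still has eigenvalue `-1`. Adding logarithmic fields with coefficients `x_i -
M_i` changes it by any map into the tangent space of the orbit, and as that space contains degree
`-1`, this leaves only the eigenvalues `0` and `1` (`exists_add_comp_spectrum_nonneg`). The new
field multiplies `f` by a unit with value `χ` at `M`, and dividing by this unit finishes the proof.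
-/

theorem LinearMap.exists_generalizedInverse {K V W : Type*} [Field K] [AddCommGroup V]
    [AddCommGroup W] [Module K V] [Module K W] (g : V →ₗ[K] W) :
    ∃ s : W →ₗ[K] V, ∀ v, g (s (g v)) = g v := by
  obtain ⟨t, ht⟩ := g.rangeRestrict.exists_rightInverse_of_surjective g.range_rangeRestrict
  obtain ⟨s, hs⟩ := LinearMap.exists_extend t
  refine ⟨s, fun v => ?_⟩
  have h1 : s (g v) = t (g.rangeRestrict v) := LinearMap.congr_fun hs (g.rangeRestrict v)
  rw [h1]
  exact congrArg Subtype.val (LinearMap.congr_fun ht (g.rangeRestrict v))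

/-! ### Right exactness of Ext and left exactness of the Auslander-Reiten translate -/

namespace QRep

variable {Q : Type} [Quiver.{0} Q]

theorem Hom.comm_apply {A B : QRep Q} (f : Hom A B) {i j : Q} (a : i ⟶ j) (v : A.V i) :
    B.map a (f.app i v) = f.app j (A.map a v) :=
  LinearMap.congr_fun (f.comm a) v

@[simp] theorem ringel_apply (A B : QRep Q) (φ : ∀ i, A.V i →ₗ[ℂ] B.V i) {i j : Q} (a : i ⟶ j)
    (v : A.V i) : ringel A B φ i j a v = φ j (A.map a v) - B.map a (φ i v) := rfl

/-- The composition of homomorphisms of representations. -/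
def Hom.comp {A B C : QRep Q} (g : Hom B C) (f : Hom A B) : Hom A C where
  app i := g.app i ∘ₗ f.app i
  comm a := by
    ext v
    simp [Hom.comm_apply]

/-- The identity homomorphism. -/
def Hom.id (A : QRep Q) : Hom A A where
  app _ := LinearMap.id
  comm _ := rfl

/-- Precomposition with `f : A ⟶ B` on families indexed by the arrows. -/
def precomp {A B : QRep Q} (f : Hom A B) (N : QRep Q) :
    (∀ (i j : Q) (_ : i ⟶ j), B.V i →ₗ[ℂ] N.V j) →ₗ[ℂ]
      (∀ (i j : Q) (_ : i ⟶ j), A.V i →ₗ[ℂ] N.V j) where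
  toFun θ := fun i j a => θ i j a ∘ₗ f.app i
  map_add' _ _ := rfl
  map_smul' _ _ := rfl

/-- Functoriality of `Ext_Q(M, N)` in `M`. -/
def extMapLeft {A B : QRep Q} (f : Hom A B) (N : QRep Q) : Ext B N →ₗ[ℂ] Ext A N :=
  Submodule.mapQ _ _ (precomp f N) (by
    rintro _ ⟨ψ, rfl⟩
    refine ⟨fun i => ψ i ∘ₗ f.app i, ?_⟩
    funext i j a
    ext v
    simp [precomp, Hom.comm_apply])

/-- The category is hereditary. Concretely, arrow families carry no compatibility condition, so they
extend along vertexwise retractions of `f`. -/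
theorem extMapLeft_surjective {A B : QRep Q} (f : Hom A B) (N : QRep Q)
    (hf : ∀ i, Function.Injective (f.app i)) : Function.Surjective (extMapLeft f N) := by
  intro e
  obtain ⟨θ, rfl⟩ := Submodule.Quotient.mk_surjective _ e
  choose r hr using fun i =>
    (f.app i).exists_leftInverse_of_injective (LinearMap.ker_eq_bot.mpr (hf i))
  refine ⟨Submodule.Quotient.mk fun i j a => θ i j a ∘ₗ r i, ?_⟩
  refine congrArg Submodule.Quotient.mk ?_
  funext i j a
  ext v
  exact congrArg (θ i j a) (LinearMap.congr_fun (hr i) v)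

theorem ker_extMapLeft {A B C : QRep Q} (f : Hom A B) (g : Hom B C) (N : QRep Q)
    (hf : ∀ i, Function.Injective (f.app i))
    (hfg : ∀ i, LinearMap.range (f.app i) = LinearMap.ker (g.app i)) :
    LinearMap.ker (extMapLeft f N) = LinearMap.range (extMapLeft g N) := by
  apply le_antisymm
  · intro e he
    obtain ⟨η, rfl⟩ := Submodule.Quotient.mk_surjective _ e
    obtain ⟨ψ', hψ'⟩ := (Submodule.Quotient.mk_eq_zero _).mp (LinearMap.mem_ker.mp he)
    choose r hr using fun i =>
      (f.app i).exists_leftInverse_of_injective (LinearMap.ker_eq_bot.mpr (hf i))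
    choose s hs using fun i => (g.app i).exists_generalizedInverse
    have hrv : ∀ i v, r i (f.app i v) = v := fun i v => LinearMap.congr_fun (hr i) v
    set ψ : ∀ i, B.V i →ₗ[ℂ] N.V i := fun i => ψ' i ∘ₗ r i with hψ
    -- Corrected by the coboundary of `ψ`, the family `η` vanishes on the image of `f`, which is the
    -- kernel of `g`. It therefore factors through `g`, and the generalized inverse `s` provides the
    -- factor without assuming `g` surjective.
    refine ⟨Submodule.Quotient.mk fun i j a => (η i j a - ringel B N ψ i j a) ∘ₗ s i, ?_⟩
    refine (Submodule.Quotient.eq _).mpr ⟨-ψ, ?_⟩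
    funext i j a
    ext v
    have hker : v - s i (g.app i v) ∈ LinearMap.ker (g.app i) := by
      rw [LinearMap.mem_ker, map_sub, hs, sub_self]
    rw [← hfg] at hker
    obtain ⟨w, hw⟩ := hker
    have h1 := LinearMap.congr_fun (congrFun (congrFun (congrFun hψ' i) j) a) w
    have h2 : (η i j a - ringel B N ψ i j a) (f.app i w) = 0 := by
      have h3 : (precomp f N) η i j a w = η i j a (f.app i w) := rfl
      rw [h3] at h1
      rw [LinearMap.sub_apply, ← h1]
      simp [hψ, hrv, Hom.comm_apply]
    rw [hw, map_sub, sub_eq_zero] at h2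
    have h4 : (precomp g N) (fun i j a => (η i j a - ringel B N ψ i j a) ∘ₗ s i) i j a v =
      (η i j a - ringel B N ψ i j a) (s i (g.app i v)) := rfl
    simp only [Pi.sub_apply, LinearMap.sub_apply, map_neg, Pi.neg_apply, LinearMap.neg_apply, h4]
    rw [← LinearMap.sub_apply, ← h2, LinearMap.sub_apply]
    abel
  · rintro _ ⟨e, rfl⟩
    obtain ⟨θ, rfl⟩ := Submodule.Quotient.mk_surjective _ e
    refine LinearMap.mem_ker.mpr ?_
    have h0 : (precomp f N) (precomp g N θ) = 0 := by
      funext i j a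
      ext v
      have h1 : g.app i (f.app i v) = 0 := by
        rw [← LinearMap.mem_ker, ← hfg]
        exact ⟨v, rfl⟩
      have h2 : (precomp f N) (precomp g N θ) i j a v = θ i j a (g.app i (f.app i v)) := rfl
      rw [h2, h1, map_zero]
      rfl
    exact congrArg Submodule.Quotient.mk h0

/-- The sequence `0 → A → B → C` is exact for suitable homomorphisms. -/
def LeftExact (A B C : QRep Q) : Prop :=
  ∃ (f : Hom A B) (g : Hom B C), (∀ i, Function.Injective (f.app i)) ∧
    ∀ i, LinearMap.range (f.app i) = LinearMap.ker (g.app i)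

/-- Functoriality of the Auslander-Reiten translate. -/
noncomputable def tauHom {A B : QRep Q} (f : Hom A B) : Hom (tau A) (tau B) where
  app i := (extMapLeft f (P i)).dualMap
  comm {i j} a := by
    refine LinearMap.ext fun l => LinearMap.ext fun e => ?_
    obtain ⟨θ, rfl⟩ := Submodule.Quotient.mk_surjective _ e
    rfl

/-- Dualizing the right exact sequence `Ext(C, P(i)) → Ext(B, P(i)) → Ext(A, P(i)) → 0`. No
surjectivity of `B → C` enters, so the statement can be iterated. -/
theorem LeftExact.tau {A B C : QRep Q} (h : LeftExact A B C) :
    LeftExact (tau A) (tau B) (tau C) := by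
  obtain ⟨f, g, hf, hfg⟩ := h
  refine ⟨tauHom f, tauHom g, fun i => ?_, fun i => ?_⟩
  · exact LinearMap.dualMap_injective_of_surjective (extMapLeft_surjective f (P i) hf)
  · refine (LinearMap.range_dualMap_eq_dualAnnihilator_ker _).trans ?_
    rw [ker_extMapLeft f g (P i) hf hfg]
    exact (LinearMap.ker_dualMap_eq_dualAnnihilator_range _).symm

theorem LeftExact.iterate_tau {A B C : QRep Q} (h : LeftExact A B C) (k : ℕ) :
    LeftExact (QRep.tau^[k] A) (QRep.tau^[k] B) (QRep.tau^[k] C) := by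
  induction k generalizing A B C with
  | zero => exact h
  | succ k ih => exact ih h.tau

theorem LeftExact.isZero {A B C : QRep Q} (h : LeftExact A B C) (hA : A.IsZero) (hC : C.IsZero) :
    B.IsZero := by
  obtain ⟨f, g, hf, hfg⟩ := h
  intro i
  have := hA i
  have := hC i
  refine subsingleton_of_forall_eq 0 fun v => ?_
  have hv : v ∈ LinearMap.ker (g.app i) := Subsingleton.elim _ _
  rw [← hfg] at hv
  obtain ⟨w, rfl⟩ := hv
  rw [Subsingleton.elim w 0, map_zero]

theorem isZero_of_injective {A B : QRep Q} (f : Hom A B) (hf : ∀ i, Function.Injective (f.app i))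
    (hB : B.IsZero) : A.IsZero := fun i =>
  have := hB i
  (hf i).subsingleton

theorem IsZero.tau {A : QRep Q} (h : A.IsZero) : A.tau.IsZero := by
  intro i
  have : ∀ i, Subsingleton (A.V i) := h
  have : Subsingleton (Ext A (P i)) := (Submodule.Quotient.mk_surjective _).subsingleton
  exact inferInstanceAs (Subsingleton (Module.Dual ℂ (Ext A (P i))))

theorem IsZero.iterate_tau {A : QRep Q} (h : A.IsZero) (k : ℕ) : (QRep.tau^[k] A).IsZero := by
  induction k generalizing A with
  | zero => exact h
  | succ k ih => exact ih h.tau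

/-! ### Subrepresentations and quotients -/

/-- A family of subspaces is stable under the arrows. -/
def IsStable (M : QRep Q) (U : ∀ i, Submodule ℂ (M.V i)) : Prop :=
  ∀ ⦃i j : Q⦄ (a : i ⟶ j), U i ≤ (U j).comap (M.map a)

/-- The subrepresentation on a stable family of subspaces. -/
def sub (M : QRep Q) (U : ∀ i, Submodule ℂ (M.V i)) (hU : M.IsStable U) : QRep Q where
  V i := U i
  map a := (M.map a).restrict (hU a)

/-- The quotient by a stable family of subspaces. -/
def quot (M : QRep Q) (U : ∀ i, Submodule ℂ (M.V i)) (hU : M.IsStable U) : QRep Q where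
  V i := M.V i ⧸ U i
  map a := Submodule.mapQ _ _ (M.map a) (hU a)

/-- The inclusion of a subrepresentation. -/
def subIncl (M : QRep Q) (U : ∀ i, Submodule ℂ (M.V i)) (hU : M.IsStable U) :
    Hom (M.sub U hU) M where
  app i := (U i).subtype
  comm _ := rfl

/-- The projection to a quotient representation. -/
def quotProj (M : QRep Q) (U : ∀ i, Submodule ℂ (M.V i)) (hU : M.IsStable U) :
    Hom M (M.quot U hU) where
  app i := (U i).mkQ
  comm _ := rfl

theorem Hom.isStable_ker {M N : QRep Q} (f : Hom M N) :
    M.IsStable fun i => LinearMap.ker (f.app i) := by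
  intro i j a v hv
  rw [Submodule.mem_comap, LinearMap.mem_ker, ← f.comm_apply, LinearMap.mem_ker.mp hv, map_zero]

theorem Hom.isStable_range {M N : QRep Q} (f : Hom M N) :
    N.IsStable fun i => LinearMap.range (f.app i) := by
  rintro i j a _ ⟨v, rfl⟩
  exact ⟨M.map a v, (f.comm_apply a v).symm⟩

/-- The homomorphism induced on the quotient by a stable family of subspaces of the kernel. -/
def Hom.descend {M N : QRep Q} (f : Hom M N) (U : ∀ i, Submodule ℂ (M.V i)) (hU : M.IsStable U)
    (h : ∀ i, U i ≤ LinearMap.ker (f.app i)) : Hom (M.quot U hU) N where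
  app i := (U i).liftQ (f.app i) (h i)
  comm {i j} a := by
    refine LinearMap.ext fun v => ?_
    obtain ⟨v, rfl⟩ := Submodule.Quotient.mk_surjective _ v
    exact f.comm_apply a v

/-- Together with `LeftExact.isZero` this makes `τ^k Z = 0` a torsion-free class: closed under
subobjects here, under extensions there. -/
theorem isZero_iterate_tau_of_injective {A B : QRep Q} (f : Hom A B)
    (hf : ∀ i, Function.Injective (f.app i)) {k : ℕ} (hB : (tau^[k] B).IsZero) :
    (tau^[k] A).IsZero := by
  have h : LeftExact A B (B.quot _ f.isStable_range) :=
    ⟨f, B.quotProj _ f.isStable_range, hf, fun i => (Submodule.ker_mkQ _).symm⟩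
  obtain ⟨f', _, hf', _⟩ := h.iterate_tau k
  exact isZero_of_injective f' hf' hB

/-! ### The Auslander-Reiten formula -/

/-- The elements of the arrow family with the single entry `θ` at the arrow `a`. -/
noncomputable def single {A B : QRep Q} {i j : Q} (a : i ⟶ j) :
    (A.V i →ₗ[ℂ] B.V j) →ₗ[ℂ] (∀ (i j : Q) (_ : i ⟶ j), A.V i →ₗ[ℂ] B.V j) := by
  classical
  exact (LinearMap.single ℂ (fun i => ∀ (j : Q) (_ : i ⟶ j), A.V i →ₗ[ℂ] B.V j) i) ∘ₗ
    (LinearMap.single ℂ (fun j => ∀ (_ : i ⟶ j), A.V i →ₗ[ℂ] B.V j) j) ∘ₗ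
    (LinearMap.single ℂ (fun _ : i ⟶ j => A.V i →ₗ[ℂ] B.V j) a)

theorem sum_single [Fintype Q] [∀ i j : Q, Fintype (i ⟶ j)] {A B : QRep Q}
    (θ : ∀ (i j : Q) (_ : i ⟶ j), A.V i →ₗ[ℂ] B.V j) :
    θ = ∑ i, ∑ j, ∑ a : i ⟶ j, single a (θ i j a) := by
  classical
  have h1 : ∀ i j, θ i j = ∑ a, LinearMap.single ℂ (fun _ : i ⟶ j => A.V i →ₗ[ℂ] B.V j) a (θ i j a) :=
    fun i j => (Finset.univ_sum_single (θ i j)).symm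
  have h2 : ∀ i, θ i =
      ∑ j, LinearMap.single ℂ (fun j => ∀ (_ : i ⟶ j), A.V i →ₗ[ℂ] B.V j) j (θ i j) :=
    fun i => (Finset.univ_sum_single (θ i)).symm
  have h3 : θ = ∑ i, LinearMap.single ℂ (fun i => ∀ (j : Q) (_ : i ⟶ j), A.V i →ₗ[ℂ] B.V j) i (θ i) :=
    (Finset.univ_sum_single θ).symm
  refine h3.trans (Finset.sum_congr rfl fun i _ => ?_)
  refine (congrArg _ (h2 i)).trans ((map_sum _ _ _).trans (Finset.sum_congr rfl fun j _ => ?_))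
  exact (congrArg _ (congrArg _ (h1 i j))).trans ((congrArg _ (map_sum _ _ _)).trans (map_sum _ _ _))

theorem postcomp_single {A B C : QRep Q} (φ : Hom B C) {i j : Q} (a : i ⟶ j)
    (θ : A.V i →ₗ[ℂ] B.V j) : postcomp A φ (single a θ) = single a (φ.app j ∘ₗ θ) := by
  classical
  funext k l b
  unfold single postcomp
  simp only [LinearMap.comp_apply, LinearMap.coe_mk, AddHom.coe_mk, LinearMap.coe_single]
  by_cases hk : k = i
  · subst hk
    by_cases hl : l = j
    · subst hl
      by_cases hb : b = a
      · subst hb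
        simp
      · simp [hb]
    · simp [hl]
  · simp [hk]

/-- The action of a path on a representation. -/
def pathMap (M : QRep Q) {i : Q} : ∀ {k : Q}, Quiver.Path i k → M.V i →ₗ[ℂ] M.V k
  | _, .nil => LinearMap.id
  | _, .cons p a => M.map a ∘ₗ pathMap M p

theorem pathMap_comp (M : QRep Q) {i j k : Q} (p : Quiver.Path i j) (q : Quiver.Path j k)
    (v : M.V i) : M.pathMap (p.comp q) v = M.pathMap q (M.pathMap p v) := by
  induction q with
  | nil => rfl
  | cons q a ih => exact congrArg (M.map a) ih

/-- The homomorphism `P(i) ⟶ M` sending the trivial path to `v`. -/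
noncomputable def fromP (M : QRep Q) {i : Q} (v : M.V i) : Hom (P i) M where
  app k := Finsupp.lsum ℂ fun p : Quiver.Path i k => LinearMap.toSpanSingleton ℂ _ (M.pathMap p v)
  comm {k l} a := by
    have h : M.map a ∘ₗ (Finsupp.lsum ℂ fun p : Quiver.Path i k =>
        LinearMap.toSpanSingleton ℂ _ (M.pathMap p v)) =
      (Finsupp.lsum ℂ fun p : Quiver.Path i l => LinearMap.toSpanSingleton ℂ _ (M.pathMap p v)) ∘ₗ
        Finsupp.lmapDomain ℂ ℂ (fun p => p.cons a) := by
      ext p : 2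
      simp [Finsupp.mapDomain_single, pathMap]
    exact h

/-- The basis vector of `P(i)` given by a path. -/
noncomputable def pathVec {i k : Q} (p : Quiver.Path i k) : (P i).V k :=
  (Finsupp.single p 1 : Quiver.Path i k →₀ ℂ)

theorem fromP_pathVec (M : QRep Q) {i : Q} (v : M.V i) {k : Q} (p : Quiver.Path i k) :
    (M.fromP v).app k (pathVec p) = M.pathMap p v := by
  have h : (Finsupp.lsum ℂ fun p : Quiver.Path i k =>
      LinearMap.toSpanSingleton ℂ _ (M.pathMap p v)) (Finsupp.single p 1) = M.pathMap p v := by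
    simp
  exact h

theorem PMap_pathVec {i j k : Q} (a : i ⟶ j) (p : Quiver.Path j k) :
    (PMap a).app k (pathVec p) = pathVec (a.toPath.comp p) :=
  Finsupp.mapDomain_single

theorem P_hom_ext {i k : Q} {W : Type*} [AddCommGroup W] [Module ℂ W] {f g : (P i).V k →ₗ[ℂ] W}
    (h : ∀ p : Quiver.Path i k, f (pathVec p) = g (pathVec p)) : f = g := by
  have h' : ∀ f g : (Quiver.Path i k →₀ ℂ) →ₗ[ℂ] W,
      (∀ p : Quiver.Path i k, f (Finsupp.single p 1) = g (Finsupp.single p 1)) → f = g := by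
    intro f g h
    ext p
    simpa using h p
  exact h' f g h

theorem fromP_add (M : QRep Q) {i : Q} (v w : M.V i) (k : Q) :
    (M.fromP (v + w)).app k = (M.fromP v).app k + (M.fromP w).app k := by
  refine P_hom_ext fun p => ?_
  rw [LinearMap.add_apply, fromP_pathVec, fromP_pathVec, fromP_pathVec, map_add]

theorem fromP_smul (M : QRep Q) {i : Q} (c : ℂ) (v : M.V i) (k : Q) :
    (M.fromP (c • v)).app k = c • (M.fromP v).app k := by
  refine P_hom_ext fun p => ?_
  rw [LinearMap.smul_apply, fromP_pathVec, fromP_pathVec, map_smul]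

theorem fromP_comp_PMap (M : QRep Q) {i j : Q} (a : i ⟶ j) (v : M.V i) (k : Q) :
    (M.fromP v).app k ∘ₗ (PMap a).app k = (M.fromP (M.map a v)).app k := by
  refine P_hom_ext fun p => ?_
  rw [LinearMap.comp_apply, PMap_pathVec, fromP_pathVec, fromP_pathVec, pathMap_comp]
  rfl

/-- The homomorphism `Y ⟶ τ X` defined by a linear form on `Ext(X, Y)`. -/
noncomputable def homTau {X Y : QRep Q} (l : Module.Dual ℂ (Ext X Y)) : Hom Y (tau X) where
  -- An element `y` of `Y` at `i` is a map `P(i) ⟶ Y`; it pushes `Ext(X, P(i))` to `Ext(X, Y)`,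
  -- where `l` is evaluated.
  app i :=
    { toFun := fun y => l ∘ₗ extMap X (Y.fromP y)
      map_add' := fun y z => by
        refine LinearMap.ext fun e => ?_
        obtain ⟨θ, rfl⟩ := Submodule.Quotient.mk_surjective _ e
        have h : postcomp X (Y.fromP (y + z)) θ =
            postcomp X (Y.fromP y) θ + postcomp X (Y.fromP z) θ := by
          funext k m a
          change (Y.fromP (y + z)).app m ∘ₗ _ = _
          rw [fromP_add, LinearMap.add_comp]
          rfl
        change l (Submodule.Quotient.mk (postcomp X (Y.fromP (y + z)) θ)) = _
        rw [h, Submodule.Quotient.mk_add, map_add]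
        rfl
      map_smul' := fun c y => by
        refine LinearMap.ext fun e => ?_
        obtain ⟨θ, rfl⟩ := Submodule.Quotient.mk_surjective _ e
        have h : postcomp X (Y.fromP (c • y)) θ = c • postcomp X (Y.fromP y) θ := by
          funext k m a
          change (Y.fromP (c • y)).app m ∘ₗ _ = _
          rw [fromP_smul, LinearMap.smul_comp]
          rfl
        change l (Submodule.Quotient.mk (postcomp X (Y.fromP (c • y)) θ)) = _
        rw [h, Submodule.Quotient.mk_smul, map_smul]
        rfl }
  comm {i j} a := by
    refine LinearMap.ext fun y => LinearMap.ext fun e => ?_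
    obtain ⟨θ, rfl⟩ := Submodule.Quotient.mk_surjective _ e
    have h : postcomp X (Y.fromP y) (postcomp X (PMap a) θ) =
        postcomp X (Y.fromP (Y.map a y)) θ := by
      funext k m b
      change (Y.fromP y).app m ∘ₗ ((PMap a).app m ∘ₗ _) = _
      rw [← LinearMap.comp_assoc, fromP_comp_PMap]
      rfl
    change l (Submodule.Quotient.mk (postcomp X (Y.fromP y) (postcomp X (PMap a) θ))) = _
    rw [h]
    rfl

/-- The half of `D Ext(X, Y) = Hom(Y, τX)` that is needed: `l ↦ homTau l` is injective. A form
killed by it vanishes on all classes pushed forward from some `P(j)`, and these span `Ext(X, Y)`. -/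
theorem ringel_surjective_of_hom_tau_eq_zero [Fintype Q] [∀ i j : Q, Fintype (i ⟶ j)]
    {X Y : QRep Q} (hX : ∀ i, Module.Finite ℂ (X.V i))
    (h : ∀ (g : Hom Y (tau X)) (i : Q), g.app i = 0) : Function.Surjective (ringel X Y) := by
  have hsub : Subsingleton (Ext X Y) := by
    rw [← Module.subsingleton_dual_iff (K := ℂ)]
    refine subsingleton_of_forall_eq 0 fun l => LinearMap.ext fun e => ?_
    obtain ⟨θ, rfl⟩ := Submodule.Quotient.mk_surjective _ e
    have h1 : ∀ {i j : Q} (a : i ⟶ j) (ξ : Module.Dual ℂ (X.V i)) (y : Y.V j),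
        l (Submodule.Quotient.mk (single a (ξ.smulRight y))) = 0 := by
      intro i j a ξ y
      -- A rank-one family `ξ ⊗ y` on one arrow is the image of `ξ ⊗ (trivial path at j)` under
      -- `P(j) ⟶ Y`.
      have h2 : single a (ξ.smulRight y) = postcomp X (Y.fromP y)
          (single a (ξ.smulRight (pathVec (Quiver.Path.nil : Quiver.Path j j)))) := by
        rw [postcomp_single]
        congr 1
        ext v
        simp only [LinearMap.comp_apply, LinearMap.smulRight_apply, map_smul, fromP_pathVec]
        rfl
      rw [h2]
      exact LinearMap.congr_fun (LinearMap.congr_fun (h (homTau l) j) y) (Submodule.Quotient.mk _)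
    have h3 : ∀ {i j : Q} (a : i ⟶ j) (φ : X.V i →ₗ[ℂ] Y.V j),
        l (Submodule.Quotient.mk (single a φ)) = 0 := by
      intro i j a φ
      have := hX i
      let b := Module.finBasis ℂ (X.V i)
      -- Finite dimension of `X` makes every map a sum of rank-one maps.
      have hφ : φ = ∑ m, (b.coord m).smulRight (φ (b m)) := by
        refine b.ext fun m => ?_
        simp [LinearMap.sum_apply, Finsupp.single_apply]
      rw [hφ, map_sum, ← Submodule.mkQ_apply, map_sum, map_sum]
      exact Finset.sum_eq_zero fun m _ => h1 a _ _
    change l (Submodule.mkQ _ θ) = 0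
    rw [sum_single θ]
    simp only [map_sum]
    exact Finset.sum_eq_zero fun i _ => Finset.sum_eq_zero fun j _ =>
      Finset.sum_eq_zero fun a _ => h3 a _
  rw [← LinearMap.range_eq_top]
  exact Submodule.Quotient.subsingleton_iff.mp hsub

/-! ### Vanishing of Ext for projectives and injectives -/

/-- The extension of `A` by `B` given by an arrow family. -/
def extension (A B : QRep Q) (η : ∀ (i j : Q) (_ : i ⟶ j), A.V i →ₗ[ℂ] B.V j) : QRep Q where
  V i := B.V i × A.V i
  map {i j} a := ((B.map a).coprod (η i j a)).prod ((A.map a) ∘ₗ LinearMap.snd ℂ _ _)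

theorem extension_map_apply (A B : QRep Q) (η : ∀ (i j : Q) (_ : i ⟶ j), A.V i →ₗ[ℂ] B.V j)
    {i j : Q} (a : i ⟶ j) (v : B.V i × A.V i) :
    (extension A B η).map a v = (B.map a v.1 + η i j a v.2, A.map a v.2) := rfl

/-- The projection of an extension. -/
def extensionSnd (A B : QRep Q) (η : ∀ (i j : Q) (_ : i ⟶ j), A.V i →ₗ[ℂ] B.V j) :
    Hom (extension A B η) A where
  app i := LinearMap.snd ℂ (B.V i) (A.V i)
  comm _ := rfl

/-- The inclusion into an extension. -/
def extensionInl (A B : QRep Q) (η : ∀ (i j : Q) (_ : i ⟶ j), A.V i →ₗ[ℂ] B.V j) :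
    Hom B (extension A B η) where
  app i := LinearMap.inl ℂ (B.V i) (A.V i)
  comm {i j} a := by
    refine LinearMap.ext fun v => ?_
    exact (extension_map_apply A B η a (v, 0)).trans (by simp; rfl)

/-- The family `η` defines an extension; a splitting of it has `B`-component `φ` with coboundary
`η`. -/
theorem IsProjective.ringel_surjective {A : QRep Q} (hA : A.IsProjective) (B : QRep Q) :
    Function.Surjective (ringel A B) := by
  intro η
  obtain ⟨l, hl⟩ := hA _ A (extensionSnd A B η) (Hom.id A) fun i => LinearMap.snd_surjective
  have hl2 : ∀ i v, (l.app i v : B.V i × A.V i).2 = v := fun i v => LinearMap.congr_fun (hl i) v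
  refine ⟨fun i => LinearMap.fst ℂ (B.V i) (A.V i) ∘ₗ l.app i, ?_⟩
  funext i j a
  ext v
  have h := congrArg Prod.fst
    ((extension_map_apply A B η a (l.app i v)).symm.trans (l.comm_apply a v))
  rw [hl2] at h
  exact sub_eq_of_eq_add' h.symm

theorem IsInjective.ringel_surjective {B : QRep Q} (hB : B.IsInjective) (A : QRep Q) :
    Function.Surjective (ringel A B) := by
  intro η
  obtain ⟨l, hl⟩ := hB B _ (extensionInl A B η) (Hom.id B) fun i => LinearMap.inl_injective
  have hl2 : ∀ i v, l.app i ((v, 0) : B.V i × A.V i) = v := fun i v => LinearMap.congr_fun (hl i) v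
  refine ⟨fun i => -(l.app i ∘ₗ LinearMap.inr ℂ (B.V i) (A.V i)), ?_⟩
  funext i j a
  ext v
  have h := l.comm_apply a ((0, v) : B.V i × A.V i)
  have h2 : (extension A B η).map a ((0, v) : B.V i × A.V i) =
      ((η i j a v, 0) + (0, A.map a v) : B.V j × A.V j) := by
    refine (extension_map_apply A B η a (0, v)).trans ?_
    simp
    rfl
  have h3 : l.app j ((η i j a v, 0) + (0, A.map a v) : B.V j × A.V j) =
    η i j a v + l.app j ((0, A.map a v) : B.V j × A.V j) :=
      (map_add (l.app j) _ _).trans (congrArg (· + _) (hl2 _ _))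
  rw [h2, h3] at h
  change -(l.app j ((0, A.map a v) : B.V j × A.V j)) -
    B.map a (-(l.app i ((0, v) : B.V i × A.V i))) = η i j a v
  rw [map_neg, h]
  abel

theorem isZero_tau_of_ringel_surjective {A : QRep Q}
    (h : ∀ i, Function.Surjective (ringel A (P i))) : A.tau.IsZero := by
  intro i
  have : Subsingleton (Ext A (P i)) :=
    Submodule.Quotient.subsingleton_iff.mpr (LinearMap.range_eq_top.mpr (h i))
  exact inferInstanceAs (Subsingleton (Module.Dual ℂ (Ext A (P i))))

/-! ### The dichotomy: rigid or orthogonally split -/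

/-- All the spaces of the representation are finite-dimensional. -/
def IsFinite (M : QRep Q) : Prop := ∀ i, Module.Finite ℂ (M.V i)

/-- `M = A ⊕ B` with `A` and `B` nonzero, `Ext(A, B) = 0` and `Hom(B, A) = 0`, stated in terms of
the projection to `A`. -/
def HasOrthogonalSplitting (M : QRep Q) : Prop :=
  ∃ e : Hom M M, (∀ i v, e.app i (e.app i v) = e.app i v) ∧ (∃ i, e.app i ≠ 0) ∧
    (∃ i, e.app i ≠ LinearMap.id) ∧
    (∀ η : ∀ (i j : Q) (_ : i ⟶ j), M.V i →ₗ[ℂ] M.V j, ∃ ψ : ∀ i, M.V i →ₗ[ℂ] M.V i,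
      ∀ (i j : Q) (a : i ⟶ j),
        ringel M M ψ i j a = (LinearMap.id - e.app j) ∘ₗ η i j a ∘ₗ e.app i) ∧
    ∀ (ψ : Hom M M) (i : Q), e.app i ∘ₗ ψ.app i ∘ₗ (LinearMap.id - e.app i) = 0

/-- If `Ext(M / U, U) = 0` and `Hom(U, M / U) = 0` for a proper nonzero subrepresentation `U`,
then `M` splits. -/
theorem hasOrthogonalSplitting_of_sub (M : QRep Q) (U : ∀ i, Submodule ℂ (M.V i))
    (hU : M.IsStable U) (h0 : ∃ i, U i ≠ ⊥) (h1 : ∃ i, U i ≠ ⊤)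
    (hExt : Function.Surjective (ringel (M.quot U hU) (M.sub U hU)))
    (hHom : ∀ (h : Hom (M.sub U hU) (M.quot U hU)) (i : Q), h.app i = 0) :
    M.HasOrthogonalSplitting := by
  let ι : ∀ i, (M.sub U hU).V i →ₗ[ℂ] M.V i := (M.subIncl U hU).app
  let q : ∀ i, M.V i →ₗ[ℂ] (M.quot U hU).V i := (M.quotProj U hU).app
  have hq : ∀ i v, q i v = 0 ↔ v ∈ U i := fun i v => Submodule.Quotient.mk_eq_zero _
  have hqι : ∀ i v, q i (ι i v) = 0 := fun i v => (hq i _).mpr v.2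
  have hlift : ∀ {i j : Q} (f : (M.quot U hU).V i →ₗ[ℂ] M.V j), (∀ v, q j (f v) = 0) →
      ∃ f' : (M.quot U hU).V i →ₗ[ℂ] (M.sub U hU).V j, ∀ v, ι j (f' v) = f v := fun f hf =>
    ⟨LinearMap.codRestrict (U _) f fun v => (hq _ _).mp (hf v), fun v => rfl⟩
  have hqM : ∀ {i j : Q} (a : i ⟶ j) v, (M.quot U hU).map a (q i v) = q j (M.map a v) :=
    fun a v => rfl
  have hιM : ∀ {i j : Q} (a : i ⟶ j) v, ι j ((M.sub U hU).map a v) = M.map a (ι i v) :=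
    fun a v => rfl
  choose s hs using fun i => (q i).exists_rightInverse_of_surjective (U i).range_mkQ
  have hs' : ∀ i v, q i (s i v) = v := fun i v => LinearMap.congr_fun (hs i) v
  -- The failure of the vertexwise sections `s` to commute with the arrows is an arrow family with
  -- values in `U`. It is a coboundary by `hExt`, and subtracting it turns `s` into a homomorphism
  -- `t`.
  have hη : ∀ (i j : Q) (a : i ⟶ j), ∃ f' : (M.quot U hU).V i →ₗ[ℂ] (M.sub U hU).V j,
      ∀ v, ι j (f' v) = (M.map a ∘ₗ s i - s j ∘ₗ (M.quot U hU).map a) v := fun i j a =>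
    hlift _ fun v => by
      rw [LinearMap.sub_apply, map_sub, LinearMap.comp_apply, LinearMap.comp_apply, hs', ← hqM, hs',
        sub_self]
  choose η hη using hη
  obtain ⟨ψ, hψ⟩ := hExt η
  have hψ' : ∀ {i j : Q} (a : i ⟶ j) v, ι j (ψ j ((M.quot U hU).map a v)) - M.map a (ι i (ψ i v)) =
      M.map a (s i v) - s j ((M.quot U hU).map a v) := by
    intro i j a v
    rw [← hιM, ← map_sub, ← ringel_apply, hψ, hη]
    rfl
  let t : ∀ i, (M.quot U hU).V i →ₗ[ℂ] M.V i := fun i => s i + ι i ∘ₗ ψ i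
  have ht_apply : ∀ i v, t i v = s i v + ι i (ψ i v) := fun i v => rfl
  have hqt : ∀ i v, q i (t i v) = v := by
    intro i v
    rw [ht_apply, map_add, hs', hqι, add_zero]
  have ht : ∀ {i j : Q} (a : i ⟶ j) v, M.map a (t i v) = t j ((M.quot U hU).map a v) := by
    intro i j a v
    rw [ht_apply, ht_apply, map_add, sub_eq_sub_iff_add_eq_add.mp (hψ' a v).symm]
    abel
  have hmem : ∀ i v, q i (v - t i (q i v)) = 0 := by
    intro i v
    rw [map_sub, hqt, sub_self]
  -- The summand `A` is the copy `t (M / U)` of the quotient, and `B` is `U`.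
  refine ⟨⟨fun i => t i ∘ₗ q i, fun {i j} a => LinearMap.ext fun v => ht a _⟩, ?_, ?_, ?_, ?_,
    ?_⟩
  · intro i v
    exact congrArg (t i) (hqt i _)
  · obtain ⟨i, hi⟩ := h1
    refine ⟨i, fun h => hi (eq_top_iff.mpr fun v _ => ?_)⟩
    have h2 : t i (q i v) = 0 := LinearMap.congr_fun h v
    rw [← hq, ← hqt i (q i v), h2, map_zero]
  · obtain ⟨i, hi⟩ := h0
    refine ⟨i, fun h => hi (eq_bot_iff.mpr fun v hv => ?_)⟩
    have h2 : t i (q i v) = v := LinearMap.congr_fun h v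
    rw [(hq i v).mpr hv, map_zero] at h2
    exact h2.symm
  · intro η
    have hη : ∀ (i j : Q) (a : i ⟶ j), ∃ f' : (M.quot U hU).V i →ₗ[ℂ] (M.sub U hU).V j,
        ∀ v, ι j (f' v) = ((LinearMap.id - t j ∘ₗ q j) ∘ₗ η i j a ∘ₗ t i) v := fun i j a =>
      hlift _ fun v => hmem j _
    choose η' hη' using hη
    obtain ⟨ψ', hψ'⟩ := hExt η'
    refine ⟨fun i => ι i ∘ₗ ψ' i ∘ₗ q i, fun i j a => LinearMap.ext fun v => ?_⟩
    have h2 := hη' i j a (q i v)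
    rw [← hψ', ringel_apply, map_sub, hιM] at h2
    exact h2
  · intro ψ i
    refine LinearMap.ext fun v => ?_
    have h2 : q i (ψ.app i (v - t i (q i v))) = 0 :=
      LinearMap.congr_fun (hHom ((M.quotProj U hU).comp (ψ.comp (M.subIncl U hU))) i)
        ⟨_, (hq i _).mp (hmem i v)⟩
    exact (congrArg (t i) h2).trans (map_zero _)

/-- The kernel of the composition `ker g → Z₂` in the extension of quotients. -/
theorem leftExact_quot (M : QRep Q) (U : ∀ i, Submodule ℂ (M.V i)) (hU : M.IsStable U)
    {Z : QRep Q} (h : Hom (M.sub U hU) Z) :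
    ∃ hU' : M.IsStable fun i => (LinearMap.ker (h.app i)).map (U i).subtype,
      LeftExact ((M.sub U hU).quot _ h.isStable_ker) (M.quot _ hU') (M.quot U hU) := by
  have hU' : M.IsStable fun i => (LinearMap.ker (h.app i)).map (U i).subtype := by
    rintro i j a _ ⟨v, hv, rfl⟩
    exact ⟨(M.sub U hU).map a v, h.isStable_ker a hv, rfl⟩
  have hle : ∀ i, (LinearMap.ker (h.app i)).map (U i).subtype ≤ U i := fun i =>
    Submodule.map_subtype_le _ _
  have hle1 : ∀ i, LinearMap.ker (h.app i) ≤
      LinearMap.ker (((M.quotProj _ hU').comp (M.subIncl U hU)).app i) := by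
    intro i v hv
    exact (Submodule.Quotient.mk_eq_zero _).mpr ⟨v, hv, rfl⟩
  have hle2 : ∀ i, (LinearMap.ker (h.app i)).map (U i).subtype ≤
      LinearMap.ker ((M.quotProj U hU).app i) := by
    intro i v hv
    exact (Submodule.Quotient.mk_eq_zero _).mpr (hle i hv)
  refine ⟨hU', ((M.quotProj _ hU').comp (M.subIncl U hU)).descend _ h.isStable_ker hle1,
    (M.quotProj U hU).descend _ hU' hle2, fun i => ?_, fun i => le_antisymm ?_ ?_⟩
  · refine (injective_iff_map_eq_zero _).mpr fun v hv => ?_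
    obtain ⟨v, rfl⟩ := Submodule.Quotient.mk_surjective _ v
    obtain ⟨w, hw, hwv⟩ := (Submodule.Quotient.mk_eq_zero _).mp hv
    have : w = v := Subtype.ext hwv
    exact (Submodule.Quotient.mk_eq_zero _).mpr (this ▸ hw)
  · rintro _ ⟨v, rfl⟩
    obtain ⟨v, rfl⟩ := Submodule.Quotient.mk_surjective _ v
    exact (Submodule.Quotient.mk_eq_zero _).mpr v.2
  · intro v hv
    obtain ⟨v, rfl⟩ := Submodule.Quotient.mk_surjective _ v
    exact ⟨Submodule.Quotient.mk ⟨v, (Submodule.Quotient.mk_eq_zero _).mp hv⟩, rfl⟩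

/-- A finite-dimensional representation with a nonzero homomorphism to some `Z` with `τ^k Z = 0`
is rigid or splits. -/
theorem ringel_surjective_or_hasOrthogonalSplitting [Fintype Q] [∀ i j : Q, Fintype (i ⟶ j)]
    (M : QRep Q) (hM : M.IsFinite)
    (h : ∃ (k : ℕ) (Z : QRep Q) (g : Hom M Z), (tau^[k] Z).IsZero ∧ ∃ i, g.app i ≠ 0) :
    Function.Surjective (ringel M M) ∨ M.HasOrthogonalSplitting := by
  classical
  have hfin : ∀ i, Module.Finite ℂ (M.V i) := hM
  -- The least `k` matters only in the rigid case, where a map `M ⟶ τM` must be excluded.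
  obtain ⟨k, ⟨Z₀, g₀, hZ₀, i₀, hi₀⟩, hk⟩ : ∃ k, (∃ (Z : QRep Q) (g : Hom M Z),
      (tau^[k] Z).IsZero ∧ ∃ i, g.app i ≠ 0) ∧ ∀ m < k, ∀ (Z : QRep Q) (g : Hom M Z),
      (tau^[m] Z).IsZero → ∀ i, g.app i = 0 := by
    refine ⟨Nat.find h, Nat.find_spec h, fun m hm Z g hZ i => ?_⟩
    by_contra hi
    exact Nat.find_min h hm ⟨Z, g, hZ, i, hi⟩
  obtain ⟨m, rfl⟩ : ∃ m, k = m + 1 := by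
    refine Nat.exists_eq_succ_of_ne_zero fun hk0 => hi₀ ?_
    subst hk0
    have : Subsingleton (Z₀.V i₀) := hZ₀ i₀
    exact LinearMap.ext fun v => Subsingleton.elim _ _
  -- A map of smallest kernel realizes the largest quotient of `M` in the torsion-free class.
  have hex : ∃ n : ℕ, ∃ (Z : QRep Q) (g : Hom M Z), (tau^[m + 1] Z).IsZero ∧
      ∑ i, Module.finrank ℂ (LinearMap.ker (g.app i)) = n := ⟨_, Z₀, g₀, hZ₀, rfl⟩
  obtain ⟨Z, g, hZ, hg⟩ := Nat.find_spec hex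
  have hmin : ∀ (Z' : QRep Q) (g' : Hom M Z'), (tau^[m + 1] Z').IsZero →
      ∑ i, Module.finrank ℂ (LinearMap.ker (g.app i)) ≤
        ∑ i, Module.finrank ℂ (LinearMap.ker (g'.app i)) := by
    intro Z' g' hZ'
    rw [hg]
    exact Nat.find_min' hex ⟨Z', g', hZ', rfl⟩
  set U : ∀ i, Submodule ℂ (M.V i) := fun i => LinearMap.ker (g.app i) with hUdef
  have hU : M.IsStable U := g.isStable_ker
  have hA : (tau^[m + 1] (M.quot U hU)).IsZero := by
    refine isZero_iterate_tau_of_injective (g.descend U hU fun i => le_rfl) (fun i => ?_) hZ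
    refine (injective_iff_map_eq_zero _).mpr fun v hv => ?_
    obtain ⟨v, rfl⟩ := Submodule.Quotient.mk_surjective _ v
    exact (Submodule.Quotient.mk_eq_zero _).mpr hv
  -- `M / ker f` is an extension of `M / U` by a subobject of `Z'`, hence in the class. Minimality
  -- of `U` gives `ker f = U`, i.e. `f = 0`.
  have hS : ∀ (Z' : QRep Q) (f : Hom (M.sub U hU) Z'), (tau^[m + 1] Z').IsZero →
      ∀ i, f.app i = 0 := by
    intro Z' f hZ'
    obtain ⟨hU', hexact⟩ := leftExact_quot M U hU f
    have hB := (hexact.iterate_tau (m + 1)).isZero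
      (isZero_iterate_tau_of_injective (f.descend _ f.isStable_ker fun i => le_rfl) (fun i => by
        refine (injective_iff_map_eq_zero _).mpr fun v hv => ?_
        obtain ⟨v, rfl⟩ := Submodule.Quotient.mk_surjective _ v
        exact (Submodule.Quotient.mk_eq_zero _).mpr hv) hZ') hA
    have hker : ∀ i, LinearMap.ker ((M.quotProj _ hU').app i) =
        (LinearMap.ker (f.app i)).map (U i).subtype := fun i => Submodule.ker_mkQ _
    have h1 := (hmin _ (M.quotProj _ hU') hB).trans_eq (Finset.sum_congr rfl fun i _ =>
      congrArg (fun S : Submodule ℂ (M.V i) => Module.finrank ℂ S) (hker i))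
    have hle : ∀ i, (LinearMap.ker (f.app i)).map (U i).subtype ≤ U i := fun i =>
      Submodule.map_subtype_le _ _
    have hfr : ∀ i ∈ Finset.univ, Module.finrank ℂ ((LinearMap.ker (f.app i)).map (U i).subtype) ≤
        Module.finrank ℂ (U i) := fun i _ => Submodule.finrank_mono (hle i)
    have h2 := (Finset.sum_eq_sum_iff_of_le hfr).mp (le_antisymm (Finset.sum_le_sum hfr) h1)
    intro i
    have h3 := Submodule.eq_of_le_of_finrank_eq (hle i) (h2 i (Finset.mem_univ i))
    refine LinearMap.ext fun v => ?_
    have h4 : (M.subIncl U hU).app i v ∈ (LinearMap.ker (f.app i)).map (U i).subtype := by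
      rw [h3]
      exact v.2
    obtain ⟨w, hw, hwv⟩ := h4
    have : w = v := Subtype.ext hwv
    exact this ▸ hw
  have htau : ∀ N : QRep Q, (tau^[m + 1] N).IsZero → (tau^[m] N.tau).IsZero := fun N hN => hN
  by_cases h0 : ∃ i, U i ≠ ⊥
  · right
    refine hasOrthogonalSplitting_of_sub M U hU h0 ⟨i₀, fun htop => hi₀ ?_⟩
      (ringel_surjective_of_hom_tau_eq_zero ?_ ?_) (fun f => hS _ f hA)
    -- `U` is proper: where it is everything, `hS` kills the nonzero map `g₀`.
    · refine LinearMap.ext fun v => ?_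
      have hv : v ∈ U i₀ := htop ▸ Submodule.mem_top
      exact LinearMap.congr_fun (hS _ (g₀.comp (M.subIncl U hU)) hZ₀ i₀) ⟨v, hv⟩
    · exact fun i => inferInstanceAs (Module.Finite ℂ (M.V i ⧸ U i))
    -- The class is stable under `τ`, so `Hom(U, τ(M / U)) = 0`.
    · refine fun f => hS _ f ?_
      rw [Function.iterate_succ_apply']
      exact (htau _ hA).tau
  · left
    push Not at h0
    -- Now `M` embeds into `Z`, so `τM` is killed by `τ^m`, and a nonzero `M ⟶ τM` would contradict
    -- the choice of `k = m + 1`.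
    refine ringel_surjective_of_hom_tau_eq_zero hM fun f => hk m (Nat.lt_succ_self m) _ f ?_
    refine htau _ (isZero_iterate_tau_of_injective g (fun i => ?_) hZ)
    exact LinearMap.ker_eq_bot.mp (h0 i)

end QRep

/-! ### Duality with the opposite quiver -/

theorem Module.exists_hom_eq_of_bilin {K V W : Type*} [Field K] [AddCommGroup V] [AddCommGroup W]
    [Module K V] [Module K W] [Module.Finite K W] (B : V →ₗ[K] Module.Dual K (Module.Dual K W)) :
    ∃ g : V →ₗ[K] W, ∀ v (w : Module.Dual K W), w (g v) = B v w := by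
  refine ⟨(Module.evalEquiv K W).symm.toLinearMap ∘ₗ B, fun v w => ?_⟩
  simp

theorem Module.exists_transpose {K V W : Type*} [Field K] [AddCommGroup V] [AddCommGroup W]
    [Module K V] [Module K W] [Module.Finite K W] (f : Module.Dual K W →ₗ[K] Module.Dual K V) :
    ∃ g : V →ₗ[K] W, ∀ v (w : Module.Dual K W), w (g v) = f w v :=
  Module.exists_hom_eq_of_bilin f.flip

theorem Module.eq_of_forall_dual {K V : Type*} [Field K] [AddCommGroup V] [Module K V] {v w : V}
    (h : ∀ l : Module.Dual K V, l v = l w) : v = w :=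
  sub_eq_zero.mp ((Module.forall_dual_apply_eq_zero_iff K _).mp fun l => by
    rw [map_sub, h, sub_self])

namespace QRep

variable {Q : Type} [Quiver.{0} Q]

open Opposite

/-- `D τ' M` and `τ D M` have the same spaces `D Ext(D M, P(i))` and the same maps by definition,
which is why an equality, not only an isomorphism, is available. -/
theorem dual_iterate_tauInv (M : QRep Q) (k : ℕ) : dual (tauInv^[k] M) = tau^[k] (dual M) := by
  induction k generalizing M with
  | zero => rfl
  | succ k ih => exact ih (tauInv M)

theorem IsFinite.dual {M : QRep Q} (hM : M.IsFinite) : M.dual.IsFinite := fun i =>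
  have := hM i.unop
  inferInstanceAs (Module.Finite ℂ (Module.Dual ℂ (M.V i.unop)))

theorem IsFinite.ext [Finite Q] [∀ i j : Q, Finite (i ⟶ j)] {M N : QRep Q} (hM : M.IsFinite)
    (hN : N.IsFinite) : Module.Finite ℂ (Ext M N) := by
  have := hM
  have := hN
  have h1 : ∀ i j, Module.Finite ℂ (M.V i →ₗ[ℂ] N.V j) := fun i j => by
    have := hM i
    have := hN j
    infer_instance
  have : ∀ i, Module.Finite ℂ (∀ j, (i ⟶ j) → M.V i →ₗ[ℂ] N.V j) := fun i => inferInstance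
  infer_instance

theorem isZero_of_dual {M : QRep Q} (h : M.dual.IsZero) : M.IsZero := fun i =>
  (Module.subsingleton_dual_iff ℂ).mp (h (op i))

/-- Transposition identifies `Ext(D W, Y)` with `Ext(D Y, W)` for finite-dimensional `W` and `Y`;
`A` below is `D Y`. -/
theorem ringel_dual_surjective {W : QRep Q} (hW : W.IsFinite)
    (h : ∀ A : QRep Q, Function.Surjective (ringel A W)) {Y : QRep Qᵒᵖ} (hY : Y.IsFinite) :
    Function.Surjective (ringel (dual W) Y) := by
  intro η
  have hW' : ∀ i, Module.Finite ℂ (W.V i) := hW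
  have hY' : ∀ i, Module.Finite ℂ (Y.V i) := hY
  let A : QRep Q :=
    { V := fun i => Module.Dual ℂ (Y.V (op i))
      map := fun a => (Y.map a.op).dualMap }
  have hη : ∀ (k l : Q) (a : k ⟶ l), ∃ f : Module.Dual ℂ (Y.V (op k)) →ₗ[ℂ] W.V l,
      ∀ (y : Module.Dual ℂ (Y.V (op k))) (w : Module.Dual ℂ (W.V l)),
        w (f y) = y ((η (op l) (op k) a.op : Module.Dual ℂ (W.V l) →ₗ[ℂ] Y.V (op k)) w) :=
    fun k l a => Module.exists_hom_eq_of_bilin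
      (η (op l) (op k) a.op : Module.Dual ℂ (W.V l) →ₗ[ℂ] Y.V (op k)).dualMap
  choose η' hη' using hη
  obtain ⟨ψ, hψ⟩ := h A η'
  have hφ : ∀ i : Qᵒᵖ, ∃ f : Module.Dual ℂ (W.V i.unop) →ₗ[ℂ] Y.V i,
      ∀ (w : Module.Dual ℂ (W.V i.unop)) (y : Module.Dual ℂ (Y.V i)), y (f w) =
      w ((ψ i.unop : Module.Dual ℂ (Y.V i) →ₗ[ℂ] W.V i.unop) y) := fun i =>
    Module.exists_hom_eq_of_bilin (ψ i.unop : Module.Dual ℂ (Y.V i) →ₗ[ℂ] W.V i.unop).dualMap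
  choose φ hφ using hφ
  -- Transposition exchanges the two terms of the coboundary, hence the sign.
  refine ⟨fun i => -φ i, ?_⟩
  funext i j b
  refine LinearMap.ext fun (w : Module.Dual ℂ (W.V i.unop)) => Module.eq_of_forall_dual (K := ℂ) fun y => ?_
  have h1 := hη' j.unop i.unop b.unop y w
  rw [← hψ, ringel_apply, map_sub] at h1
  have h2 : w (W.map b.unop (ψ j.unop y)) = y (φ j ((W.map b.unop).dualMap w)) :=
    (hφ j ((W.map b.unop).dualMap w) y).symm
  have h3 : w (ψ i.unop (A.map b.unop y)) = y (Y.map b (φ i w)) := (hφ i _ _).symm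
  rw [h2, h3] at h1
  refine Eq.trans ?_ h1
  change y (-(φ j ((W.map b.unop).dualMap w)) - Y.map b (-(φ i w))) = _
  rw [map_neg, map_sub, map_neg, map_neg]
  abel

theorem IsInjective.isZero_tau_dual (hP : ∀ i : Qᵒᵖ, (P i).IsFinite) {W : QRep Q}
    (hW : W.IsFinite) (h : W.IsInjective) : (tau (dual W)).IsZero :=
  isZero_tau_of_ringel_surjective fun i => ringel_dual_surjective hW h.ringel_surjective (hP i)

theorem IsFinite.iterate_tauInv [Finite Q] [∀ i j : Q, Finite (i ⟶ j)]
    (hP : ∀ i : Qᵒᵖ, (P i).IsFinite) {M : QRep Q} (hM : M.IsFinite) (k : ℕ) :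
    (tauInv^[k] M).IsFinite := by
  induction k generalizing M with
  | zero => exact hM
  | succ k ih =>
    have : ∀ i j : Qᵒᵖ, Finite (i ⟶ j) := fun i j =>
      Finite.of_injective (fun a : i ⟶ j => a.unop) fun a b h => Quiver.Hom.unop_inj h
    have : Finite Qᵒᵖ := Finite.of_equiv _ Opposite.equivToOpposite
    exact ih (M := tauInv M) fun i => hM.dual.ext (hP (op i))

/-- The transposed homomorphism. -/
def Hom.dual {M N : QRep Q} (f : Hom M N) : Hom (dual N) (dual M) where
  app i := (f.app i.unop).dualMap
  comm {i j} a := by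
    refine LinearMap.ext fun l => LinearMap.ext fun v => ?_
    let l' : Module.Dual ℂ (N.V i.unop) := l
    exact congrArg l' (f.comm_apply a.unop v).symm

theorem ringel_surjective_of_dual {M : QRep Q} (hM : M.IsFinite)
    (h : Function.Surjective (ringel (dual M) (dual M))) : Function.Surjective (ringel M M) := by
  intro η
  have hM' : ∀ i, Module.Finite ℂ (M.V i) := hM
  obtain ⟨Ψ, hΨ⟩ := h fun i j a => (η j.unop i.unop a.unop).dualMap
  let Ψ' : ∀ i, Module.Dual ℂ (M.V i) →ₗ[ℂ] Module.Dual ℂ (M.V i) := fun i => Ψ (op i)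
  choose ψ hψ using fun i => Module.exists_transpose (Ψ' i)
  refine ⟨fun i => -ψ i, ?_⟩
  funext i j a
  refine LinearMap.ext fun v => Module.eq_of_forall_dual (K := ℂ) fun w => ?_
  have h1 : (Ψ' i ((M.map a).dualMap w)) v -
      (Ψ' j w) (M.map a v) = w (η i j a v) :=
    LinearMap.congr_fun (LinearMap.congr_fun
      (congrFun (congrFun (congrFun hΨ (op j)) (op i)) a.op) w) v
  rw [← h1, ← hψ, ← hψ]
  simp
  abel

theorem HasOrthogonalSplitting.of_dual {M : QRep Q} (hM : M.IsFinite)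
    (h : (dual M).HasOrthogonalSplitting) : M.HasOrthogonalSplitting := by
  have hM' : ∀ i, Module.Finite ℂ (M.V i) := hM
  obtain ⟨e, he, ⟨i₀, hi₀⟩, ⟨i₁, hi₁⟩, hE, hH⟩ := h
  let e' : ∀ i, Module.Dual ℂ (M.V i) →ₗ[ℂ] Module.Dual ℂ (M.V i) := fun i => e.app (op i)
  have he' : ∀ i w, e' i (e' i w) = e' i w := fun i w => he (op i) w
  have hcomm : ∀ {i j : Q} (a : i ⟶ j) w, (M.map a).dualMap (e' j w) = e' i ((M.map a).dualMap w) :=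
    fun a w => e.comm_apply a.op w
  choose t ht using fun i => Module.exists_transpose (e' i)
  -- Duality reverses Hom and Ext, so the two summands change roles and the projection becomes the
  -- complement of the transpose of `e`.
  refine ⟨⟨fun i => LinearMap.id - t i, fun {i j} a => ?_⟩, ?_, ⟨i₁.unop, fun h => hi₁ ?_⟩,
    ⟨i₀.unop, fun h => hi₀ ?_⟩, fun η => ?_, fun ψ i => ?_⟩
  · refine LinearMap.ext fun v => Module.eq_of_forall_dual (K := ℂ) fun w => ?_
    have h1 := LinearMap.congr_fun (hcomm a w) v
    rw [← ht] at h1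
    simp only [LinearMap.comp_apply, LinearMap.sub_apply, LinearMap.id_apply, map_sub, ht]
    exact congrArg _ h1.symm
  · intro i v
    refine Module.eq_of_forall_dual (K := ℂ) fun w => ?_
    simp only [LinearMap.sub_apply, LinearMap.id_apply, map_sub, ht, he']
    abel
  · refine LinearMap.ext fun (w : Module.Dual ℂ (M.V i₁.unop)) => LinearMap.ext fun v => ?_
    have h1 := congrArg w (LinearMap.congr_fun h v)
    simp only [LinearMap.sub_apply, LinearMap.id_apply, map_sub, ht, LinearMap.zero_apply,
      map_zero] at h1
    exact (sub_eq_zero.mp h1).symm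
  · refine LinearMap.ext fun (w : Module.Dual ℂ (M.V i₀.unop)) => LinearMap.ext fun v => ?_
    have h1 := congrArg w (LinearMap.congr_fun h v)
    simp only [LinearMap.sub_apply, LinearMap.id_apply, map_sub, ht] at h1
    exact sub_eq_self.mp h1
  · obtain ⟨Ψ, hΨ⟩ := hE fun i j a => (η j.unop i.unop a.unop).dualMap
    let Ψ' : ∀ i, Module.Dual ℂ (M.V i) →ₗ[ℂ] Module.Dual ℂ (M.V i) := fun i => Ψ (op i)
    choose ψ hψ using fun i => Module.exists_transpose (Ψ' i)
    refine ⟨fun i => -ψ i, fun i j a => ?_⟩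
    refine LinearMap.ext fun v => Module.eq_of_forall_dual (K := ℂ) fun w => ?_
    have h1 : (Ψ' i ((M.map a).dualMap w)) v -
        (Ψ' j w) (M.map a v) =
        (e' j w) (η i j a v) - (e' i ((η i j a).dualMap (e' j w))) v :=
      LinearMap.congr_fun (LinearMap.congr_fun (hΨ (op j) (op i) a.op) w) v
    rw [← hψ, ← hψ, ← ht, ← ht] at h1
    simp only [LinearMap.dualMap_apply, ← ht] at h1
    simp only [ringel_apply, LinearMap.comp_apply, LinearMap.sub_apply, LinearMap.id_apply, map_sub,
      LinearMap.neg_apply, map_neg, sub_sub_cancel]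
    linear_combination h1
  · refine LinearMap.ext fun v => Module.eq_of_forall_dual (K := ℂ) fun w => ?_
    have h1 : (e' i ((ψ.app i).dualMap (w - e' i w))) v = 0 :=
      LinearMap.congr_fun (LinearMap.congr_fun (hH ψ.dual (op i)) w) v
    rw [← ht] at h1
    simp only [LinearMap.dualMap_apply, LinearMap.sub_apply] at h1
    simp only [LinearMap.comp_apply, LinearMap.sub_apply, LinearMap.id_apply, map_sub,
      LinearMap.zero_apply, map_zero, sub_sub_cancel, ht]
    exact h1

/-- A non-regular finite-dimensional representation of an acyclic quiver is rigid or splits. -/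
theorem ringel_surjective_or_hasOrthogonalSplitting_of_not_isRegular [Fintype Q]
    [∀ i j : Q, Fintype (i ⟶ j)] (hP : ∀ i : Qᵒᵖ, (P i).IsFinite) {M : QRep Q} (hM : M.IsFinite)
    (h : ¬ M.IsRegular) : Function.Surjective (ringel M M) ∨ M.HasOrthogonalSplitting := by
  classical
  unfold IsRegular at h
  push Not at h
  obtain ⟨N, -, ⟨N', φ, hφ⟩, hN⟩ := h
  by_cases hpre : N.IsPreprojective
  · obtain ⟨k, hk0, hk⟩ := hpre
    -- One more translate than in the definition of preprojective: `τ^k N` is projective, so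
    -- `τ^(k+1) N = 0`.
    refine ringel_surjective_or_hasOrthogonalSplitting M hM ⟨k + 1, N,
      Hom.comp (B := N.sum N') ⟨fun i => LinearMap.fst ℂ (N.V i) (N'.V i), fun a => rfl⟩ φ, ?_, ?_⟩
    · rw [Function.iterate_succ_apply']
      exact isZero_tau_of_ringel_surjective fun i => hk.ringel_surjective _
    · by_contra! hzero
      refine hk0 (IsZero.iterate_tau (fun i => subsingleton_of_forall_eq 0 fun v => ?_) k)
      obtain ⟨w, hw⟩ := (hφ i).2 ((v, 0) : N.V i × N'.V i)
      have h1 : ((φ.app i w : N.V i × N'.V i)).1 = 0 := LinearMap.congr_fun (hzero i) w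
      rwa [hw] at h1
  · obtain ⟨k, hk0, hk⟩ := hN hpre
    let E : ∀ i, M.V i ≃ₗ[ℂ] N.V i × N'.V i := fun i => LinearEquiv.ofBijective (φ.app i) (hφ i)
    let f : Hom N M :=
      { app := fun i => (E i).symm.toLinearMap ∘ₗ LinearMap.inl ℂ (N.V i) (N'.V i)
        comm := fun {i j} a => LinearMap.ext fun v => by
          refine (E j).injective ?_
          have h1 : E j (M.map a ((E i).symm (v, 0))) =
              (N.sum N').map a (E i ((E i).symm (v, 0))) := (φ.comm_apply a _).symm
          change E j (M.map a ((E i).symm (v, 0))) = E j ((E j).symm (N.map a v, 0))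
          rw [h1, LinearEquiv.apply_symm_apply, LinearEquiv.apply_symm_apply]
          exact Prod.ext rfl (map_zero (N'.map a)) }
    have hf : ∀ i, Function.Injective (f.app i) := fun i =>
      (E i).symm.injective.comp LinearMap.inl_injective
    have hNfin : N.IsFinite := fun i => by
      have := hM i
      exact Module.Finite.of_injective (f.app i) (hf i)
    have key : Function.Surjective (ringel (dual M) (dual M)) ∨
        (dual M).HasOrthogonalSplitting := by
      have : ∀ i j : Qᵒᵖ, Fintype (i ⟶ j) := fun i j =>
        Fintype.ofInjective (fun a : i ⟶ j => a.unop) fun a b h => Quiver.Hom.unop_inj h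
      have : Fintype Qᵒᵖ := Fintype.ofEquiv Q Opposite.equivToOpposite
      -- The inclusion of the preinjective summand dualizes to a nonzero map `D M ⟶ D N` with
      -- `τ^(k+1) D N = 0`.
      refine ringel_surjective_or_hasOrthogonalSplitting (dual M) hM.dual
        ⟨k + 1, dual N, f.dual, ?_, ?_⟩
      · rw [Function.iterate_succ_apply', ← dual_iterate_tauInv]
        exact hk.isZero_tau_dual hP (hNfin.iterate_tauInv hP k)
      · by_contra! hzero
        refine hk0 (isZero_of_dual ?_)
        rw [dual_iterate_tauInv]
        refine IsZero.iterate_tau (fun i => subsingleton_of_forall_eq 0 fun l => ?_) k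
        obtain ⟨l', rfl⟩ := LinearMap.dualMap_surjective_of_injective (hf i.unop) l
        exact LinearMap.congr_fun (hzero i) l'
    rcases key with h | h
    · exact .inl (ringel_surjective_of_dual hM h)
    · exact .inr (h.of_dual hM)

end QRep

/-! ### Acyclicity of the quiver from the dense orbit -/

namespace Quiver.Path

variable {V : Type*} [Quiver V]

theorem finite_length_le [Finite V] [∀ i j : V, Finite (i ⟶ j)] (a b : V) (n : ℕ) :
    {p : Path a b | p.length ≤ n}.Finite := by
  have h0 : ∀ b, {p : Path a b | p.length = 0}.Finite := by
    intro b
    refine Set.Subsingleton.finite ?_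
    rintro (_ | ⟨p, e⟩) hp (_ | ⟨q, e'⟩) hq
    · rfl
    all_goals simp_all
  induction n generalizing b with
  | zero => simpa using h0 b
  | succ n ih =>
    refine ((h0 b).union (Set.finite_iUnion fun c => Set.finite_iUnion fun e : c ⟶ b =>
      (ih c).image fun p => p.cons e)).subset ?_
    rintro (_ | ⟨p, e⟩) hp
    · exact Or.inl rfl
    · refine Or.inr (Set.mem_iUnion₂.mpr ⟨_, e, p, ?_, rfl⟩)
      simpa using hp

theorem nodup_vertices (hV : ∀ (a : V) (p : Path a a), p.length = 0) {a b : V} (p : Path a b) :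
    p.vertices.Nodup := by
  induction p with
  | nil => simp
  | @cons b c p e ih =>
    rw [vertices_cons, List.concat_eq_append, List.nodup_append]
    refine ⟨ih, by simp, ?_⟩
    rintro v hv w hw rfl
    rw [List.mem_singleton] at hw
    subst hw
    obtain ⟨p₁, p₂, -⟩ := exists_eq_comp_of_mem_vertices p hv
    have := hV _ (p₂.cons e)
    simp at this

/-- Without cycles a path repeats no vertex, so lengths are bounded by the number of vertices. -/
theorem finite_of_acyclic [Finite V] [∀ i j : V, Finite (i ⟶ j)]
    (hV : ∀ (a : V) (p : Path a a), p.length = 0) (a b : V) : Finite (Path a b) := by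
  have := Fintype.ofFinite V
  refine Set.finite_univ_iff.mp ((finite_length_le a b (Fintype.card V)).subset fun p _ => ?_)
  have h1 := (nodup_vertices hV p).length_le_card
  have h2 := p.vertices_length
  change p.length ≤ _
  omega

theorem exists_unop {a b : Vᵒᵖ} (p : Path a b) :
    ∃ q : Path b.unop a.unop, q.length = p.length := by
  induction p with
  | nil => exact ⟨nil, rfl⟩
  | cons p e ih =>
    obtain ⟨q, hq⟩ := ih
    exact ⟨e.unop.toPath.comp q, by simp [hq, add_comm]⟩

end Quiver.Path

theorem QRep.isFinite_P_op {Q : Type} [Quiver.{0} Q] [Finite Q] [∀ i j : Q, Finite (i ⟶ j)]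
    (hQ : ∀ (a : Q) (p : Quiver.Path a a), p.length = 0) (i : Qᵒᵖ) : (P i).IsFinite := by
  intro k
  have : Finite Qᵒᵖ := Finite.of_equiv _ Opposite.equivToOpposite
  have : ∀ i j : Qᵒᵖ, Finite (i ⟶ j) := fun i j =>
    Finite.of_injective (fun a : i ⟶ j => a.unop) fun a b h => Quiver.Hom.unop_inj h
  have : Finite (Quiver.Path i k) := Quiver.Path.finite_of_acyclic (fun a p => by
    obtain ⟨q, hq⟩ := p.exists_unop
    rw [← hq, hQ]) i k
  exact inferInstanceAs (Module.Finite ℂ (Quiver.Path i k →₀ ℂ))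

/-- An open set contains a product of infinite sets, on which only the zero polynomial vanishes. -/
theorem MvPolynomial.dense_eval_ne_zero {ι : Type*} [Finite ι] {f : MvPolynomial ι ℂ} (hf : f ≠ 0) :
    Dense {x : ι → ℂ | MvPolynomial.eval x f ≠ 0} := by
  rw [dense_iff_inter_open]
  intro U hU ⟨x, hx⟩
  by_contra hne
  rw [Set.not_nonempty_iff_eq_empty, Set.eq_empty_iff_forall_notMem] at hne
  obtain ⟨⟨I, u⟩, hu, hsub⟩ : ∃ I : Set ι × (ι → Set ℂ), (∀ i, I.2 i ∈ nhds (x i)) ∧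
      Set.univ.pi I.2 ⊆ U := by
    have h1 := hU.mem_nhds hx
    rw [nhds_pi, Filter.mem_pi'] at h1
    obtain ⟨I, t, ht, hsub⟩ := h1
    exact ⟨⟨I, t⟩, ht, (Set.pi_mono' (fun _ _ => le_rfl) (Set.subset_univ _)).trans hsub⟩
  refine hf (MvPolynomial.funext_set (s := u) (fun i => infinite_of_mem_nhds (x i) (hu i)) ?_)
  intro y hy
  by_contra hy'
  exact hne y ⟨hsub hy, by simpa using hy'⟩

theorem IsHypersurface.dense_compl {ι : Type} [Fintype ι] [DecidableEq ι] {D : Set (ι → ℂ)}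
    (hD : IsHypersurface D) : Dense Dᶜ := by
  obtain ⟨f, hf, rfl⟩ := hD
  exact MvPolynomial.dense_eval_ne_zero hf

namespace RepSpace

variable {Q : Type} [Quiver.{0} Q] {d : Q → ℕ}

/-- The matrix of a path in the representation `x`. -/
def pathMat (x : RepSpace Q d) {i : Q} : ∀ {k : Q}, Quiver.Path i k →
    Matrix (Fin (d k)) (Fin (d i)) ℂ
  | _, .nil => 1
  | _, .cons p a => mat x a * pathMat x p

theorem mat_act (g : ∀ i, GL (Fin (d i)) ℂ) (x : RepSpace Q d) {i j : Q} (a : i ⟶ j) :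
    mat (act g x) a = (g j).1 * mat x a * ((g i)⁻¹).1 := rfl

theorem pathMat_act (g : ∀ i, GL (Fin (d i)) ℂ) (x : RepSpace Q d) {i k : Q}
    (p : Quiver.Path i k) : pathMat (act g x) p = (g k).1 * pathMat x p * ((g i)⁻¹).1 := by
  induction p with
  | nil => simp [pathMat]
  | cons p a ih =>
    simp only [pathMat, ih, mat_act, Matrix.mul_assoc]
    congr 2
    rw [← Matrix.mul_assoc, ← Units.val_mul, inv_mul_cancel]
    simp

theorem continuous_mat {i j : Q} (a : i ⟶ j) : Continuous fun x : RepSpace Q d => mat x a :=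
  continuous_matrix fun _ _ => continuous_apply _

theorem continuous_pathMat {i k : Q} (p : Quiver.Path i k) :
    Continuous fun x : RepSpace Q d => pathMat x p := by
  induction p with
  | nil => exact continuous_const
  | cons p a ih => exact (continuous_mat a).matrix_mul ih

/-- A quiver with an oriented cycle has no representation of sincere dimension with dense orbit. -/
theorem length_eq_zero_of_dense_orbit (hd : ∀ i, 1 ≤ d i) {x₀ : RepSpace Q d}
    (h : Dense (Set.range fun g => act g x₀)) (i : Q) (p : Quiver.Path i i) : p.length = 0 := by
  by_contra hp
  -- The trace along a closed path is a continuous invariant, hence constant if some orbit is dense.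
  have htr : ∀ x : RepSpace Q d, (pathMat x p).trace = (pathMat x₀ p).trace := by
    have h1 : (fun x : RepSpace Q d => (pathMat x p).trace) = fun _ => (pathMat x₀ p).trace := by
      refine (continuous_pathMat p).matrix_trace.ext_on h continuous_const ?_
      rintro _ ⟨g, rfl⟩
      change (pathMat (act g x₀) p).trace = _
      rw [pathMat_act, Matrix.trace_mul_comm, ← Matrix.mul_assoc, ← Units.val_mul, inv_mul_cancel]
      simp
    exact congrFun h1
  have h0 : ∀ {k : Q} (q : Quiver.Path i k), q.length ≠ 0 →
      pathMat (0 : RepSpace Q d) q = 0 := by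
    rintro k (_ | ⟨q, a⟩) hq
    · simp at hq
    · have : mat (0 : RepSpace Q d) a = 0 := rfl
      simp [pathMat, this]
  let z : ∀ k, Fin (d k) := fun k => ⟨0, hd k⟩
  -- Every arrow of `y` sends the first basis vector to the first basis vector. The trace along the
  -- cycle is `1` at `y` and `0` at the origin.
  let y : RepSpace Q d := fun c => Matrix.single (z c.2.1) (z c.1) (1 : ℂ) c.2.2.2.1 c.2.2.2.2
  have hy : ∀ {k l : Q} (a : k ⟶ l), mat y a = Matrix.single (z l) (z k) 1 := fun a => rfl
  have h1 : ∀ {k : Q} (q : Quiver.Path i k), q.length ≠ 0 →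
      pathMat y q = Matrix.single (z k) (z i) 1 := by
    intro k q hq
    induction q with
    | nil => simp at hq
    | cons q a ih =>
      rcases q with _ | ⟨q, b⟩
      · simp [pathMat, hy]
      · rw [pathMat, ih (by simp), hy]
        simp
  have h2 := (htr y).trans (htr 0).symm
  rw [h1 p hp, h0 p hp] at h2
  simp at h2

theorem isFinite_toQRep (x : RepSpace Q d) : (toQRep x).IsFinite := fun i =>
  inferInstanceAs (Module.Finite ℂ (Fin (d i) → ℂ))

end RepSpace

theorem DefinesLinearFreeDivisor.ringel_surjective_or_hasOrthogonalSplitting {Q : Type} [Fintype Q]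
    [DecidableEq Q] [Quiver.{0} Q] [∀ i j : Q, Fintype (i ⟶ j)] [∀ i j : Q, DecidableEq (i ⟶ j)]
    {d : Q → ℕ} {D : Set (RepSpace Q d)} (hD : DefinesLinearFreeDivisor d D) (M : RepSpace Q d)
    (hreg : ¬ (RepSpace.toQRep M).IsRegular) :
    Function.Surjective (QRep.ringel M.toQRep M.toQRep) ∨ M.toQRep.HasOrthogonalSplitting := by
  obtain ⟨x₀, hx₀⟩ := hD.discriminant
  have hdense : Dense (Set.range fun g => RepSpace.act g x₀) :=
    hx₀ ▸ hD.linearFree.1.dense_compl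
  exact QRep.ringel_surjective_or_hasOrthogonalSplitting_of_not_isRegular
    (QRep.isFinite_P_op (RepSpace.length_eq_zero_of_dense_orbit hD.sincere hdense))
    (RepSpace.isFinite_toQRep M) hreg

/-! ### Jacobi's formula and derivations of polynomial rings -/

theorem Derivation.leibniz_finset_prod {R A : Type*} [CommRing R] [CommRing A] [Algebra R A]
    (δ : Derivation R A A) {ι : Type*} [DecidableEq ι] (s : Finset ι) (g : ι → A) :
    δ (∏ i ∈ s, g i) = ∑ i ∈ s, ∏ j ∈ s, Function.update g i (δ (g i)) j := by
  induction s using Finset.induction_on with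
  | empty => simp
  | insert a s ha ih =>
    rw [Finset.prod_insert ha, δ.leibniz, ih, Finset.sum_insert ha, smul_eq_mul, smul_eq_mul,
      add_comm, Finset.prod_insert ha, Function.update_self, Finset.mul_sum]
    congr 1
    · rw [mul_comm]
      congr 1
      refine Finset.prod_congr rfl fun j hj => ?_
      rw [Function.update_of_ne (ne_of_mem_of_not_mem hj ha)]
    · refine Finset.sum_congr rfl fun i hi => ?_
      rw [Finset.prod_insert ha, Function.update_of_ne (ne_of_mem_of_not_mem hi ha).symm]

theorem Derivation.finset_sum_apply {R A : Type*} [CommRing R] [CommRing A] [Algebra R A]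
    {ι : Type*} (s : Finset ι) (δ : ι → Derivation R A A) (f : A) :
    (∑ i ∈ s, δ i) f = ∑ i ∈ s, δ i f := by
  change Derivation.coeFnAddMonoidHom (∑ i ∈ s, δ i) f = _
  rw [map_sum, Finset.sum_apply]
  rfl

/-- Jacobi's formula for a derivation. -/
theorem Derivation.map_det {R A : Type*} [CommRing R] [CommRing A] [Algebra R A]
    (δ : Derivation R A A) {ι : Type*} [Fintype ι] [DecidableEq ι] (B : Matrix ι ι A) :
    δ B.det = (B.adjugate * B.map δ).trace := by
  have h1 : δ B.det = ∑ i, (B.updateCol i fun k => δ (B k i)).det := by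
    simp only [Matrix.det_apply, map_sum, Derivation.map_smul_of_tower]
    rw [Finset.sum_comm]
    refine Finset.sum_congr rfl fun σ _ => ?_
    rw [← Finset.smul_sum, Derivation.leibniz_finset_prod]
    congr 1
    refine Finset.sum_congr rfl fun i _ => Finset.prod_congr rfl fun j _ => ?_
    by_cases hj : j = i
    · subst hj
      simp
    · simp [hj]
  rw [h1, Matrix.trace]
  refine Finset.sum_congr rfl fun i _ => ?_
  rw [← Matrix.cramer_apply, Matrix.cramer_eq_adjugate_mulVec]
  rfl

/-- This form of Jacobi's formula will compute the weight of the Saito determinant under a linear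
field of the Lie algebra. -/
theorem Derivation.map_det_eq_trace_mul {R A : Type*} [CommRing R] [CommRing A] [Algebra R A]
    (δ : Derivation R A A) {ι : Type*} [Fintype ι] [DecidableEq ι] {B M N : Matrix ι ι A}
    (h : B.map δ = M * B + B * N) : δ B.det = (M.trace + N.trace) * B.det := by
  rw [δ.map_det, h, Matrix.mul_add, Matrix.trace_add, ← Matrix.mul_assoc, Matrix.trace_mul_comm,
    ← Matrix.mul_assoc, ← Matrix.mul_assoc, Matrix.mul_adjugate, Matrix.adjugate_mul]
  simp
  ring

namespace MvPolynomial

variable {ι : Type*}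

theorem totalDegree_pderiv_lt {p : MvPolynomial ι ℂ} {i : ι} (h : pderiv i p ≠ 0) :
    (pderiv i p).totalDegree < p.totalDegree := by
  obtain ⟨m, hm, hdeg⟩ := Finset.exists_mem_eq_sup (pderiv i p).support
    (Finset.nonempty_iff_ne_empty.mpr (by simpa using h)) (fun s => s.sum fun _ e => e)
  have h1 : m + Finsupp.single i 1 ∈ p.support := by
    rw [mem_support_iff] at hm ⊢
    rw [coeff_pderiv] at hm
    exact left_ne_zero_of_mul hm
  have h2 := le_totalDegree h1
  rw [Finsupp.sum_add_index' (by simp) (by simp), Finsupp.sum_single_index rfl] at h2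
  have h3 : (pderiv i p).totalDegree = m.sum fun _ e => e := hdeg
  omega

/-- A derivative has smaller degree, so divisibility forces it to vanish; in characteristic zero a
polynomial with all derivatives zero is constant. -/
theorem exists_not_dvd_pderiv {p : MvPolynomial ι ℂ} (hp : Irreducible p) :
    ∃ i, ¬ p ∣ pderiv i p := by
  by_contra! hdvd
  have h0 : ∀ i, pderiv i p = 0 := by
    intro i
    by_contra hne
    obtain ⟨q, hq⟩ := hdvd i
    have hq0 : q ≠ 0 := by
      rintro rfl
      exact hne (by simpa using hq)
    have h1 := totalDegree_pderiv_lt hne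
    rw [hq, totalDegree_mul_of_isDomain hp.ne_zero hq0] at h1
    omega
  have hC : p = C (coeff 0 p) := by
    classical
    ext m
    rw [coeff_C]
    split_ifs with hm
    · rw [hm]
    · obtain ⟨i, hi⟩ := Finsupp.ne_iff.mp (Ne.symm hm)
      have h1 := coeff_pderiv (i := i) p (m - Finsupp.single i 1)
      have h2 : m - Finsupp.single i 1 + Finsupp.single i 1 = m := by
        refine tsub_add_cancel_of_le (Finsupp.single_le_iff.mpr ?_)
        exact Nat.one_le_iff_ne_zero.mpr (by simpa using hi)
      rw [h0, h2, coeff_zero, eq_comm, mul_eq_zero] at h1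
      refine h1.resolve_right ?_
      exact Nat.cast_add_one_ne_zero _
  refine hp.not_isUnit ?_
  rw [hC]
  refine (isUnit_iff_ne_zero.mpr fun h => hp.ne_zero ?_).map C
  rw [hC, h, C_0]

theorem derivation_eq_sum [Fintype ι] (δ : Derivation ℂ (MvPolynomial ι ℂ) (MvPolynomial ι ℂ))
    (f : MvPolynomial ι ℂ) : δ f = ∑ l, δ (X l) * pderiv l f := by
  classical
  have h : δ = ∑ l, δ (X l) • pderiv l := by
    refine derivation_ext fun i => ?_
    rw [Derivation.finset_sum_apply]
    simp [pderiv_X, Pi.single_apply]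
  conv_lhs => rw [h]
  rw [Derivation.finset_sum_apply]
  rfl

theorem hasDerivAt_eval (δ : Derivation ℂ (MvPolynomial ι ℂ) (MvPolynomial ι ℂ))
    {γ : ℂ → ι → ℂ} {t : ℂ}
    (h : ∀ j, HasDerivAt (fun s => γ s j) (eval (γ t) (δ (X j))) t) (p : MvPolynomial ι ℂ) :
    HasDerivAt (fun s => eval (γ s) p) (eval (γ t) (δ p)) t := by
  induction p using MvPolynomial.induction_on with
  | C a => simpa using hasDerivAt_const t a
  | add p q hp hq =>
    simp only [map_add]
    exact hp.add hq
  | mul_X p j hp =>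
    have h1 := hp.mul (h j)
    simp only [map_mul, eval_X, Derivation.leibniz, smul_eq_mul, map_add]
    exact h1.congr_deriv (by ring)

end MvPolynomial

theorem Squarefree.dvd_of_forall_irreducible {R : Type*} [CommRing R] [IsDomain R]
    [UniqueFactorizationMonoid R] {f g : R} (hf : Squarefree f)
    (h : ∀ p, Irreducible p → p ∣ f → p ∣ g) : f ∣ g := by
  induction f using WfDvdMonoid.induction_on_irreducible generalizing g with
  | zero => exact absurd rfl hf.ne_zero
  | unit u hu => exact hu.dvd
  | mul a p ha hp ih =>
    obtain ⟨c, rfl⟩ := ih (hf.of_mul_right) fun q hq hqa => h q hq (hqa.mul_left p)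
    rcases hp.prime.dvd_or_dvd (h p hp (dvd_mul_right p a)) with h1 | h1
    · exact absurd (hf p (mul_dvd_mul_left p h1)) hp.not_isUnit
    · rw [mul_comm p a]
      exact mul_dvd_mul_left a h1

/-! ### Reduced equations and Saito's criterion -/

section LinearFreeDivisor

open MvPolynomial

set_option linter.unusedSectionVars false

variable {ι : Type} [Fintype ι] [DecidableEq ι]

/-- `f` is a reduced equation of `D`. -/
structure IsReducedEquation (D : Set (ι → ℂ)) (f : MvPolynomial ι ℂ) : Prop where
  ideal_eq : idealOf D = Ideal.span {f}
  squarefree : Squarefree f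
  mem_iff : ∀ x, x ∈ D ↔ eval x f = 0

/-- By the Nullstellensatz the ideal of `D` is the radical of `(g)`, generated by the product of the
prime factors of `g`. -/
theorem IsHypersurface.exists_isReducedEquation {D : Set (ι → ℂ)} (hD : IsHypersurface D) :
    ∃ f, IsReducedEquation D f := by
  obtain ⟨g, hg, rfl⟩ := hD
  let _ : StrongNormalizationMonoid (MvPolynomial ι ℂ) :=
    UniqueFactorizationMonoid.strongNormalizationMonoid
  have h1 : idealOf {x | eval x g = 0} = Ideal.span {UniqueFactorizationMonoid.radical g} := by
    have h2 : {x : ι → ℂ | eval x g = 0} = zeroLocus ℂ (Ideal.span {g}) := by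
      ext x
      simp [zeroLocus_span]
    rw [idealOf, h2, vanishingIdeal_zeroLocus_eq_radical]
    ext p
    rw [Ideal.mem_span_singleton, ← UniqueFactorizationMonoid.exists_dvd_pow_iff_radical_dvd hg]
    simp only [Ideal.mem_radical_iff, Ideal.mem_span_singleton]
  refine ⟨UniqueFactorizationMonoid.radical g, h1, UniqueFactorizationMonoid.squarefree_radical,
    fun x => ⟨fun hx => ?_, fun hx => ?_⟩⟩
  · have h2 : UniqueFactorizationMonoid.radical g ∈ idealOf {x | eval x g = 0} :=
      h1 ▸ Ideal.mem_span_singleton_self _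
    simpa using h2 x hx
  · obtain ⟨c, hc⟩ := UniqueFactorizationMonoid.radical_dvd_self (a := g)
    change eval x g = 0
    rw [hc, map_mul, hx, zero_mul]

namespace IsReducedEquation

variable {D : Set (ι → ℂ)} {f : MvPolynomial ι ℂ}

theorem mem_idealOf_iff (hf : IsReducedEquation D f) {g : MvPolynomial ι ℂ} :
    g ∈ idealOf D ↔ f ∣ g := by
  rw [hf.ideal_eq, Ideal.mem_span_singleton]

theorem mem_logDer_iff (hf : IsReducedEquation D f)
    {δ : Derivation ℂ (MvPolynomial ι ℂ) (MvPolynomial ι ℂ)} : δ ∈ logDer D ↔ f ∣ δ f := by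
  constructor
  · intro h
    exact hf.mem_idealOf_iff.mp (h f (hf.mem_idealOf_iff.mpr dvd_rfl))
  · intro h g hg
    obtain ⟨c, rfl⟩ := hf.mem_idealOf_iff.mp hg
    rw [hf.mem_idealOf_iff, δ.leibniz]
    exact dvd_add (Dvd.intro _ rfl) (h.mul_left c)

/-- The coefficient matrix of a family of vector fields. -/
noncomputable def _root_.coeffMatrix
    (δ : ι → Derivation ℂ (MvPolynomial ι ℂ) (MvPolynomial ι ℂ)) :
    Matrix ι ι (MvPolynomial ι ℂ) :=
  Matrix.of fun k j => δ k (X j)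

/-- Multiplying the vector of the `δ_k f` by the adjugate gives `det • ∇f`, so `f` divides each `det
* ∂_j f`. A prime factor `p` of the squarefree `f` misses some `∂_j f`, and so divides `det`. -/
theorem dvd_det_coeffMatrix (hf : IsReducedEquation D f)
    {δ : ι → Derivation ℂ (MvPolynomial ι ℂ) (MvPolynomial ι ℂ)} (hδ : ∀ k, δ k ∈ logDer D) :
    f ∣ (coeffMatrix δ).det := by
  have h1 : ∀ j, f ∣ pderiv j f * (coeffMatrix δ).det := by
    intro j
    have h2 : ∑ k, (coeffMatrix δ).adjugate j k * δ k f = pderiv j f * (coeffMatrix δ).det := by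
      have h3 : ∀ k, δ k f = (coeffMatrix δ).mulVec (fun l => pderiv l f) k := fun k =>
        derivation_eq_sum (δ k) f
      simp only [h3]
      change (coeffMatrix δ).adjugate.mulVec ((coeffMatrix δ).mulVec fun l => pderiv l f) j = _
      rw [Matrix.mulVec_mulVec, Matrix.adjugate_mul, Matrix.smul_mulVec, Matrix.one_mulVec,
        Pi.smul_apply, smul_eq_mul, mul_comm]
    rw [← h2]
    exact Finset.dvd_sum fun k _ => (hf.mem_logDer_iff.mp (hδ k)).mul_left _
  refine Squarefree.dvd_of_forall_irreducible hf.squarefree fun p hp ⟨q, hq⟩ => ?_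
  by_contra hdet
  obtain ⟨j, hj⟩ := exists_not_dvd_pderiv hp
  have h2 : p ∣ pderiv j f :=
    (hp.prime.dvd_or_dvd ((Dvd.intro _ hq.symm).trans (h1 j))).resolve_right hdet
  have hpq : ¬ p ∣ q := fun h => hp.not_isUnit (hf.squarefree p (hq ▸ mul_dvd_mul_left p h))
  rw [hq, pderiv_mul] at h2
  rcases hp.prime.dvd_or_dvd ((dvd_add_left (Dvd.intro _ rfl)).mp h2) with h | h
  · exact hj h
  · exact hpq h

theorem exists_logDer_det (hf : IsReducedEquation D f) (i : ι) :
    ∃ θ : ι → Derivation ℂ (MvPolynomial ι ℂ) (MvPolynomial ι ℂ), (∀ k, θ k ∈ logDer D) ∧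
      ∃ m : ℕ, (coeffMatrix θ).det = pderiv i f ^ m * f := by
  -- The fields `∂_i f ∂_k - ∂_k f ∂_i` kill `f`; with `f ∂_i` they form a triangular coefficient
  -- matrix.
  refine ⟨fun k => if k = i then f • pderiv i else
    pderiv i f • pderiv k - pderiv k f • pderiv i, fun k => ?_, ?_⟩
  · rw [hf.mem_logDer_iff]
    dsimp only
    split_ifs with hk
    · exact Dvd.intro _ rfl
    · simp [mul_comm]
  · refine ⟨Fintype.card {k // k ≠ i}, ?_⟩
    rw [Matrix.twoBlockTriangular_det _ (fun k => k ≠ i)]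
    · congr 1
      · have h1 : Matrix.toSquareBlockProp (coeffMatrix fun k => if k = i then f • pderiv i else
            pderiv i f • pderiv k - pderiv k f • pderiv i) (fun k => k ≠ i) =
            Matrix.diagonal fun _ => pderiv i f := by
          ext ⟨k, hk⟩ ⟨l, hl⟩ : 1
          simp only [Matrix.toSquareBlockProp_def, Matrix.of_apply, coeffMatrix, hk, if_false]
          by_cases hkl : k = l
          · subst hkl
            simp [pderiv_X, hk]
          · have : (⟨k, hk⟩ : {k // k ≠ i}) ≠ ⟨l, hl⟩ := fun h => hkl (congrArg Subtype.val h)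
            rw [Matrix.diagonal_apply_ne _ this]
            simp [pderiv_X, hl, Ne.symm hkl]
        rw [h1, Matrix.det_diagonal, Finset.prod_const, Finset.card_univ]
      · let _ : Unique {k // ¬ k ≠ i} := ⟨⟨i, by simp⟩, fun k => Subtype.ext (not_not.mp k.2)⟩
        rw [Matrix.det_unique]
        have : ((default : {k // ¬ k ≠ i}) : ι) = i := rfl
        simp [Matrix.toSquareBlockProp_def, coeffMatrix, this]
    · intro k hk l hl
      rw [not_not] at hk
      simp [coeffMatrix, hk, pderiv_X, hl]

theorem _root_.det_coeffMatrix_dvd (b : Module.Basis ι (MvPolynomial ι ℂ) (logDer D))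
    {θ : ι → Derivation ℂ (MvPolynomial ι ℂ) (MvPolynomial ι ℂ)} (hθ : ∀ k, θ k ∈ logDer D) :
    (coeffMatrix fun k => (b k).1).det ∣ (coeffMatrix θ).det := by
  have h1 : coeffMatrix θ = Matrix.of (fun k l => b.repr ⟨θ k, hθ k⟩ l) *
      coeffMatrix fun k => (b k).1 := by
    ext k j : 1
    have h2 : θ k = ∑ l, b.repr ⟨θ k, hθ k⟩ l • (b l).1 := by
      have h3 := congrArg Subtype.val (b.sum_repr ⟨θ k, hθ k⟩)
      exact h3.symm.trans (map_sum (logDer D).subtype _ _)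
    rw [Matrix.mul_apply]
    simp only [coeffMatrix, Matrix.of_apply]
    conv_lhs => rw [h2]
    rw [Derivation.finset_sum_apply]
    rfl
  rw [h1, Matrix.det_mul]
  exact dvd_mul_left _ _

/-- Saito's criterion for a free divisor. -/
theorem associated_det_coeffMatrix (hf : IsReducedEquation D f)
    (b : Module.Basis ι (MvPolynomial ι ℂ) (logDer D)) :
    Associated f (coeffMatrix fun k => (b k).1).det := by
  -- The determinant of the basis is `f * q` and divides that of any logarithmic family. The
  -- families `f ∂_k` and those of `exists_logDer_det` show that a prime factor of `q` would divide
  -- `f` and all `∂_i f`, so `q` is a unit.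
  obtain ⟨q, hq⟩ := hf.dvd_det_coeffMatrix fun k => (b k).2
  have hf0 := hf.squarefree.ne_zero
  have hpow : f * q ∣ f ^ Fintype.card ι := by
    have h1 := det_coeffMatrix_dvd b (θ := fun k => f • pderiv k) fun k =>
      hf.mem_logDer_iff.mpr (Dvd.intro _ rfl)
    have h2 : coeffMatrix (fun k => f • pderiv k) = Matrix.diagonal fun _ : ι => f := by
      ext k l : 1
      by_cases hkl : k = l
      · subst hkl
        simp [coeffMatrix]
      · simp [coeffMatrix, hkl, Ne.symm hkl]
    rwa [h2, Matrix.det_diagonal, Finset.prod_const, Finset.card_univ, hq] at h1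
  have hdiv : ∀ i, ∃ m : ℕ, q ∣ pderiv i f ^ m := by
    intro i
    obtain ⟨θ, hθ, m, hm⟩ := hf.exists_logDer_det i
    have h1 := det_coeffMatrix_dvd b hθ
    rw [hm, hq, mul_comm] at h1
    exact ⟨m, (mul_dvd_mul_iff_right hf0).mp h1⟩
  have hunit : IsUnit q := by
    by_contra hq1
    have hq0 : q ≠ 0 := by
      rintro rfl
      rw [mul_zero, zero_dvd_iff] at hpow
      exact pow_ne_zero _ hf0 hpow
    obtain ⟨p, hp, hpq⟩ := WfDvdMonoid.exists_irreducible_factor hq1 hq0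
    have hpf : p ∣ f := hp.prime.dvd_of_dvd_pow ((hpq.mul_left f).trans hpow)
    obtain ⟨r, hr⟩ := hpf
    have hpr : ¬ p ∣ r := fun h => hp.not_isUnit (hf.squarefree p (hr ▸ mul_dvd_mul_left p h))
    obtain ⟨i, hi⟩ := exists_not_dvd_pderiv hp
    obtain ⟨m, hm⟩ := hdiv i
    have h2 := hp.prime.dvd_of_dvd_pow (hpq.trans hm)
    rw [hr, pderiv_mul] at h2
    rcases hp.prime.dvd_or_dvd ((dvd_add_left (Dvd.intro _ rfl)).mp h2) with h | h
    · exact hi h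
    · exact hpr h
  rw [hq]
  exact (associated_mul_unit_right f q hunit)

end IsReducedEquation

end LinearFreeDivisor

/-! ### Linear logarithmic vector fields -/

section LinearVectorField

open MvPolynomial

variable {ι : Type} [Fintype ι] [DecidableEq ι]

theorem LinearMap.apply_eq_sum_mul_single (l : (ι → ℂ) →ₗ[ℂ] ℂ) (x : ι → ℂ) :
    l x = ∑ i, x i * l (Pi.single i 1) := by
  rw [l.pi_apply_eq_sum_univ x]
  refine Finset.sum_congr rfl fun i _ => ?_
  rw [smul_eq_mul]
  congr 2
  funext j
  simp [Pi.single_apply, eq_comm]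

/-- The polynomial of a linear form. -/
noncomputable def linForm : ((ι → ℂ) →ₗ[ℂ] ℂ) →ₗ[ℂ] MvPolynomial ι ℂ where
  toFun l := ∑ i, C (l (Pi.single i 1)) * X i
  map_add' l m := by simp [add_mul, Finset.sum_add_distrib]
  map_smul' c l := by simp [Finset.smul_sum, smul_eq_C_mul, mul_assoc]

theorem linForm_apply (l : (ι → ℂ) →ₗ[ℂ] ℂ) : linForm l = ∑ i, C (l (Pi.single i 1)) * X i := rfl

@[simp] theorem eval_linForm (l : (ι → ℂ) →ₗ[ℂ] ℂ) (x : ι → ℂ) : eval x (linForm l) = l x := by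
  rw [l.apply_eq_sum_mul_single x]
  simp [linForm_apply, mul_comm]

theorem pderiv_linForm (l : (ι → ℂ) →ₗ[ℂ] ℂ) (i : ι) :
    pderiv i (linForm l) = C (l (Pi.single i 1)) := by
  rw [linForm_apply, map_sum, Finset.sum_eq_single i]
  · rw [pderiv_C_mul, pderiv_X_self, mul_one]
  · intro j _ hj
    rw [pderiv_C_mul, pderiv_X_of_ne hj, mul_zero]
  · simp

theorem linForm_isHomogeneous (l : (ι → ℂ) →ₗ[ℂ] ℂ) : (linForm l).IsHomogeneous 1 :=
  IsHomogeneous.sum _ _ _ fun i _ => by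
    simpa using (isHomogeneous_C ι (l (Pi.single i 1))).mul (isHomogeneous_X ℂ i)

theorem MvPolynomial.IsHomogeneous.exists_eq_linForm {p : MvPolynomial ι ℂ}
    (hp : p.IsHomogeneous 1) : ∃ l, p = linForm l := by
  refine ⟨∑ i, coeff 0 (pderiv i p) • LinearMap.proj i, ?_⟩
  have h1 := hp.sum_X_mul_pderiv
  have h2 : ∀ i, pderiv i p = C (coeff 0 (pderiv i p)) := fun i =>
    totalDegree_eq_zero_iff_eq_C.mp ((totalDegree_zero_iff_isHomogeneous _).mpr hp.pderiv)
  rw [one_smul] at h1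
  conv_lhs => rw [← h1]
  rw [linForm_apply]
  refine Finset.sum_congr rfl fun i _ => ?_
  rw [mul_comm]
  conv_lhs => rw [h2]
  congr 2
  simp [LinearMap.sum_apply, Pi.single_apply]

/-- The linear vector field of an endomorphism. -/
noncomputable def linVF : Module.End ℂ (ι → ℂ) →ₗ[ℂ]
    Derivation ℂ (MvPolynomial ι ℂ) (MvPolynomial ι ℂ) where
  toFun L := mkDerivation ℂ fun j => linForm (LinearMap.proj j ∘ₗ L)
  map_add' L L' := derivation_ext fun j => by
    simp [mkDerivation_X, LinearMap.comp_add]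
  map_smul' c L := derivation_ext fun j => by
    simp [mkDerivation_X, LinearMap.comp_smul]

theorem linVF_X (L : Module.End ℂ (ι → ℂ)) (j : ι) :
    linVF L (X j) = linForm (LinearMap.proj j ∘ₗ L) :=
  mkDerivation_X _ _ _

@[simp] theorem eval_linVF_X (L : Module.End ℂ (ι → ℂ)) (j : ι) (x : ι → ℂ) :
    eval x (linVF L (X j)) = L x j := by
  rw [linVF_X, eval_linForm]
  rfl

theorem linVF_linForm (L : Module.End ℂ (ι → ℂ)) (l : (ι → ℂ) →ₗ[ℂ] ℂ) :
    linVF L (linForm l) = linForm (l ∘ₗ L) := by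
  refine MvPolynomial.funext fun x => ?_
  rw [eval_linForm, linForm_apply, map_sum, map_sum, LinearMap.comp_apply,
    l.apply_eq_sum_mul_single (L x)]
  refine Finset.sum_congr rfl fun i _ => ?_
  rw [← smul_eq_C_mul, Derivation.map_smul, smul_eval, eval_linVF_X, mul_comm]

theorem IsLinearVectorField.exists_eq_linVF
    {δ : Derivation ℂ (MvPolynomial ι ℂ) (MvPolynomial ι ℂ)} (h : IsLinearVectorField δ) :
    ∃ L, δ = linVF L := by
  choose l hl using fun j => (h j).exists_eq_linForm
  refine ⟨LinearMap.pi l, derivation_ext fun j => ?_⟩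
  rw [hl, linVF_X, LinearMap.proj_pi]

theorem totalDegree_linVF_le (L : Module.End ℂ (ι → ℂ)) (p : MvPolynomial ι ℂ) :
    (linVF L p).totalDegree ≤ p.totalDegree := by
  rw [derivation_eq_sum]
  refine totalDegree_finsetSum_le fun l _ => ?_
  by_cases h : pderiv l p = 0
  · simp [h]
  · refine (totalDegree_mul _ _).trans ?_
    have h1 := totalDegree_pderiv_lt h
    have h2 : (linVF L (X l)).totalDegree ≤ 1 := by
      rw [linVF_X]
      exact (linForm_isHomogeneous _).totalDegree_le
    omega

namespace IsReducedEquation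

variable {D : Set (ι → ℂ)} {f : MvPolynomial ι ℂ}

/-- A linear field does not raise degrees, so the cofactor of `f` has degree zero. -/
theorem exists_linVF_eq_C_mul (hf : IsReducedEquation D f) {L : Module.End ℂ (ι → ℂ)}
    (hL : linVF L ∈ logDer D) : ∃ c : ℂ, linVF L f = C c * f := by
  obtain ⟨q, hq⟩ := hf.mem_logDer_iff.mp hL
  by_cases hq0 : q = 0
  · exact ⟨0, by simp [hq, hq0]⟩
  · have h1 := totalDegree_linVF_le L f
    rw [hq, totalDegree_mul_of_isDomain hf.squarefree.ne_zero hq0] at h1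
    refine ⟨coeff 0 q, ?_⟩
    rw [← totalDegree_eq_zero_iff_eq_C.mp (by omega : q.totalDegree = 0), hq, mul_comm]

/-- Differentiating `f = 0` along a curve inside `D` shows that `L f` vanishes on `D`. -/
theorem linVF_mem_logDer (hf : IsReducedEquation D f) {L : Module.End ℂ (ι → ℂ)}
    (h : ∀ x ∈ D, ∃ γ : ℂ → ι → ℂ, γ 0 = x ∧ (∀ s, γ s ∈ D) ∧ HasDerivAt γ (L x) 0) :
    linVF L ∈ logDer D := by
  rw [hf.mem_logDer_iff, ← hf.mem_idealOf_iff, mem_vanishingIdeal_iff]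
  intro x hx
  obtain ⟨γ, h0, hγ, hL⟩ := h x hx
  have hj : ∀ j, HasDerivAt (fun s => γ s j) (eval (γ 0) (linVF L (X j))) 0 := by
    intro j
    rw [eval_linVF_X, h0]
    exact hasDerivAt_pi.mp hL j
  have h1 := hasDerivAt_eval (linVF L) hj f
  have h2 : ∀ s, eval (γ s) f = 0 := fun s => (hf.mem_iff (γ s)).mp (hγ s)
  simp only [h2] at h1
  have h3 : eval (γ 0) (linVF L f) = 0 := h1.unique (hasDerivAt_const 0 (0 : ℂ))
  rw [h0] at h3
  rw [aeval_eq_eval]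
  exact h3

end IsReducedEquation

/-- Comparing first-order terms at the origin: the polynomial coefficients of a linear field in a
linear basis may be replaced by their constant terms. -/
theorem eq_sum_eval_zero_smul {A : Module.End ℂ (ι → ℂ)} {L : ι → Module.End ℂ (ι → ℂ)}
    {q : ι → MvPolynomial ι ℂ} (h : linVF A = ∑ k, q k • linVF (L k)) :
    A = ∑ k, eval 0 (q k) • L k := by
  refine LinearMap.pi_ext' fun i => LinearMap.ext_ring (funext fun j => ?_)
  have h1 := congrArg (fun δ : Derivation ℂ (MvPolynomial ι ℂ) (MvPolynomial ι ℂ) =>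
    eval 0 (pderiv i (δ (X j)))) h
  have h2 : ∀ k, eval 0 (pderiv i ((q k • linVF (L k)) (X j))) =
      eval 0 (q k) * L k (Pi.single i 1) j := by
    intro k
    rw [Derivation.smul_apply, smul_eq_mul, linVF_X, pderiv_mul, pderiv_linForm, map_add, map_mul,
      map_mul, eval_linForm, map_zero, mul_zero, zero_add, eval_C]
    rfl
  simp only [Derivation.finset_sum_apply, map_sum, h2, linVF_X, pderiv_linForm, eval_C] at h1
  simpa [LinearMap.sum_apply] using h1

/-- If sufficiently many linear vector fields are logarithmic, they are a basis. -/
theorem IsLinearFreeDivisor.exists_section {D : Set (ι → ℂ)} (hD : IsLinearFreeDivisor D)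
    {f : MvPolynomial ι ℂ} (hf : IsReducedEquation D f) {V : Type*} [AddCommGroup V] [Module ℂ V]
    [Module.Finite ℂ V] (ρ : V →ₗ[ℂ] Module.End ℂ (ι → ℂ)) (hlog : ∀ v, linVF (ρ v) ∈ logDer D)
    (hrank : Fintype.card ι + Module.finrank ℂ (LinearMap.ker ρ) ≤ Module.finrank ℂ V) :
    ∃ (c : (ι → ℂ) →ₗ[ℂ] V) (r : V →ₗ[ℂ] ι → ℂ), (∀ w, r (c w) = w) ∧
      (∀ v, r v = 0 → ρ v = 0) ∧
      Associated f (coeffMatrix fun k => linVF (ρ (c (Pi.single k 1)))).det := by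
  obtain ⟨-, b, hb⟩ := hD
  choose L hL using fun k => (hb k).exists_eq_linVF
  let θ : V → logDer D := fun v => ⟨linVF (ρ v), hlog v⟩
  have hadd : ∀ v w, θ (v + w) = θ v + θ w := fun v w => Subtype.ext (by simp [θ])
  have hsmul : ∀ (c : ℂ) v, θ (c • v) = (C c : MvPolynomial ι ℂ) • θ v := fun c v => by
    refine Subtype.ext (derivation_ext fun j => ?_)
    simp [θ, smul_eq_C_mul]
  let r : V →ₗ[ℂ] ι → ℂ :=
    { toFun := fun v k => eval 0 (b.repr (θ v) k)
      map_add' := fun v w => by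
        funext k
        rw [hadd, map_add, Finsupp.add_apply, map_add]
        rfl
      map_smul' := fun c v => by
        funext k
        rw [hsmul, map_smul, Finsupp.smul_apply, smul_eq_mul, map_mul, eval_C]
        rfl }
  have hr : ∀ v, ρ v = ∑ k, r v k • L k := by
    intro v
    refine eq_sum_eval_zero_smul (q := b.repr (θ v)) ?_
    simp only [← hL]
    exact (congrArg Subtype.val (b.sum_repr (θ v))).symm.trans (map_sum (logDer D).subtype _ _)
  have hker : LinearMap.ker r ≤ LinearMap.ker ρ := by
    intro v hv
    rw [LinearMap.mem_ker] at hv ⊢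
    simp [hr v, hv]
  -- The kernel of `r` is at most that of `ρ`, so `hrank` forces the image of `r` to have full
  -- dimension.
  have hsurj : Function.Surjective r := by
    rw [← LinearMap.range_eq_top]
    refine Submodule.eq_top_of_finrank_eq (le_antisymm (Submodule.finrank_le _) ?_)
    have h1 := r.finrank_range_add_finrank_ker
    have h2 := Submodule.finrank_mono hker
    rw [Module.finrank_fintype_fun_eq_card]
    omega
  obtain ⟨c, hc⟩ := r.exists_rightInverse_of_surjective (LinearMap.range_eq_top.mpr hsurj)
  have hc' : ∀ w, r (c w) = w := fun w => LinearMap.congr_fun hc w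
  refine ⟨c, r, hc', fun v hv => hker hv, ?_⟩
  -- The section `c` hits exactly the given basis fields, so Saito's criterion applies to the family
  -- `ρ ∘ c`.
  have h1 : (fun k => linVF (ρ (c (Pi.single k 1)))) = fun k => (b k).1 := by
    funext k
    rw [hr, hc', hL]
    congr 1
    simp [Pi.single_apply]
  rw [h1]
  exact hf.associated_det_coeffMatrix b

end LinearVectorField

/-! ### Isotropy and the weight of the equation -/

section LinearVectorField

open MvPolynomial

variable {ι : Type} [Fintype ι] [DecidableEq ι] {V : Type*} [AddCommGroup V] [Module ℂ V]

theorem LinearMap.trace_eq_trace_toMatrix' (A : Module.End ℂ (ι → ℂ)) :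
    LinearMap.trace ℂ _ A = (LinearMap.toMatrix' A).trace := by
  rw [LinearMap.trace_eq_matrix_trace ℂ (Pi.basisFun ℂ ι), LinearMap.toMatrix_eq_toMatrix']

theorem vecMul_coeffMatrix_map_eval (A : (ι → ℂ) →ₗ[ℂ] Module.End ℂ (ι → ℂ)) (w y : ι → ℂ) :
    Matrix.vecMul w ((coeffMatrix fun k => linVF (A (Pi.single k 1))).map (eval y)) = A w y := by
  have h1 : A w = ∑ k, w k • A (Pi.single k 1) := by
    have h2 : w = ∑ k, w k • (Pi.single k 1 : ι → ℂ) := by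
      funext j
      simp [Pi.single_apply]
    conv_lhs => rw [h2]
    rw [map_sum]
    simp only [map_smul]
  rw [h1]
  funext j
  simp [Matrix.vecMul, dotProduct, coeffMatrix, LinearMap.sum_apply]

theorem IsReducedEquation.isUnit_map_eval_iff {D : Set (ι → ℂ)} {f : MvPolynomial ι ℂ}
    (hf : IsReducedEquation D f) {B : Matrix ι ι (MvPolynomial ι ℂ)} (hB : Associated f B.det)
    (y : ι → ℂ) : IsUnit (B.map (eval y)) ↔ y ∉ D := by
  obtain ⟨u, hu⟩ := hB
  have h1 : (B.map (eval y)).det = eval y f * eval y u := by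
    rw [← map_mul, hu, RingHom.map_det]
    rfl
  have h2 : eval y (u : MvPolynomial ι ℂ) ≠ 0 := (u.isUnit.map (eval y)).ne_zero
  rw [Matrix.isUnit_iff_isUnit_det, h1, isUnit_iff_ne_zero, hf.mem_iff]
  simp [h2]

namespace IsLinearFreeDivisor

variable [Module.Finite ℂ V] {D : Set (ι → ℂ)} (hD : IsLinearFreeDivisor D) {f : MvPolynomial ι ℂ}
  (hf : IsReducedEquation D f) (ρ : V →ₗ[ℂ] Module.End ℂ (ι → ℂ))
  (hlog : ∀ v, linVF (ρ v) ∈ logDer D)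
  (hrank : Fintype.card ι + Module.finrank ℂ (LinearMap.ker ρ) ≤ Module.finrank ℂ V)

include hD hf hlog hrank

/-- Off `D` the Saito matrix is invertible, so no nonzero field of the Lie algebra vanishes there.
-/
theorem eq_zero_of_apply_eq_zero {y : ι → ℂ} (hy : y ∉ D) {v : V} (hv : ρ v y = 0) : ρ v = 0 := by
  obtain ⟨c, r, hrc, hker, hdet⟩ := hD.exists_section hf ρ hlog hrank
  refine hker v ?_
  have h1 : ρ (c (r v)) = ρ v := by
    rw [← sub_eq_zero, ← map_sub]
    exact hker _ (by rw [map_sub, hrc, sub_self])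
  have h2 : Matrix.vecMul (r v) ((coeffMatrix fun k => linVF (ρ (c (Pi.single k 1)))).map (eval y)) =
    ρ (c (r v)) y := vecMul_coeffMatrix_map_eval (ρ ∘ₗ c) (r v) y
  rw [h1, hv] at h2
  refine Matrix.vecMul_injective_iff_isUnit.mpr ((hf.isUnit_map_eval_iff hdet y).mpr hy) ?_
  simpa using h2

/-- If the fields span the tangent space at `y`, the Saito matrix is invertible there and its
determinant, an associate of `f`, is nonzero. -/
theorem notMem_of_surjective {y : ι → ℂ} (hy : ∀ z, ∃ v, ρ v y = z) : y ∉ D := by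
  obtain ⟨c, r, hrc, hker, hdet⟩ := hD.exists_section hf ρ hlog hrank
  rw [← hf.isUnit_map_eval_iff hdet, ← Matrix.vecMul_surjective_iff_isUnit]
  intro z
  obtain ⟨v, hv⟩ := hy z
  have h1 : ρ (c (r v)) = ρ v := by
    rw [← sub_eq_zero, ← map_sub]
    exact hker _ (by rw [map_sub, hrc, sub_self])
  refine ⟨r v, ?_⟩
  have h2 : Matrix.vecMul (r v) ((coeffMatrix fun k => linVF (ρ (c (Pi.single k 1)))).map (eval y)) =
    ρ (c (r v)) y := vecMul_coeffMatrix_map_eval (ρ ∘ₗ c) (r v) y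
  rw [h1, hv] at h2
  exact h2

/-- The weight of the equation of a linear free divisor with a unimodular group is the trace. -/
theorem linVF_eq_trace_mul (v : V) (ad : V →ₗ[ℂ] V) (had : ∀ w, ρ (ad w) = ρ v * ρ w - ρ w * ρ v)
    (htr : LinearMap.trace ℂ V ad = 0) (hadker : ∀ w, ρ w = 0 → ad w = 0) :
    linVF (ρ v) f = C (LinearMap.trace ℂ _ (ρ v)) * f := by
  obtain ⟨c, r, hrc, hker, ⟨u, hu⟩⟩ := hD.exists_section hf ρ hlog hrank
  set B := coeffMatrix fun k => linVF (ρ (c (Pi.single k 1))) with hB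
  have hρ : ∀ w, ρ (c (r w)) = ρ w := fun w => by
    rw [← sub_eq_zero, ← map_sub]
    exact hker _ (by rw [map_sub, hrc, sub_self])
  -- `N` is the adjoint action induced on the image of `ρ`. Its trace is that of `ad`, because `c ∘
  -- r` is the identity up to `ker ρ`, which `ad` kills.
  let N : Matrix ι ι ℂ := (LinearMap.toMatrix' (r ∘ₗ ad ∘ₗ c)).transpose
  have hN : N.trace = 0 := by
    rw [Matrix.trace_transpose, ← LinearMap.trace_eq_trace_toMatrix', LinearMap.trace_comp_comm',
      LinearMap.comp_assoc]
    have h1 : ad ∘ₗ c ∘ₗ r = ad := by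
      refine LinearMap.ext fun w => ?_
      rw [LinearMap.comp_apply, LinearMap.comp_apply, ← sub_eq_zero, ← map_sub]
      exact hadker _ (by rw [map_sub, hρ, sub_self])
    rw [h1, htr]
  -- Differentiating the linear coefficients of the field `ρ w` along `ρ v` gives `ρ w * ρ v = ρ v *
  -- ρ w - ρ (ad w)`: a column operation by `ρ v` and a row operation by `ad`.
  have hBmap : B.map (linVF (ρ v)) = (-(N.map C)) * B +
      B * ((LinearMap.toMatrix' (ρ v)).transpose.map C) := by
    ext k j : 1
    refine MvPolynomial.funext fun x => ?_
    have hw : ∀ w, ρ w * ρ v = ρ v * ρ w - ρ (ad w) := fun w => by rw [had, sub_sub_cancel]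
    have h1 : eval x (linVF (ρ v) (B k j)) = (ρ (c (Pi.single k 1)) * ρ v) x j := by
      change eval x (linVF (ρ v) (linVF (ρ (c (Pi.single k 1))) (X j))) = _
      rw [linVF_X, linVF_linForm, eval_linForm]
      rfl
    have h2 := congrFun (vecMul_coeffMatrix_map_eval (ρ ∘ₗ c) (N k) x) j
    have h3 : (ρ ∘ₗ c) (N k) = ρ (ad (c (Pi.single k 1))) := by
      have h4 : N k = r (ad (c (Pi.single k 1))) := by
        funext m
        simp [N, LinearMap.toMatrix'_apply]
      rw [h4, LinearMap.comp_apply, hρ]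
    rw [h3] at h2
    have h5 : ∀ w : ι → ℂ, ρ v w j = ∑ i, w i * LinearMap.toMatrix' (ρ v) j i := by
      intro w
      rw [← LinearMap.toMatrix'_mulVec]
      simp [Matrix.mulVec, dotProduct, mul_comm]
    rw [Matrix.map_apply, h1, hw, LinearMap.sub_apply, Pi.sub_apply, ← h2, Module.End.mul_apply, h5]
    simp only [Matrix.add_apply, Matrix.mul_apply, map_add, map_sum, map_mul, Matrix.neg_apply,
      Matrix.map_apply, Matrix.transpose_apply, eval_C, Matrix.vecMul, dotProduct, map_neg, hB,
      coeffMatrix, Matrix.of_apply, eval_linVF_X, LinearMap.comp_apply, neg_mul]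
    ring
  have h1 := (linVF (ρ v)).map_det_eq_trace_mul hBmap
  have h2 : ∀ A : Matrix ι ι ℂ, (A.map (C : ℂ →+* MvPolynomial ι ℂ)).trace = C A.trace := by
    intro A
    simp [Matrix.trace]
  rw [Matrix.trace_neg, h2, hN, h2, Matrix.trace_transpose, ← LinearMap.trace_eq_trace_toMatrix', map_zero,
    neg_zero, zero_add, ← hu] at h1
  -- The unit relating `f` to the determinant is constant, so both have the same weight.
  obtain ⟨a, -, ha⟩ := MvPolynomial.isUnit_iff_eq_C_of_isReduced.mp u.isUnit
  have h3 : linVF (ρ v) (C a * f) = C a * linVF (ρ v) f := by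
    rw [← smul_eq_C_mul, Derivation.map_smul, smul_eq_C_mul]
  rw [ha, mul_comm f, h3, mul_left_comm] at h1
  exact mul_left_cancel₀ (ha ▸ u.ne_zero) h1

end IsLinearFreeDivisor

end LinearVectorField

/-! ### A criterion for weak quasihomogeneity -/

section WeaklyQuasihomogeneous

open MvPolynomial

set_option linter.unusedSectionVars false

variable {ι : Type} [Fintype ι] [DecidableEq ι]

theorem valueAt_algebraMap (p : ι → ℂ) (g : MvPolynomial ι ℂ) :
    valueAt p (algebraMap _ _ g) = eval p g :=
  IsLocalization.lift_eq _ _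

theorem partialAt_algebraMap (p : ι → ℂ) (j : ι) (g : MvPolynomial ι ℂ) :
    partialAt p j (algebraMap _ _ g) = algebraMap _ _ (pderiv j g) := by
  rw [← Localization.mk_one_eq_algebraMap, partialAt_mk, ← Localization.mk_one_eq_algebraMap]
  congr 1
  · simp
  · simp

theorem IsReducedEquation.isLocalEquation {D : Set (ι → ℂ)} {f : MvPolynomial ι ℂ}
    (hf : IsReducedEquation D f) (p : ι → ℂ) : IsLocalEquation D p (algebraMap _ _ f) := by
  rw [IsLocalEquation, hf.ideal_eq, Ideal.map_span, Set.image_singleton]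

theorem Matrix.exists_eigenvector_of_mem_spectrum_transpose {K : Matrix ι ι ℂ} {μ : ℂ}
    (h : μ ∈ spectrum ℂ K.transpose) : ∃ v ≠ 0, K.mulVec v = μ • v := by
  rw [spectrum.mem_iff, Matrix.isUnit_iff_isUnit_det, isUnit_iff_ne_zero, not_not,
    ← Matrix.det_transpose] at h
  obtain ⟨v, hv, hKv⟩ := Matrix.exists_mulVec_eq_zero_iff.mpr h
  refine ⟨v, hv, ?_⟩
  rw [Matrix.transpose_sub, Matrix.transpose_transpose, Matrix.sub_mulVec, sub_eq_zero,
    Matrix.algebraMap_eq_diagonal, Matrix.diagonal_transpose] at hKv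
  rw [← hKv]
  funext j
  simp [Matrix.mulVec_diagonal]

/-- A criterion for weak quasihomogeneity at `M`: the field `L + ∑ (x_i - M_i) R_i` vanishes at `M`
and its linear part there is `K`. -/
theorem IsReducedEquation.isWeaklyQuasihomogeneousAt {D : Set (ι → ℂ)} {f : MvPolynomial ι ℂ}
    (hf : IsReducedEquation D f) {M : ι → ℂ} {L : Module.End ℂ (ι → ℂ)} {χ : ℝ} (hχ : 0 < χ)
    (hL : linVF L f = C (χ : ℂ) * f) (hLM : L M = 0) {R : ι → Module.End ℂ (ι → ℂ)}
    (hR : ∀ i, linVF (R i) ∈ logDer D) {K : Module.End ℂ (ι → ℂ)}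
    (hK : ∀ i, K (Pi.single i 1) = L (Pi.single i 1) + R i M)
    (hspec : ∀ (μ : ℂ) (v : ι → ℂ), v ≠ 0 → K v = μ • v → ∃ r : ℝ, 0 ≤ r ∧ μ = r) :
    IsWeaklyQuasihomogeneousAt D M := by
  choose r hr using fun i => hf.exists_linVF_eq_C_mul (hR i)
  -- Since `L M = 0`, the field `L + ∑ (x_i - M_i) R_i` has coefficients `∑ (x_i - M_i) a_ij`. It
  -- multiplies `f` by `u`, a unit at `M` with value `χ`; the required matrix is `u⁻¹ a`.
  let a : ι → ι → MvPolynomial ι ℂ := fun i j => C (L (Pi.single i 1) j) + linVF (R i) (X j)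
  let u : MvPolynomial ι ℂ := C (χ : ℂ) + ∑ i, (X i - C (M i)) * C (r i)
  have hu0 : eval M u = χ := by simp [u]
  have hid : u * f = ∑ i, ∑ j, (X i - C (M i)) * a i j * pderiv j f := by
    have h1 : ∀ j, linVF L (X j) = ∑ i, (X i - C (M i)) * C (L (Pi.single i 1) j) := by
      intro j
      have h2 : ∑ i, M i * L (Pi.single i 1) j = 0 := by
        have h3 := (LinearMap.proj j ∘ₗ L).apply_eq_sum_mul_single M
        rw [LinearMap.comp_apply, hLM, map_zero] at h3
        exact h3.symm
      rw [linVF_X, linForm_apply]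
      simp only [sub_mul, Finset.sum_sub_distrib, ← C_mul, ← map_sum, h2, map_zero, sub_zero]
      exact Finset.sum_congr rfl fun i _ => mul_comm _ _
    have h4 : u * f = linVF L f + ∑ i, (X i - C (M i)) * linVF (R i) f := by
      rw [hL]
      simp only [hr, u, add_mul, Finset.sum_mul, mul_assoc]
    rw [h4, derivation_eq_sum, Finset.sum_comm]
    simp only [derivation_eq_sum (linVF (R _)) f, h1, Finset.mul_sum, Finset.sum_mul]
    rw [Finset.sum_comm (s := Finset.univ) (t := Finset.univ)
      (f := fun i j => (X i - C (M i)) * (linVF (R i) (X j) * pderiv j f)),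
      ← Finset.sum_add_distrib]
    refine Finset.sum_congr rfl fun j _ => ?_
    rw [← Finset.sum_add_distrib]
    refine Finset.sum_congr rfl fun i _ => ?_
    simp only [a]
    ring
  have hunit : IsUnit (algebraMap (MvPolynomial ι ℂ) (LocalRingAt M) u) := by
    refine IsLocalization.map_units (M := (RingHom.ker (eval M)).primeCompl) (LocalRingAt M)
      ⟨u, fun h => ?_⟩
    rw [SetLike.mem_coe, RingHom.mem_ker, hu0] at h
    exact hχ.ne' (by exact_mod_cast h)
  obtain ⟨w, hw⟩ := hunit
  have hwinv : valueAt M (w⁻¹ : (LocalRingAt M)ˣ) = (χ : ℂ)⁻¹ := by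
    refine eq_inv_of_mul_eq_one_left ?_
    rw [← hu0, ← valueAt_algebraMap, ← hw, ← map_mul, Units.inv_mul, map_one]
  refine ⟨algebraMap _ _ f, hf.isLocalEquation M,
    Matrix.of fun i j => (w⁻¹ : (LocalRingAt M)ˣ) * algebraMap _ _ (a i j), ?_, ?_⟩
  · have h1 := congrArg (algebraMap (MvPolynomial ι ℂ) (LocalRingAt M)) hid
    rw [map_mul, ← hw] at h1
    refine (Units.inv_mul_cancel_left w (algebraMap _ _ f)).symm.trans ?_
    rw [h1, map_sum, Finset.mul_sum]
    refine Finset.sum_congr rfl fun i _ => ?_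
    rw [map_sum, Finset.mul_sum]
    refine Finset.sum_congr rfl fun j _ => ?_
    rw [partialAt_algebraMap, map_mul, map_mul, Matrix.of_apply]
    ring
  · intro μ hμ
    -- The row index of `A` belongs to the coordinate `x_i`, so `A(M)` is the transpose of `χ⁻¹ K`;
    -- eigenvalues are unaffected.
    have h1 : Matrix.map (Matrix.of fun i j => ((w⁻¹ : (LocalRingAt M)ˣ) : LocalRingAt M) *
        algebraMap _ _ (a i j)) (valueAt M) =
        ((χ : ℂ)⁻¹ • LinearMap.toMatrix' K).transpose := by
      ext i j
      rw [Matrix.map_apply, Matrix.of_apply, map_mul, hwinv, valueAt_algebraMap]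
      simp [a, LinearMap.toMatrix'_apply, hK]
    rw [h1] at hμ
    obtain ⟨v, hv, hKv⟩ := Matrix.exists_eigenvector_of_mem_spectrum_transpose hμ
    rw [Matrix.smul_mulVec, LinearMap.toMatrix'_mulVec] at hKv
    have hχ0 : (χ : ℂ) ≠ 0 := by exact_mod_cast hχ.ne'
    obtain ⟨s, hs, hμs⟩ := hspec (χ * μ) v hv (by
      rw [← smul_smul, ← hKv, smul_inv_smul₀ hχ0])
    refine ⟨s / χ, div_nonneg hs hχ.le, ?_⟩
    rw [Complex.ofReal_div, ← hμs, mul_div_cancel_left₀ _ hχ0]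

end WeaklyQuasihomogeneous

/-! ### The infinitesimal action of `GL(Q, d)` -/

namespace RepSpace

variable {Q : Type} [Quiver.{0} Q] {d : Q → ℕ}

variable (d) in
/-- The Lie algebra of `GL(Q, d)`. -/
abbrev LieAlg : Type := ∀ i : Q, Matrix (Fin (d i)) (Fin (d i)) ℂ

theorem ext_mat {x y : RepSpace Q d} (h : ∀ {i j : Q} (a : i ⟶ j), mat x a = mat y a) : x = y := by
  funext ⟨i, j, a, k, l⟩
  exact congrFun (congrFun (h a) k) l

/-- The infinitesimal action of the Lie algebra of `GL(Q, d)`. -/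
noncomputable def inf : LieAlg d →ₗ[ℂ] Module.End ℂ (RepSpace Q d) :=
  LinearMap.mk₂ ℂ
    (fun ψ x c => (ψ c.2.1 * mat x c.2.2.1 - mat x c.2.2.1 * ψ c.1) c.2.2.2.1 c.2.2.2.2)
    (fun ψ φ x => ext_mat fun {i j} a => by
      have h : (ψ j + φ j) * mat x a - mat x a * (ψ i + φ i) =
          (ψ j * mat x a - mat x a * ψ i) + (φ j * mat x a - mat x a * φ i) := by
        rw [Matrix.add_mul, Matrix.mul_add]
        abel
      exact h)
    (fun c ψ x => ext_mat fun {i j} a => by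
      have h : (c • ψ j) * mat x a - mat x a * (c • ψ i) =
          c • (ψ j * mat x a - mat x a * ψ i) := by
        rw [Matrix.smul_mul, Matrix.mul_smul, smul_sub]
      exact h)
    (fun ψ x y => ext_mat fun {i j} a => by
      have h : ψ j * (mat x a + mat y a) - (mat x a + mat y a) * ψ i =
          (ψ j * mat x a - mat x a * ψ i) + (ψ j * mat y a - mat y a * ψ i) := by
        rw [Matrix.add_mul, Matrix.mul_add]
        abel
      exact h)
    (fun c ψ x => ext_mat fun {i j} a => by
      have h : ψ j * (c • mat x a) - (c • mat x a) * ψ i =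
          c • (ψ j * mat x a - mat x a * ψ i) := by
        rw [Matrix.smul_mul, Matrix.mul_smul, smul_sub]
      exact h)

theorem mat_inf (ψ : LieAlg d) (x : RepSpace Q d) {i j : Q} (a : i ⟶ j) :
    mat (inf ψ x) a = ψ j * mat x a - mat x a * ψ i := rfl

theorem mat_sub (x y : RepSpace Q d) {i j : Q} (a : i ⟶ j) : mat (x - y) a = mat x a - mat y a :=
  rfl

theorem act_mul (g h : ∀ i, GL (Fin (d i)) ℂ) (x : RepSpace Q d) :
    act (g * h) x = act g (act h x) := by
  refine ext_mat fun a => ?_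
  simp [mat_act, Matrix.mul_assoc]

theorem act_one (x : RepSpace Q d) : act 1 x = x := by
  refine ext_mat fun a => ?_
  simp [mat_act]

theorem act_mem_iff {D : Set (RepSpace Q d)} {x₀ : RepSpace Q d}
    (hD : Dᶜ = Set.range fun g => act g x₀) (g : ∀ i, GL (Fin (d i)) ℂ) (x : RepSpace Q d) :
    act g x ∈ D ↔ x ∈ D := by
  have h1 : ∀ (g : ∀ i, GL (Fin (d i)) ℂ) (x : RepSpace Q d), x ∈ Dᶜ → act g x ∈ Dᶜ := by
    intro g x hx
    rw [hD] at hx ⊢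
    obtain ⟨h, rfl⟩ := hx
    exact ⟨g * h, act_mul g h x₀⟩
  refine not_iff_not.mp ⟨fun h => ?_, h1 g x⟩
  have h2 := h1 g⁻¹ _ h
  rwa [← act_mul, inv_mul_cancel, act_one] at h2

section Exponential

open scoped Matrix.Norms.Operator

/-- The exponential of an element of the Lie algebra. -/
noncomputable def expGL (ψ : LieAlg d) (i : Q) : GL (Fin (d i)) ℂ where
  val := NormedSpace.exp (ψ i)
  inv := NormedSpace.exp (-ψ i)
  val_inv := by
    rw [← Matrix.exp_add_of_commute _ _ (Commute.neg_right (Commute.refl (ψ i))), add_neg_cancel,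
      NormedSpace.exp_zero]
  inv_val := by
    rw [← Matrix.exp_add_of_commute _ _ (Commute.neg_left (Commute.refl (ψ i))), neg_add_cancel,
      NormedSpace.exp_zero]

variable [Fintype Q] [∀ i j : Q, Fintype (i ⟶ j)]

/-- Strict differentiability jointly in the group and the point serves twice: for the tangent to
one-parameter orbits, and for the open mapping argument on slices. -/
theorem hasStrictFDerivAt_act_expGL (x : RepSpace Q d) :
    HasStrictFDerivAt (fun p : LieAlg d × RepSpace Q d => act (expGL p.1) p.2)
      (LinearMap.toContinuousLinearMap
        ((inf.flip x) ∘ₗ LinearMap.fst ℂ (LieAlg d) (RepSpace Q d) +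
          LinearMap.snd ℂ (LieAlg d) (RepSpace Q d))) (0, x) := by
  refine hasStrictFDerivAt_pi'.mpr fun ⟨i, j, a, k, l⟩ => ?_
  have hexp : ∀ (i : Q) (L : LieAlg d × RepSpace Q d →L[ℂ] Matrix (Fin (d i)) (Fin (d i)) ℂ),
      L (0, x) = 0 → HasStrictFDerivAt (fun p => NormedSpace.exp (L p)) L (0, x) := by
    intro i L hL
    have h1 : HasStrictFDerivAt (NormedSpace.exp : Matrix (Fin (d i)) (Fin (d i)) ℂ → _)
        (1 : _ →L[ℂ] _) (L (0, x)) := by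
      rw [hL]
      exact hasStrictFDerivAt_exp_zero
    exact h1.comp _ L.hasStrictFDerivAt
  let L₁ : LieAlg d × RepSpace Q d →L[ℂ] Matrix (Fin (d j)) (Fin (d j)) ℂ :=
    LinearMap.toContinuousLinearMap (LinearMap.proj j ∘ₗ LinearMap.fst ℂ (LieAlg d) (RepSpace Q d))
  let L₂ : LieAlg d × RepSpace Q d →L[ℂ] Matrix (Fin (d i)) (Fin (d i)) ℂ :=
    LinearMap.toContinuousLinearMap
      (-(LinearMap.proj i ∘ₗ LinearMap.fst ℂ (LieAlg d) (RepSpace Q d)))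
  have h1 := hexp j L₁ rfl
  have h2 := hexp i L₂ (neg_zero)
  have hcoord : (fun p : LieAlg d × RepSpace Q d => act (expGL p.1) p.2 ⟨i, j, a, k, l⟩) =
      fun p => ∑ m, (∑ n, NormedSpace.exp (L₁ p) k n * p.2 ⟨i, j, a, n, m⟩) *
        NormedSpace.exp (L₂ p) m l := by
    funext p
    rfl
  have hent : ∀ (i : Q) (k l : Fin (d i)) {F : LieAlg d × RepSpace Q d → Matrix (Fin (d i)) (Fin (d i)) ℂ}
      {F' : LieAlg d × RepSpace Q d →L[ℂ] Matrix (Fin (d i)) (Fin (d i)) ℂ},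
      HasStrictFDerivAt F F' (0, x) → HasStrictFDerivAt (fun p => F p k l)
        ((LinearMap.toContinuousLinearMap (Matrix.entryLinearMap ℂ ℂ k l)).comp F') (0, x) :=
    fun i k l F F' h =>
      (LinearMap.toContinuousLinearMap (Matrix.entryLinearMap ℂ ℂ k l)).hasStrictFDerivAt.comp _ h
  have hx : ∀ c, HasStrictFDerivAt (fun p : LieAlg d × RepSpace Q d => p.2 c)
      ((ContinuousLinearMap.proj (R := ℂ) (φ := fun _ : RepCoord Q d => ℂ) c).comp
        (ContinuousLinearMap.snd ℂ (LieAlg d) (RepSpace Q d))) (0, x) := fun c =>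
    ((ContinuousLinearMap.proj (R := ℂ) (φ := fun _ : RepCoord Q d => ℂ) c).comp
        (ContinuousLinearMap.snd ℂ (LieAlg d) (RepSpace Q d))).hasStrictFDerivAt
  have hmul : ∀ {F G : LieAlg d × RepSpace Q d → ℂ} {F' G' : LieAlg d × RepSpace Q d →L[ℂ] ℂ},
      HasStrictFDerivAt F F' (0, x) → HasStrictFDerivAt G G' (0, x) →
      HasStrictFDerivAt (fun p => F p * G p) (F (0, x) • G' + G (0, x) • F') (0, x) :=
    fun hF hG => hF.mul hG
  have hsum : ∀ {n : ℕ} {F : Fin n → LieAlg d × RepSpace Q d → ℂ}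
      {F' : Fin n → LieAlg d × RepSpace Q d →L[ℂ] ℂ},
      (∀ m, HasStrictFDerivAt (F m) (F' m) (0, x)) →
      HasStrictFDerivAt (fun p => ∑ m, F m p) (∑ m, F' m) (0, x) :=
    fun h => HasStrictFDerivAt.fun_sum fun m _ => h m
  rw [hcoord]
  refine (hsum fun m => hmul (hsum fun n =>
    hmul (hent j k n h1) (hx ⟨i, j, a, n, m⟩)) (hent i m l h2)).congr_fderiv ?_
  have hL1 : L₁ (0, x) = 0 := rfl
  have hL2 : L₂ (0, x) = 0 := neg_zero
  have hE1 : NormedSpace.exp (L₁ (0, x)) = 1 := by rw [hL1, NormedSpace.exp_zero]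
  have hE2 : NormedSpace.exp (L₂ (0, x)) = 1 := by rw [hL2, NormedSpace.exp_zero]
  refine ContinuousLinearMap.ext fun ⟨ψ, y⟩ => ?_
  have hr : ∀ z : RepSpace Q d, z = (inf ψ x + y) → z ⟨i, j, a, k, l⟩ =
      (∑ n, ψ j k n * x ⟨i, j, a, n, l⟩ - ∑ n, x ⟨i, j, a, k, n⟩ * ψ i n l) + y ⟨i, j, a, k, l⟩ := by
    rintro _ rfl
    rfl
  refine Eq.trans ?_ (hr _ rfl).symm
  have he1 : ∀ n, ((LinearMap.toContinuousLinearMap (Matrix.entryLinearMap ℂ ℂ k n)).comp L₁)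
      (ψ, y) = ψ j k n := fun _ => rfl
  have he2 : ∀ n, ((LinearMap.toContinuousLinearMap (Matrix.entryLinearMap ℂ ℂ n l)).comp L₂)
      (ψ, y) = -ψ i n l := fun _ => rfl
  simp only [_root_.sum_apply, _root_.add_apply,
    _root_.smul_apply, he1, he2, hE1, hE2, Matrix.one_apply, smul_eq_mul,
    ContinuousLinearMap.comp_apply, ContinuousLinearMap.proj_apply, ContinuousLinearMap.coe_snd',
    ite_mul, one_mul, zero_mul, Finset.sum_add_distrib, Finset.sum_ite_eq, Finset.sum_ite_eq',
    Finset.mem_univ, if_true, mul_neg, Finset.sum_neg_distrib]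
  simp only [mul_comm (x _) (ψ j _ _)]
  ring

theorem hasDerivAt_act_expGL (ψ : LieAlg d) (x : RepSpace Q d) :
    HasDerivAt (fun s : ℂ => act (expGL (s • ψ)) x) (inf ψ x) 0 := by
  have h1 : HasDerivAt (fun s : ℂ => (s • ψ, x)) (ψ, (0 : RepSpace Q d)) 0 := by
    have h2 : HasDerivAt (fun s : ℂ => s • ψ) ψ 0 := by
      have h3 := (hasDerivAt_id (0 : ℂ)).smul_const ψ
      rw [one_smul] at h3
      exact h3
    exact h2.prodMk (hasDerivAt_const 0 x)
  have h3 := (hasStrictFDerivAt_act_expGL x).hasFDerivAt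
  rw [← zero_smul ℂ ψ] at h3
  have h4 := HasFDerivAt.comp_hasDerivAt (f := fun s : ℂ => (s • ψ, x)) (0 : ℂ) h3 h1
  exact h4.congr_deriv (add_zero (inf ψ x))

theorem linVF_inf_mem_logDer [DecidableEq (RepCoord Q d)] {D : Set (RepSpace Q d)}
    {f : MvPolynomial (RepCoord Q d) ℂ} (hf : IsReducedEquation D f) {x₀ : RepSpace Q d}
    (hD : Dᶜ = Set.range fun g => act g x₀) (ψ : LieAlg d) : linVF (inf ψ) ∈ logDer D := by
  refine hf.linVF_mem_logDer fun x hx => ⟨fun s => act (expGL (s • ψ)) x, ?_, fun s => ?_,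
    hasDerivAt_act_expGL ψ x⟩
  · have h : expGL ((0 : ℂ) • ψ) = 1 := by
      funext i
      refine Units.ext ?_
      change NormedSpace.exp ((0 : ℂ) • ψ i) = 1
      rw [zero_smul, NormedSpace.exp_zero]
    change act (expGL ((0 : ℂ) • ψ)) x = x
    rw [h, act_one]
  · exact (act_mem_iff hD _ _).mpr hx

end Exponential

/-- For `t` outside the finitely many eigenvalues, `t - ψ` is an element of the group commuting with
every representation. It acts trivially, so it is scalar, and so is `ψ`. -/
theorem eq_smul_one_of_inf_eq_zero [Fintype Q]
    (hk : ∀ g : ∀ i, GL (Fin (d i)) ℂ, (∀ x : RepSpace Q d, act g x = x) →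
      ∃ c : ℂ, ∀ i, (g i).1 = c • (1 : Matrix (Fin (d i)) (Fin (d i)) ℂ))
    {ψ : LieAlg d} (hψ : inf ψ = 0) : ∃ c : ℂ, ∀ i, ψ i = c • 1 := by
  have hfin : (⋃ i, spectrum ℂ (ψ i)).Finite := Set.finite_iUnion fun i => Matrix.finite_spectrum _
  obtain ⟨t, ht⟩ := hfin.exists_notMem
  have hu : ∀ i, IsUnit (algebraMap ℂ (Matrix (Fin (d i)) (Fin (d i)) ℂ) t - ψ i) := fun i => by
    by_contra h
    exact ht (Set.mem_iUnion.mpr ⟨i, h⟩)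
  obtain ⟨c, hc⟩ := hk (fun i => (hu i).unit) fun x => ext_mat fun {i j} a => by
    have h1 : ψ j * mat x a - mat x a * ψ i = 0 := by
      rw [← mat_inf, hψ]
      rfl
    have h2 : ((hu j).unit : Matrix (Fin (d j)) (Fin (d j)) ℂ) * mat x a =
        mat x a * ((hu i).unit : Matrix (Fin (d i)) (Fin (d i)) ℂ) := by
      rw [IsUnit.unit_spec, IsUnit.unit_spec, Matrix.sub_mul, Matrix.mul_sub, sub_eq_zero.mp h1,
        Algebra.algebraMap_eq_smul_one, Algebra.algebraMap_eq_smul_one, Matrix.smul_mul,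
        Matrix.mul_smul, Matrix.one_mul, Matrix.mul_one]
    rw [mat_act, h2, Matrix.mul_assoc, Units.mul_inv, Matrix.mul_one]
  refine ⟨t - c, fun i => ?_⟩
  have h := hc i
  rw [IsUnit.unit_spec, Algebra.algebraMap_eq_smul_one] at h
  rw [sub_smul, ← h]
  abel

end RepSpace

/-! ### Dimension of the group and unimodularity of its Lie algebra -/

namespace RepSpace

variable {Q : Type} [Quiver.{0} Q] {d : Q → ℕ} [Fintype Q]

section Orbit

variable [∀ i j : Q, Fintype (i ⟶ j)]

open scoped Matrix.Norms.Operator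

/-- An orbit with nonempty interior needs a group of dimension larger than that of the
representation space, as the scalars act trivially. -/
theorem card_lt_finrank_lieAlg [Nonempty Q] (hd : ∀ i, 1 ≤ d i) (x₀ : RepSpace Q d)
    (hopen : (interior (Set.range fun g => act g x₀)).Nonempty) :
    Fintype.card (RepCoord Q d) < Module.finrank ℂ (LieAlg d) := by
  by_contra! hlt
  have hfr : Module.finrank ℂ (LieAlg d) ≤ Module.finrank ℂ (RepSpace Q d) := by
    rwa [Module.finrank_fintype_fun_eq_card]
  obtain ⟨q, hq⟩ := finrank_le_iff_exists_linearMap.mp hfr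
  obtain ⟨p, hp⟩ := q.exists_leftInverse_of_injective (LinearMap.ker_eq_bot.mpr hq)
  -- If the Lie algebra were no larger than the representation space, the orbit map would extend
  -- through the retraction `p` to a map `F` between spaces of equal dimension. It is constant along
  -- rays, so its Jacobian vanishes and its image is a null set, as in Sard's theorem.
  let F : RepSpace Q d → RepSpace Q d := fun y c =>
    (p y c.2.1 * mat x₀ c.2.2.1 * Ring.inverse (p y c.1)) c.2.2.2.1 c.2.2.2.2
  let U : Set (RepSpace Q d) := {y | ∀ i, IsUnit (p y i)}
  have hdiff : ∀ y ∈ U, DifferentiableAt ℝ F y := by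
    intro y hy
    -- Lebesgue measure requires the real derivative.
    refine DifferentiableAt.restrictScalars ℝ (𝕜' := ℂ) (differentiableAt_pi.mpr fun c => ?_)
    obtain ⟨i, j, a, k, l⟩ := c
    have hp' : ∀ i : Q, Differentiable ℂ fun y => p y i := fun i =>
      (LinearMap.toContinuousLinearMap ((LinearMap.proj (R := ℂ)
        (φ := fun i : Q => Matrix (Fin (d i)) (Fin (d i)) ℂ) i) ∘ₗ p)).differentiable
    have hent : ∀ (i : Q) (k l : Fin (d i))
        {G : RepSpace Q d → Matrix (Fin (d i)) (Fin (d i)) ℂ}, DifferentiableAt ℂ G y →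
        DifferentiableAt ℂ (fun y => G y k l) y := fun i k l G h =>
      (LinearMap.toContinuousLinearMap (Matrix.entryLinearMap ℂ ℂ k l)).differentiableAt.comp y h
    have hinv : DifferentiableAt ℂ (fun y => Ring.inverse (p y i)) y :=
      DifferentiableAt.comp (g := (Ring.inverse : Matrix (Fin (d i)) (Fin (d i)) ℂ → _))
        (f := fun y => p y i) y (differentiableAt_inverse (hy i)) (hp' i y)
    have hF : (fun y => F y ⟨i, j, a, k, l⟩) = fun y =>
        ∑ m, (∑ n, p y j k n * x₀ ⟨i, j, a, n, m⟩) * Ring.inverse (p y i) m l := by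
      funext y
      rfl
    rw [hF]
    exact DifferentiableAt.fun_sum fun m _ => (DifferentiableAt.fun_sum fun n _ =>
      (hent j k n (hp' j y)).mul_const _).mul (hent i m l hinv)
  have hscale : ∀ y (s : ℂ), s ≠ 0 → F (s • y) = F y := by
    intro y s hs
    refine ext_mat fun {i j} a => ?_
    have h : (s • p y j) * mat x₀ a * Ring.inverse (s • p y i) =
        p y j * mat x₀ a * Ring.inverse (p y i) := by
      rw [← Matrix.nonsing_inv_eq_ringInverse, ← Matrix.nonsing_inv_eq_ringInverse]
      by_cases hu : IsUnit (p y i).det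
      · have hinv : (s • p y i)⁻¹ = s⁻¹ • (p y i)⁻¹ := by
          refine Matrix.inv_eq_left_inv ?_
          rw [Matrix.smul_mul, Matrix.mul_smul, smul_smul, inv_mul_cancel₀ hs, one_smul,
            Matrix.nonsing_inv_mul _ hu]
        rw [hinv, Matrix.smul_mul, Matrix.smul_mul, Matrix.mul_smul, smul_smul,
          mul_inv_cancel₀ hs, one_smul]
      · have hu' : ¬ IsUnit (s • p y i).det := by
          rw [Matrix.det_smul, isUnit_iff_ne_zero] at *
          exact fun h => hu (right_ne_zero_of_mul h)
        rw [Matrix.nonsing_inv_apply_not_isUnit _ hu, Matrix.nonsing_inv_apply_not_isUnit _ hu',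
          Matrix.mul_zero, Matrix.mul_zero]
    have h2 : p (s • y) = s • p y := map_smul p s y
    change p (s • y) j * mat x₀ a * Ring.inverse (p (s • y) i) =
        p y j * mat x₀ a * Ring.inverse (p y i)
    rw [h2]
    exact h
  have hdet : ∀ y ∈ U, (fderiv ℝ F y).det = 0 := by
    intro y hy
    refine (LinearMap.det_eq_zero_iff_ker_ne_bot (f := (fderiv ℝ F y).toLinearMap)).mpr
      -- The radial vector `y` lies in the kernel of the derivative, and `y ≠ 0` because `p y` is
      -- invertible of positive size.
      ((Submodule.ne_bot_iff _).mpr ⟨y, ?_, ?_⟩)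
    · have h1 : HasDerivAt (fun s : ℝ => (1 + s) • y) y 0 := by
        simpa using ((hasDerivAt_id (0 : ℝ)).const_add 1).smul_const y
      have h2 : HasFDerivAt F (fderiv ℝ F y) ((1 + (0 : ℝ)) • y) := by
        simpa using (hdiff y hy).hasFDerivAt
      have h3 : HasDerivAt (F ∘ fun s : ℝ => (1 + s) • y) (fderiv ℝ F y y) 0 :=
        h2.comp_hasDerivAt (0 : ℝ) h1
      have h4 : (F ∘ fun s : ℝ => (1 + s) • y) =ᶠ[nhds 0] fun _ => F y := by
        have h5 : ∀ᶠ s : ℝ in nhds 0, s ≠ -1 := isOpen_ne.mem_nhds (by norm_num)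
        filter_upwards [h5] with s hs
        have h6 : ((1 + s : ℝ) : ℂ) ≠ 0 := by
          intro h
          apply hs
          have := Complex.ofReal_eq_zero.mp h
          linarith
        have h7 := hscale y _ h6
        rwa [Complex.coe_smul] at h7
      exact (h3.unique ((hasDerivAt_const 0 (F y)).congr_of_eventuallyEq h4))
    · rintro rfl
      obtain ⟨i⟩ := ‹Nonempty Q›
      have h := hy i
      rw [map_zero] at h
      have : Nonempty (Fin (d i)) := ⟨⟨0, hd i⟩⟩
      exact not_isUnit_zero h
  have hzero : MeasureTheory.volume (F '' U) = 0 :=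
    MeasureTheory.addHaar_image_eq_zero_of_det_fderivWithin_eq_zero _
      (fun y hy => (hdiff y hy).hasFDerivAt.hasFDerivWithinAt) hdet
  have hsub : (Set.range fun g => act g x₀) ⊆ F '' U := by
    rintro _ ⟨g, rfl⟩
    have hpq : p (q fun i => (g i).1) = fun i => (g i).1 := LinearMap.congr_fun hp _
    refine ⟨q fun i => (g i).1, fun i => ?_, ext_mat fun {i j} a => ?_⟩
    · rw [hpq]
      exact (g i).isUnit
    · change p (q fun i => (g i).1) j * mat x₀ a * Ring.inverse (p (q fun i => (g i).1) i) = _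
      rw [hpq, Ring.inverse_unit]
      rfl
  exact (isOpen_interior.measure_pos _ hopen).ne'
    (MeasureTheory.measure_mono_null (interior_subset.trans hsub) hzero)

end Orbit

section Bracket

theorem finrank_ker_inf_le
    (hk : ∀ g : ∀ i, GL (Fin (d i)) ℂ, (∀ x : RepSpace Q d, act g x = x) →
      ∃ c : ℂ, ∀ i, (g i).1 = c • (1 : Matrix (Fin (d i)) (Fin (d i)) ℂ)) :
    Module.finrank ℂ (LinearMap.ker (inf : LieAlg d →ₗ[ℂ] Module.End ℂ (RepSpace Q d))) ≤ 1 := by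
  have h : LinearMap.ker (inf : LieAlg d →ₗ[ℂ] Module.End ℂ (RepSpace Q d)) ≤
      Submodule.span ℂ {(1 : LieAlg d)} := by
    intro ψ hψ
    obtain ⟨c, hc⟩ := eq_smul_one_of_inf_eq_zero hk hψ
    exact Submodule.mem_span_singleton.mpr ⟨c, funext fun i => (hc i).symm⟩
  exact (Submodule.finrank_mono h).trans ((finrank_span_le_card _).trans (by simp))

/-- The commutator with an element of the Lie algebra. -/
noncomputable def ad (ψ : LieAlg d) : LieAlg d →ₗ[ℂ] LieAlg d :=
  LinearMap.mulLeft ℂ ψ - LinearMap.mulRight ℂ ψ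

omit [Fintype Q] [Quiver Q] in
theorem ad_apply (ψ θ : LieAlg d) : ad ψ θ = ψ * θ - θ * ψ := rfl

omit [Fintype Q] in
theorem inf_ad (ψ θ : LieAlg d) : inf (ad ψ θ) = inf ψ * inf θ - inf θ * inf ψ := by
  refine LinearMap.ext fun x => ext_mat fun {i j} a => ?_
  have h : (ψ j * θ j - θ j * ψ j) * mat x a - mat x a * (ψ i * θ i - θ i * ψ i) =
      (ψ j * (θ j * mat x a - mat x a * θ i) - (θ j * mat x a - mat x a * θ i) * ψ i) -
      (θ j * (ψ j * mat x a - mat x a * ψ i) - (ψ j * mat x a - mat x a * ψ i) * θ i) := by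
    simp only [Matrix.mul_sub, Matrix.sub_mul, Matrix.mul_assoc]
    abel
  exact h

omit [Quiver Q] in
-- On the matrix unit `E_kl` the diagonal entry of `ad ψ` is `ψ_kk - ψ_ll`, and these cancel in the
-- sum.
theorem trace_ad (ψ : LieAlg d) : LinearMap.trace ℂ _ (ad ψ) = 0 := by
  classical
  rw [LinearMap.trace_eq_matrix_trace ℂ
    (Pi.basis fun i => Matrix.stdBasis ℂ (Fin (d i)) (Fin (d i))), Matrix.trace,
    Fintype.sum_sigma]
  refine Finset.sum_eq_zero fun i _ => ?_
  have h : ∀ kl : Fin (d i) × Fin (d i), (LinearMap.toMatrix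
      (Pi.basis fun i => Matrix.stdBasis ℂ (Fin (d i)) (Fin (d i)))
      (Pi.basis fun i => Matrix.stdBasis ℂ (Fin (d i)) (Fin (d i))) (ad ψ)).diag ⟨i, kl⟩ =
      ψ i kl.1 kl.1 - ψ i kl.2 kl.2 := by
    rintro ⟨k, l⟩
    rw [Matrix.diag_apply, LinearMap.toMatrix_apply, Pi.basis_repr, Pi.basis_apply, ad_apply]
    dsimp only
    have h1 : (ψ * Pi.single i (Matrix.stdBasis ℂ (Fin (d i)) (Fin (d i)) (k, l)) -
        Pi.single i (Matrix.stdBasis ℂ (Fin (d i)) (Fin (d i)) (k, l)) * ψ : LieAlg d) i =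
        ψ i * Matrix.single k l 1 - Matrix.single k l 1 * ψ i := by
      rw [Pi.sub_apply, Pi.mul_apply, Pi.mul_apply, Pi.single_eq_same, Matrix.stdBasis_eq_single]
    rw [h1]
    change (ψ i * Matrix.single k l (1 : ℂ) - Matrix.single k l (1 : ℂ) * ψ i :
      Matrix (Fin (d i)) (Fin (d i)) ℂ) k l = _
    simp
  rw [Finset.sum_congr rfl fun kl _ => h kl, Fintype.sum_prod_type]
  simp only [Finset.sum_sub_distrib]
  rw [Finset.sum_comm, sub_self]

end Bracket

end RepSpace

/-! ### Linear algebra of the graded orbit map -/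

section GradedMap

variable {V W : Type*} [AddCommGroup V] [Module ℂ V] [Module.Finite ℂ V]
  [AddCommGroup W] [Module ℂ W] [Module.Finite ℂ W]
  {p p' : Module.End ℂ V} {P P' : Module.End ℂ W} {c : V →ₗ[ℂ] W}

/-- Let `c : V → W` commute with the gradings of degrees `1, 0, -1` with projections `p, p'` to the
degrees `1, -1` of `V` and `P, P'` to those of `W`. If `c` is injective in degree `1` and surjective
in degree `-1` and `p - p'` has trace zero, then `P - P'` has nonnegative trace, and if the trace
vanishes then `c` is surjective in degree `1` too. -/
theorem exists_trace_sub_eq_of_graded (hp : IsIdempotentElem p) (hp' : IsIdempotentElem p')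
    (hP : IsIdempotentElem P) (hP' : IsIdempotentElem P') (hc : ∀ v, c (p v) = P (c v))
    (hc' : ∀ v, c (p' v) = P' (c v)) (hinj : ∀ v, c v = 0 → p v = 0)
    (hsurj : ∀ w, ∃ v, c v = P' w) (htr : LinearMap.trace ℂ V (p - p') = 0) :
    ∃ χ : ℝ, 0 ≤ χ ∧ LinearMap.trace ℂ W (P - P') = χ ∧ (χ = 0 → ∀ w, ∃ v, c v = P w) := by
  -- Traces of idempotents are ranks, and `rank P ≥ rank p = rank p' ≥ rank P'`. Equality of the
  -- ends forces `c` to be onto in degree `1`.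
  have h1 : Module.finrank ℂ (LinearMap.range p) = Module.finrank ℂ (LinearMap.range p') := by
    rw [map_sub, (LinearMap.IsIdempotentElem.isProj_range _ hp).trace, (LinearMap.IsIdempotentElem.isProj_range _ hp').trace, sub_eq_zero] at htr
    exact_mod_cast htr
  have hmap : (LinearMap.range p).map c ≤ LinearMap.range P := by
    rintro _ ⟨_, ⟨v, rfl⟩, rfl⟩
    exact ⟨c v, (hc v).symm⟩
  have hmap' : LinearMap.range P' ≤ (LinearMap.range p').map c := by
    rintro _ ⟨w, rfl⟩
    obtain ⟨v, hv⟩ := hsurj w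
    refine ⟨p' v, ⟨v, rfl⟩, ?_⟩
    rw [hc', hv]
    exact LinearMap.congr_fun hP'.eq w
  have h2 : Module.finrank ℂ ((LinearMap.range p).map c) =
      Module.finrank ℂ (LinearMap.range p) := by
    have h : Function.Injective (c.domRestrict (LinearMap.range p)) := by
      rw [← LinearMap.ker_eq_bot, LinearMap.ker_eq_bot']
      rintro ⟨_, v, rfl⟩ hv
      refine Subtype.ext ?_
      have h3 : p (p v) = p v := LinearMap.congr_fun hp.eq v
      exact h3.symm.trans (hinj _ hv)
    rw [← LinearMap.range_domRestrict]
    exact LinearMap.finrank_range_of_inj h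
  have h3 := Submodule.finrank_mono hmap
  have h4 := (Submodule.finrank_mono hmap').trans (Submodule.finrank_map_le c _)
  refine ⟨(Module.finrank ℂ (LinearMap.range P) : ℝ) - Module.finrank ℂ (LinearMap.range P'),
    sub_nonneg.mpr (by exact_mod_cast (by omega)), ?_, fun h0 => ?_⟩
  · rw [map_sub, (LinearMap.IsIdempotentElem.isProj_range _ hP).trace, (LinearMap.IsIdempotentElem.isProj_range _ hP').trace]
    push_cast
    rfl
  · have h5 : Module.finrank ℂ (LinearMap.range P) = Module.finrank ℂ (LinearMap.range P') := by
      exact_mod_cast sub_eq_zero.mp h0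
    have h6 : (LinearMap.range p).map c = LinearMap.range P :=
      Submodule.eq_of_le_of_finrank_le hmap (by omega)
    intro w
    obtain ⟨v, -, hv⟩ : P w ∈ (LinearMap.range p).map c := h6 ▸ LinearMap.mem_range_self P w
    exact ⟨v, hv⟩

omit [Module.Finite ℂ V] [Module.Finite ℂ W] in
/-- In the situation of `exists_trace_sub_eq_of_graded`, the endomorphism `P - P'` can be changed by
a map with values in the range of `c` to one with eigenvalues `0` and `1`. -/
theorem exists_add_comp_spectrum_nonneg (hP : IsIdempotentElem P)
    (hc : ∀ v, c (p v) = P (c v)) (hc' : ∀ v, c (p' v) = P' (c v))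
    (hsurj : ∀ w, ∃ v, c v = P' w) :
    ∃ R : W →ₗ[ℂ] V, ∀ (μ : ℂ) (w : W), w ≠ 0 → (P - P' + c ∘ₗ R) w = μ • w →
      ∃ r : ℝ, 0 ≤ r ∧ μ = r := by
  obtain ⟨s, hs⟩ := c.exists_generalizedInverse
  -- As `c s c = c` and `P - P'` preserves the image of `c`, the corrected map is zero on that
  -- image. On the quotient it is induced by `P`, since degree `-1` lies in the image.
  refine ⟨-(s ∘ₗ (P - P')), fun μ w hw h => ?_⟩
  have hK : P w - P' w - c (s ((P - P') w)) = μ • w := by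
    rw [← h]
    simp [sub_eq_add_neg]
  have hT : w ∈ LinearMap.range c → μ = 0 := by
    rintro ⟨v, rfl⟩
    have h1 : (P - P') (c v) = c (p v - p' v) := by
      rw [map_sub, hc, hc']
      rfl
    rw [h1, hs, map_sub, hc, hc', sub_self] at hK
    exact (smul_eq_zero.mp hK.symm).resolve_right hw
  by_cases h0 : μ = 0
  · exact ⟨0, le_rfl, by simpa using h0⟩
  obtain ⟨v, hv⟩ := hsurj w
  have h1 : P w - μ • w = c (v + s ((P - P') w)) := by
    rw [map_add, hv, ← hK]
    abel
  -- Applying `P` modulo the image of `c`: for `μ ≠ 0, 1` this puts `P w`, and then `w`, into the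
  -- image, where only `μ = 0` is possible.
  have h2 : (1 - μ) • P w = c (p (v + s ((P - P') w))) := by
    have hPP : P (P w) = P w := LinearMap.congr_fun hP.eq w
    rw [hc, ← h1, map_sub, hPP, map_smul, sub_smul, one_smul]
  by_cases h3 : μ = 1
  · exact ⟨1, zero_le_one, by simpa using h3⟩
  · refine absurd (hT ?_) h0
    have h4 : P w ∈ LinearMap.range c := by
      rw [← Submodule.smul_mem_iff _ (sub_ne_zero.mpr (Ne.symm h3)), h2]
      exact LinearMap.mem_range_self _ _
    rw [← Submodule.smul_mem_iff _ h0]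
    have h5 : μ • w = P w - c (v + s ((P - P') w)) := by
      rw [← h1]
      abel
    rw [h5]
    exact sub_mem h4 (LinearMap.mem_range_self _ _)

end GradedMap

/-! ### The grading by an idempotent endomorphism and transversal slices -/

namespace RepSpace

variable {Q : Type} [Quiver.{0} Q] {d : Q → ℕ}

/-- The linear maps `θ ↦ (x_i θ_i y_i)_i` on the Lie algebra. -/
noncomputable def sandwich (x y : LieAlg d) : Module.End ℂ (LieAlg d) :=
  LinearMap.mulLeft ℂ x ∘ₗ LinearMap.mulRight ℂ y

omit [Quiver Q] in
theorem sandwich_apply (x y θ : LieAlg d) : sandwich x y θ = x * (θ * y) := rfl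

/-- The linear maps `η ↦ (x_j η_a y_i)_{a : i → j}` on the representation space. -/
noncomputable def repSandwich (x y : LieAlg d) : Module.End ℂ (RepSpace Q d) where
  toFun η c := (x c.2.1 * (mat η c.2.2.1 * y c.1)) c.2.2.2.1 c.2.2.2.2
  map_add' η ζ := ext_mat fun {i j} a => by
    have h : x j * ((mat η a + mat ζ a) * y i) =
        x j * (mat η a * y i) + x j * (mat ζ a * y i) := by
      rw [Matrix.add_mul, Matrix.mul_add]
    exact h
  map_smul' s η := ext_mat fun {i j} a => by
    have h : x j * ((s • mat η a) * y i) = s • (x j * (mat η a * y i)) := by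
      rw [Matrix.smul_mul, Matrix.mul_smul]
    exact h

theorem mat_repSandwich (x y : LieAlg d) (η : RepSpace Q d) {i j : Q} (a : i ⟶ j) :
    mat (repSandwich x y η) a = x j * (mat η a * y i) := rfl

omit [Quiver Q] in
theorem isIdempotentElem_sandwich {x y : LieAlg d} (hx : x * x = x) (hy : y * y = y) :
    IsIdempotentElem (sandwich x y) := by
  refine LinearMap.ext fun θ => ?_
  change x * ((x * (θ * y)) * y) = x * (θ * y)
  rw [mul_assoc x (θ * y) y, mul_assoc θ y y, hy, ← mul_assoc x x, hx]

theorem isIdempotentElem_repSandwich {x y : LieAlg d} (hx : x * x = x) (hy : y * y = y) :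
    IsIdempotentElem (repSandwich x y : Module.End ℂ (RepSpace Q d)) := by
  refine LinearMap.ext fun η => ext_mat fun {i j} a => ?_
  have hx' : x j * x j = x j := congrFun hx j
  have hy' : y i * y i = y i := congrFun hy i
  change mat (repSandwich x y (repSandwich x y η)) a = mat (repSandwich x y η) a
  simp only [mat_repSandwich]
  rw [Matrix.mul_assoc (x j), Matrix.mul_assoc (mat η a), hy', ← Matrix.mul_assoc (x j) (x j), hx']

omit [Quiver Q] in
theorem ad_eq_sandwich_sub (e : LieAlg d) : ad e = sandwich e (1 - e) - sandwich (1 - e) e := by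
  refine LinearMap.ext fun θ => ?_
  rw [LinearMap.sub_apply, sandwich_apply, sandwich_apply, ad_apply]
  noncomm_ring

theorem inf_eq_repSandwich_sub (e : LieAlg d) :
    (inf e : Module.End ℂ (RepSpace Q d)) = repSandwich e (1 - e) - repSandwich (1 - e) e := by
  refine LinearMap.ext fun η => ext_mat fun {i j} a => ?_
  rw [LinearMap.sub_apply, mat_sub, mat_repSandwich, mat_repSandwich, mat_inf, Pi.sub_apply,
    Pi.sub_apply, Pi.one_apply, Pi.one_apply, Matrix.mul_sub, Matrix.mul_sub, Matrix.sub_mul,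
    Matrix.mul_one, Matrix.one_mul]
  abel

/-- The infinitesimal orbit map commutes with the multiplications by endomorphisms of `M`. -/
theorem inf_sandwich {M : RepSpace Q d} {x y : LieAlg d}
    (hx : ∀ {i j : Q} (a : i ⟶ j), x j * mat M a = mat M a * x i)
    (hy : ∀ {i j : Q} (a : i ⟶ j), y j * mat M a = mat M a * y i) (θ : LieAlg d) :
    inf (sandwich x y θ) M = repSandwich x y (inf θ M) := by
  refine ext_mat fun {i j} a => ?_
  have h : x j * (θ j * y j) * mat M a - mat M a * (x i * (θ i * y i)) =
      x j * ((θ j * mat M a - mat M a * θ i) * y i) := by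
    rw [Matrix.sub_mul, Matrix.mul_sub, ← Matrix.mul_assoc (mat M a) (x i), ← hx a,
      Matrix.mul_assoc (x j) (θ j * y j), Matrix.mul_assoc (θ j) (y j), hy a]
    simp only [Matrix.mul_assoc]
  exact h

/-- In matrices the map `ringel M M` is the infinitesimal orbit map at `M`, so `Ext(M, M)` is the
normal space of the orbit. -/
theorem exists_inf_eq_of_ringel_surjective {M : RepSpace Q d}
    (h : Function.Surjective (QRep.ringel M.toQRep M.toQRep)) (z : RepSpace Q d) :
    ∃ ψ, inf ψ M = z := by
  obtain ⟨φ', hφ⟩ := h fun i j a => (mat z a).mulVecLin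
  let φ : ∀ i, (Fin (d i) → ℂ) →ₗ[ℂ] Fin (d i) → ℂ := φ'
  have h1 : ∀ {i j : Q} (a : i ⟶ j), φ j ∘ₗ
      Matrix.toLin' (mat M a) - Matrix.toLin' (mat M a) ∘ₗ φ i = Matrix.toLin' (mat z a) :=
    fun {i j} a => congrFun (congrFun (congrFun hφ i) j) a
  refine ⟨fun i => LinearMap.toMatrix' (φ i), ext_mat fun {i j} a => ?_⟩
  have h2 := congrArg LinearMap.toMatrix' (h1 a)
  rwa [map_sub, LinearMap.toMatrix'_comp, LinearMap.toMatrix'_comp, LinearMap.toMatrix'_toLin',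
    LinearMap.toMatrix'_toLin'] at h2

/-- The matrix form of an orthogonal splitting of a point of the representation space. -/
theorem exists_idempotent_of_hasOrthogonalSplitting {M : RepSpace Q d}
    (h : M.toQRep.HasOrthogonalSplitting) :
    ∃ e : LieAlg d, e * e = e ∧ e ≠ 0 ∧ e ≠ 1 ∧
      (∀ {i j : Q} (a : i ⟶ j), e j * mat M a = mat M a * e i) ∧
      (∀ η : RepSpace Q d, ∃ ψ, inf ψ M = repSandwich (1 - e) e η) ∧
      ∀ ψ, inf ψ M = 0 → sandwich e (1 - e) ψ = 0 := by
  obtain ⟨e, hid, ⟨i₀, hi₀⟩, ⟨i₁, hi₁⟩, hExt, hHom⟩ := h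
  let ε : ∀ i, (Fin (d i) → ℂ) →ₗ[ℂ] Fin (d i) → ℂ := e.app
  let E : LieAlg d := fun i => LinearMap.toMatrix' (ε i)
  have hE : ∀ i, Matrix.toLin' (E i) = ε i := fun i => Matrix.toLin'_toMatrix' _
  have hcomm : ∀ {i j : Q} (a : i ⟶ j), E j * mat M a = mat M a * E i := by
    intro i j a
    have h1 : Matrix.toLin' (mat M a) ∘ₗ ε i = ε j ∘ₗ Matrix.toLin' (mat M a) := e.comm a
    have h2 := congrArg LinearMap.toMatrix' h1
    rw [LinearMap.toMatrix'_comp, LinearMap.toMatrix'_comp, LinearMap.toMatrix'_toLin'] at h2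
    exact h2.symm
  refine ⟨E, ?_, ?_, ?_, hcomm, fun η => ?_, fun ψ hψ => ?_⟩
  · funext i
    have h1 : ε i ∘ₗ ε i = ε i := LinearMap.ext (hid i)
    have h2 := congrArg LinearMap.toMatrix' h1
    rwa [LinearMap.toMatrix'_comp] at h2
  · intro h0
    refine hi₀ ?_
    change ε i₀ = 0
    rw [← hE, h0, Pi.zero_apply, map_zero]
  · intro h0
    refine hi₁ ?_
    change ε i₁ = LinearMap.id
    rw [← hE, h0, Pi.one_apply, Matrix.toLin'_one]
  · obtain ⟨φ', hφ⟩ := hExt fun i j a => (mat η a).mulVecLin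
    let φ : ∀ i, (Fin (d i) → ℂ) →ₗ[ℂ] Fin (d i) → ℂ := φ'
    refine ⟨fun i => LinearMap.toMatrix' (φ i), ext_mat fun {i j} a => ?_⟩
    have h1 : φ j ∘ₗ
        Matrix.toLin' (mat M a) - Matrix.toLin' (mat M a) ∘ₗ φ i =
        (LinearMap.id - ε j) ∘ₗ Matrix.toLin' (mat η a) ∘ₗ ε i := hφ i j a
    have h2 := congrArg LinearMap.toMatrix' h1
    rwa [map_sub, LinearMap.toMatrix'_comp, LinearMap.toMatrix'_comp, LinearMap.toMatrix'_comp,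
      LinearMap.toMatrix'_comp, LinearMap.toMatrix'_toLin', LinearMap.toMatrix'_toLin', map_sub,
      LinearMap.toMatrix'_id] at h2
  · let φ : QRep.Hom M.toQRep M.toQRep :=
      { app := fun i => Matrix.toLin' (ψ i)
        comm := fun {i j} a => by
          have h1 : ψ j * mat M a - mat M a * ψ i = 0 := by
            rw [← mat_inf, hψ]
            rfl
          have h2 := congrArg Matrix.toLin' (sub_eq_zero.mp h1)
          rw [Matrix.toLin'_mul, Matrix.toLin'_mul] at h2
          exact h2.symm }
    funext i
    have h1 : ε i ∘ₗ Matrix.toLin' (ψ i) ∘ₗ (LinearMap.id - ε i) = 0 := hHom φ i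
    have h2 := congrArg LinearMap.toMatrix' h1
    rwa [LinearMap.toMatrix'_comp, LinearMap.toMatrix'_comp, LinearMap.toMatrix'_toLin', map_sub,
      LinearMap.toMatrix'_id, map_zero] at h2

section Density

variable [Fintype Q] [∀ i j : Q, Fintype (i ⟶ j)]

open scoped Matrix.Norms.Operator

/-- An affine slice through `M` that is transversal to the orbit of `M` meets every dense set that
is stable under the group. -/
theorem exists_mem_slice_of_dense {M : RepSpace Q d} {U : Set (RepSpace Q d)} (hU : Dense U)
    (hact : ∀ g x, act g x ∈ U → x ∈ U) (S : Submodule ℂ (RepSpace Q d))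
    (hS : ∀ w, ∃ ψ, ∃ s ∈ S, inf ψ M + s = w) : ∃ s ∈ S, M + s ∈ U := by
  let A : LieAlg d × S →L[ℂ] LieAlg d × RepSpace Q d :=
    (ContinuousLinearMap.id ℂ (LieAlg d)).prodMap S.subtypeL
  have h1 : HasStrictFDerivAt (fun q : LieAlg d × S => ((q.1, M + q.2) : LieAlg d × RepSpace Q d))
      A 0 := by
    have h2 : HasStrictFDerivAt (fun q : LieAlg d × S => ((0, M) : LieAlg d × RepSpace Q d) + A q)
        A 0 := A.hasStrictFDerivAt.const_add _
    have h3 : (fun q : LieAlg d × S => ((q.1, M + q.2) : LieAlg d × RepSpace Q d)) =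
        fun q => ((0, M) : LieAlg d × RepSpace Q d) + A q := by
      funext q
      exact Prod.ext (zero_add q.1).symm rfl
    rw [h3]
    exact h2
  have h2 := hasStrictFDerivAt_act_expGL M
  have h3 : ((0 : LieAlg d × S).1, M + ((0 : LieAlg d × S).2 : RepSpace Q d)) = (0, M) :=
    Prod.ext rfl (add_zero M)
  rw [← h3] at h2
  have h4 := HasStrictFDerivAt.comp
    (f := fun q : LieAlg d × S => ((q.1, M + q.2) : LieAlg d × RepSpace Q d)) (0 : LieAlg d × S)
    h2 h1
  -- By transversality `(ψ, s) ↦ exp(ψ) (M + s)` is a submersion at the origin, so its image is a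
  -- neighbourhood of `M` and meets `U`; stability of `U` removes `exp(ψ)`.
  have h5 := h4.map_nhds_eq_of_surj (LinearMap.range_eq_top.mpr fun w => by
    obtain ⟨ψ, s, hs, hw⟩ := hS w
    exact ⟨(ψ, ⟨s, hs⟩), hw⟩)
  have h6 := h5 ▸ Filter.image_mem_map (Filter.univ_mem (f := nhds (0 : LieAlg d × S)))
  obtain ⟨_, hy, q, -, rfl⟩ := hU.inter_nhds_nonempty h6
  exact ⟨q.2, q.2.2, hact _ _ hy⟩

end Density

end RepSpace

/-! ### The main theorem -/

theorem mainTheorem5 {Q : Type} [Fintype Q] [DecidableEq Q] [Quiver.{0} Q]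
    [∀ i j : Q, Fintype (i ⟶ j)] [∀ i j : Q, DecidableEq (i ⟶ j)]
    (hQ : IsConnectedQuiver Q) (d : Q → ℕ) (D : Set (RepSpace Q d))
    (hD : DefinesLinearFreeDivisor d D)
    (M : RepSpace Q d) (hM : M ∈ D) (hreg : ¬ (RepSpace.toQRep M).IsRegular) :
    IsWeaklyQuasihomogeneousAt D M := by
  classical
  open RepSpace in
  obtain ⟨⟨i₀⟩, -⟩ := hQ
  have : Nonempty Q := ⟨i₀⟩
  obtain ⟨x₀, hx₀⟩ := hD.discriminant
  have hLFD := hD.linearFree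
  obtain ⟨f, hf⟩ := hLFD.1.exists_isReducedEquation
  have hdense : Dense Dᶜ := hLFD.1.dense_compl
  have hk : ∀ g : ∀ i, GL (Fin (d i)) ℂ, (∀ x : RepSpace Q d, act g x = x) →
      ∃ c : ℂ, ∀ i, (g i).1 = c • (1 : Matrix (Fin (d i)) (Fin (d i)) ℂ) :=
    fun g => (hD.group_kernel g).mp
  have hopen : IsOpen Dᶜ := by
    obtain ⟨g, -, hg⟩ := hLFD.1
    have h : Dᶜ = {x | MvPolynomial.eval x g ≠ 0} := by
      rw [hg]
      rfl
    rw [h]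
    exact isOpen_ne.preimage (MvPolynomial.continuous_eval g)
  have hrank : Fintype.card (RepCoord Q d) + Module.finrank ℂ (LinearMap.ker
      (inf : LieAlg d →ₗ[ℂ] Module.End ℂ (RepSpace Q d))) ≤ Module.finrank ℂ (LieAlg d) := by
    have h1 := card_lt_finrank_lieAlg hD.sincere x₀ (by
      rw [← hx₀, hopen.interior_eq]
      exact hdense.nonempty)
    have h2 := finrank_ker_inf_le hk
    omega
  have hlog := linVF_inf_mem_logDer hf hx₀
  rcases hD.ringel_surjective_or_hasOrthogonalSplitting M hreg with hsurj | hsplit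
  · exact absurd hM
      (hLFD.notMem_of_surjective hf inf hlog hrank (exists_inf_eq_of_ringel_surjective hsurj))
  obtain ⟨e, hid, h0, h1, hcomm, hExt, hHom⟩ := exists_idempotent_of_hasOrthogonalSplitting hsplit
  have hid' : (1 - e) * (1 - e) = 1 - e := IsIdempotentElem.one_sub hid
  have hcomm' : ∀ {i j : Q} (a : i ⟶ j), (1 - e) j * mat M a = mat M a * (1 - e) i := by
    intro i j a
    rw [Pi.sub_apply, Pi.sub_apply, Matrix.sub_mul, Matrix.mul_sub, hcomm a, Pi.one_apply,
      Pi.one_apply, Matrix.one_mul, Matrix.mul_one]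
  have heM : inf e M = 0 := ext_mat fun {i j} a => by
    rw [mat_inf, hcomm a, sub_self]
    rfl
  have hc := inf_sandwich hcomm hcomm'
  have hc' := inf_sandwich hcomm' hcomm
  -- `V` is the Lie algebra with degree `1` part `e θ (1 - e)`, `W` is `Rep(Q, d)`, and `c` is the
  -- infinitesimal orbit map at `M`.
  obtain ⟨χ, hχ, hχe, hχ0⟩ := exists_trace_sub_eq_of_graded (c := inf.flip M)
    (isIdempotentElem_sandwich hid hid') (isIdempotentElem_sandwich hid' hid)
    (isIdempotentElem_repSandwich hid hid') (isIdempotentElem_repSandwich hid' hid)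
    hc hc' hHom hExt (by rw [← ad_eq_sandwich_sub, trace_ad])
  obtain ⟨R, hR⟩ := exists_add_comp_spectrum_nonneg (c := inf.flip M)
    (isIdempotentElem_repSandwich hid hid') hc hc' hExt
  rw [← inf_eq_repSandwich_sub] at hχe hR
  have hL : linVF (inf e) f = MvPolynomial.C (χ : ℂ) * f := by
    rw [← hχe]
    refine hLFD.linVF_eq_trace_mul hf inf hlog hrank e (ad e) (inf_ad e) (trace_ad e) fun θ hθ => ?_
    obtain ⟨c, hcθ⟩ := eq_smul_one_of_inf_eq_zero hk hθ
    have h : θ = c • 1 := funext hcθ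
    rw [h, map_smul, ad_apply, mul_one, one_mul, sub_self, smul_zero]
  have hχpos : 0 < χ := by
    refine lt_of_le_of_ne hχ fun h => ?_
    -- If `χ = 0`, the orbit of `M` is tangent to all of degrees `1` and `-1`, so the degree `0`
    -- part, the kernel of `inf e`, is a transversal slice.
    obtain ⟨s, hs, hsU⟩ := exists_mem_slice_of_dense hdense
      (fun g x hx => fun hxD => hx ((act_mem_iff hx₀ g x).mpr hxD)) (LinearMap.ker (inf e))
      (M := M) fun w => by
        obtain ⟨v, hv⟩ := hχ0 h.symm w
        obtain ⟨v', hv'⟩ := hExt w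
        refine ⟨v + v', w - (repSandwich e (1 - e) w + repSandwich (1 - e) e w), ?_, ?_⟩
        · have h1 : repSandwich e (1 - e) (repSandwich e (1 - e) w) = repSandwich e (1 - e) w :=
            LinearMap.congr_fun (isIdempotentElem_repSandwich hid hid').eq w
          have h2 : repSandwich (1 - e) e (repSandwich (1 - e) e w) = repSandwich (1 - e) e w :=
            LinearMap.congr_fun (isIdempotentElem_repSandwich hid' hid).eq w
          have h3 : ∀ {x y z t : LieAlg d}, x * z = 0 →
              repSandwich x y (repSandwich z t w) = 0 := fun {x y z t} hxz =>
            ext_mat fun {i j} a => by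
              have hxz' : x j * z j = 0 := congrFun hxz j
              rw [mat_repSandwich, mat_repSandwich, Matrix.mul_assoc (z j), ← Matrix.mul_assoc,
                hxz', Matrix.zero_mul]
              rfl
          have he : e * (1 - e) = 0 := by rw [mul_sub, hid, mul_one, sub_self]
          have he' : (1 - e) * e = 0 := by rw [sub_mul, hid, one_mul, sub_self]
          rw [LinearMap.mem_ker, inf_eq_repSandwich_sub]
          simp only [LinearMap.sub_apply, map_sub, map_add, h1, h2, h3 he, h3 he']
          abel
        · have h1 : inf (v + v') M = repSandwich e (1 - e) w + repSandwich (1 - e) e w := by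
            rw [map_add, LinearMap.add_apply, ← hv, hv']
            rfl
          rw [h1, add_sub_cancel]
    -- The field of `e` vanishes at a point of the open orbit, so `e` is a scalar; as an idempotent
    -- it is `0` or `1`, against the choice of `e`.
    have h2 : inf e (M + s) = 0 := by rw [map_add, heM, zero_add]; exact hs
    have h3 := hLFD.eq_zero_of_apply_eq_zero hf inf hlog hrank hsU h2
    obtain ⟨c, hce⟩ := eq_smul_one_of_inf_eq_zero hk h3
    have hec : e = c • 1 := funext hce
    have : Nonempty (Fin (d i₀)) := ⟨⟨0, hD.sincere i₀⟩⟩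
    have h4 : (c * c - c) • (1 : LieAlg d) = 0 := by
      have h5 := hid
      rw [hec, smul_mul_smul_comm, mul_one] at h5
      rw [sub_smul, h5, sub_self]
    have h5 : c * c - c = 0 := by
      refine (smul_eq_zero.mp h4).resolve_right fun h => ?_
      exact one_ne_zero (congrFun h i₀)
    have h6 : c * (c - 1) = 0 := by rw [← h5]; ring
    rcases mul_eq_zero.mp h6 with h7 | h7
    · exact h0 (by rw [hec, h7, zero_smul])
    · exact h1 (by rw [hec, sub_eq_zero.mp h7, one_smul])
  -- The correcting field with coefficient `x_i - M_i` is the action of `R` applied to the `i`-th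
  -- basis vector; its value at `M` is the `i`-th column of `c ∘ R`.
  exact hf.isWeaklyQuasihomogeneousAt hχpos hL heM
    (R := fun i => inf (R (Pi.single i 1))) (fun i => hlog _)
    (K := inf e + inf.flip M ∘ₗ R) (fun i => rfl) hR
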